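/- **Problem.** Let $0<\alpha<1$, $\varepsilon,T,L>0$, $\Omega=(0,L)^2$, and let $f\in C^1(\mathbb R)$ satisfy $f(-1)\le 0\le f(1)$ (e.g. $f(u)=u^3-u$). Let $\phi$ solve $$D_t^\alpha\phi-\varepsilon^2\Delta\phi+f(\phi)=0\ \text{ in }\Omega\times(0,T],\qquad \partial_{\boldsymbol n}\phi=0\ \text{ on }\partial\Omega,\qquad D_t^\alpha\phi(t)=\frac1{\Gamma(1-\alpha)}\int_0^t(t-s)^{-\alpha}\phi'(s)\,ds .$$ Let $\phi$ be continuous in $t$ on $[0,T]$, let $\phi\in L^\infty(0,T;W^{4,\infty}(\Omega))$, and suppose that for some $\sigma\in(0,1)$ and $0<t<T$ $$\|\phi'(t)\|_{L^\infty(\Omega)}\le C(1+t^{\sigma-1}),\qquad \|\phi''(t)\|_{L^\infty(\Omega)}\le C(1+t^{\sigma-2}).$$ **Scheme.** Fix $\kappa\ge\max_{[-1,1]}f'$ and put $f_\kappa(u)=f(u)-\kappa u$. Let $h=L/M$ with $M\ge1$, let $\Pi_h$ be the restriction to the cell centres $((i-\frac12)h,(j-\frac12)h)$, $1\le i,j\le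 M$, let $\Delta_h$ be the five-point Laplacian on the cell-centred grid with vanishing normal differences across boundary faces, and let $\|\cdot\|_\infty$ be the maximum over the grid points. Let $0=t_0<\dots<t_N=T$, $\tau_k=t_k-t_{k-1}$, $\tau=\max_k\tau_k$. Let $\omega_i,s_i>0$ $(1\le i\le N_\epsilon)$ satisfy, for a tolerance $\epsilon>0$ and a cut-off $0<\delta\le\min_k\tau_k$, $$\Big|\frac{1}{\Gamma(1-\alpha)t^{\alpha}}-\sum_{i=1}^{N_\epsilon}\omega_i e^{-s_it}\Big|\le\epsilon\quad\text{for }t\in(\delta,T],\qquad \epsilon\le\min\Big\{\frac{T^{-\alpha}}{3\Gamma(1-\alpha)},\ \frac{\alpha}{\Gamma(2-\alpha)\max(1,\tau)^{\alpha}}\Big\}.$$ Put $$A^{(n)}_0=\frac1{\Gamma(1-\alpha)\tau_{n+1}}\int_{t_n}^{t_{n+1}}(t_{n+1}-r)^{-\alpha}dr,\qquad A^{(n)}_{n-k}=\frac1{\tau_{k+1}}\sum_{i}\omega_i\int_{t_k}^{t_{k+1}}e^{-s_i(t_{n+1}-r)}dr\quad(0\le k<n),$$ $$\mathcal L^{n}(V)=A^{(n)}_0(V-\Phi^n)+\sum_{k=0}^{n-1}A^{(n)}_{n-k}(\Phi^{k+1}-\Phi^k).$$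 Starting from $\Phi^0=\Pi_h\phi(0)$, the grid functions $\Phi^{*,n+1}$ and $\Phi^{n+1}$, $0\le n\le N-1$, are defined by $$\mathcal L^{n}(\Phi^{*,n+1})+\kappa\Phi^{*,n+1}-\varepsilon^2\Delta_h\Phi^{*,n+1}+f_\kappa(\Phi^n)=0,\qquad \mathcal L^{n}(\Phi^{n+1})+\kappa\Phi^{n+1}-\varepsilon^2\Delta_h\Phi^{n+1}+f_\kappa(\Phi^{*,n+1})=0 .$$ Put $e^n=\Phi^n-\Pi_h\phi(t_n)$. **Theorem.** Assume that $\|\Phi^0\|_\infty\le1$ and that $\tau_k/\tau_{k+1}\le\rho$ for $1\le k\le N-1$. (i) For $0\le n\le N-1$, with $\hat t_{n+1}=\max(1,t_{n+1})$ and with maxima over the empty set equal to $0$, $$\|e^{n+1}\|_\infty\le C\Big(\tau_1^{1+2\alpha}+\frac{\tau_1^\sigma}{\sigma}+t_{n+1}^\alpha\Big(\max_{1\le k\le n}\big(\tau_{k+1}^{1+\alpha}+t_k^{\sigma-1}\tau_{k+1}^{1+\alpha}\big)+\max_{1\le k\le n}t_k^{\sigma-2}\tau_{k+1}^{2-\alpha}\Big)+\frac{\epsilon}{\sigma}t_{n+1}^\alpha\hat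 t_{n+1}^{\,2}+h^2\Big).$$ (ii) If moreover, for some $\gamma\ge1$ and $C_\gamma>0$, $\tau_k\le C_\gamma\tau\min(1,t_k^{1-1/\gamma})$ for $1\le k\le N$ and $t_k\le C_\gamma t_{k-1}$ for $2\le k\le N$, then $$\|e^{n+1}\|_\infty\le C\big(\tau^{\min\{1+\alpha,\,2-\alpha,\,\gamma\sigma\}}+\epsilon+h^2\big),\qquad 0\le n\le N-1 .$$ The constants $C$ depend only on $\alpha,\varepsilon,T,L,\kappa,\rho,\sigma,f,\phi$ (and on $\gamma,C_\gamma$ in (ii)); they do not depend on $M$, on the time mesh, on $n$, or on the sum of exponentials ($\epsilon,\delta,N_\epsilon,\omega_i,s_i$). No restriction on the time-step sizes is imposed. -/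

import Mathlib

noncomputable section

namespace TFAC

/-! ### The continuous problem -/

/-- The Riemann-Liouville fractional integral of order `β`, started at `0`. -/
def riemannLiouville (β : ℝ) (u : ℝ → ℝ) (t : ℝ) : ℝ :=
  (1 / Real.Gamma β) * ∫ s in (0 : ℝ)..t, (t - s) ^ (β - 1) * u s

/-- The Caputo derivative of order `α`. -/
def caputo (α : ℝ) (u : ℝ → ℝ) (t : ℝ) : ℝ :=
  riemannLiouville (1 - α) (deriv u) t

/-- The two-dimensional Laplacian `u_xx + u_yy`. -/
def laplacian (u : ℝ → ℝ → ℝ) (x y : ℝ) : ℝ :=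
  iteratedDeriv 2 (fun s => u s y) x + iteratedDeriv 2 (fun s => u x s) y

/-- `φ t x y` is a solution on `(0,L)² × (0,T]` of the time-fractional Allen-Cahn equation
`D_t^α φ - ε² Δφ + f(φ) = 0` with homogeneous Neumann boundary condition. The normal derivatives
on the four edges are one-sided derivatives from inside the square. -/
structure IsSolution (α ε T L : ℝ) (f : ℝ → ℝ) (φ : ℝ → ℝ → ℝ → ℝ) : Prop where
  equation : ∀ t ∈ Set.Ioc 0 T, ∀ x ∈ Set.Ioo 0 L, ∀ y ∈ Set.Ioo 0 L,
    caputo α (fun s => φ s x y) t - ε ^ 2 * laplacian (φ t) x y + f (φ t x y) = 0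
  neumann_left : ∀ t ∈ Set.Ioc 0 T, ∀ y ∈ Set.Icc 0 L,
    HasDerivWithinAt (fun s => φ t s y) 0 (Set.Icc 0 L) 0
  neumann_right : ∀ t ∈ Set.Ioc 0 T, ∀ y ∈ Set.Icc 0 L,
    HasDerivWithinAt (fun s => φ t s y) 0 (Set.Icc 0 L) L
  neumann_bottom : ∀ t ∈ Set.Ioc 0 T, ∀ x ∈ Set.Icc 0 L,
    HasDerivWithinAt (fun s => φ t x s) 0 (Set.Icc 0 L) 0
  neumann_top : ∀ t ∈ Set.Ioc 0 T, ∀ x ∈ Set.Icc 0 L,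
    HasDerivWithinAt (fun s => φ t x s) 0 (Set.Icc 0 L) L

/-- `‖φ'(t)‖_∞ ≤ Cφ (1 + t^(σ-1))` and `‖φ''(t)‖_∞ ≤ Cφ (1 + t^(σ-2))` for `0 < t < T`, for a
function that is continuous in time on `[0,T]`. -/
structure TimeRegular (σ Cφ T L : ℝ) (φ : ℝ → ℝ → ℝ → ℝ) : Prop where
  continuousOn : ∀ x ∈ Set.Ioo 0 L, ∀ y ∈ Set.Ioo 0 L,
    ContinuousOn (fun s => φ s x y) (Set.Icc 0 T)
  differentiableAt : ∀ t ∈ Set.Ioo 0 T, ∀ x ∈ Set.Ioo 0 L, ∀ y ∈ Set.Ioo 0 L,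
    DifferentiableAt ℝ (fun s => φ s x y) t
  differentiableAt_deriv : ∀ t ∈ Set.Ioo 0 T, ∀ x ∈ Set.Ioo 0 L, ∀ y ∈ Set.Ioo 0 L,
    DifferentiableAt ℝ (deriv (fun s => φ s x y)) t
  deriv_bound : ∀ t ∈ Set.Ioo 0 T, ∀ x ∈ Set.Ioo 0 L, ∀ y ∈ Set.Ioo 0 L,
    |deriv (fun s => φ s x y) t| ≤ Cφ * (1 + t ^ (σ - 1))
  deriv_deriv_bound : ∀ t ∈ Set.Ioo 0 T, ∀ x ∈ Set.Ioo 0 L, ∀ y ∈ Set.Ioo 0 L,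
    |deriv (deriv (fun s => φ s x y)) t| ≤ Cφ * (1 + t ^ (σ - 2))

/-- The closed square `[0,L]²`. -/
def closedSquare (L : ℝ) : Set (ℝ × ℝ) := Set.Icc 0 L ×ˢ Set.Icc 0 L

/-- `φ ∈ L^∞(0,T; W^{4,∞}((0,L)²))`, with bound `K`. On the (convex) square, `W^{4,∞}` is the space
of functions that are three times continuously differentiable up to the boundary, with bounded
derivatives and Lipschitz third derivatives. -/
def SpaceRegular (K T L : ℝ) (φ : ℝ → ℝ → ℝ → ℝ) : Prop :=
  ∀ t ∈ Set.Ioc 0 T,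
    ContDiffOn ℝ 3 (fun p : ℝ × ℝ => φ t p.1 p.2) (closedSquare L) ∧
    (∀ k : ℕ, k ≤ 3 → ∀ p ∈ closedSquare L,
      ‖iteratedFDerivWithin ℝ k (fun p : ℝ × ℝ => φ t p.1 p.2) (closedSquare L) p‖ ≤ K) ∧
    (∀ p ∈ closedSquare L, ∀ q ∈ closedSquare L,
      ‖iteratedFDerivWithin ℝ 3 (fun p : ℝ × ℝ => φ t p.1 p.2) (closedSquare L) p
        - iteratedFDerivWithin ℝ 3 (fun p : ℝ × ℝ => φ t p.1 p.2) (closedSquare L) q‖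
        ≤ K * ‖p - q‖)

/-! ### Space discretization: cell-centred grid functions -/

/-- Grid functions on the `M × M` cell centres; the norm on this type is the maximum norm. -/
abbrev Grid (M : ℕ) : Type := Fin M → Fin M → ℝ

/-- Pointwise restriction to the cell centres `((i + 1/2) h, (j + 1/2) h)`, `0 ≤ i, j < M`,
where `h = L / M`. -/
def restrict (L : ℝ) (M : ℕ) (u : ℝ → ℝ → ℝ) : Grid M :=
  fun i j => u (((i : ℝ) + 1 / 2) * (L / M)) (((j : ℝ) + 1 / 2) * (L / M))

/-- The `x`-component of the discrete gradient, on the `M + 1` vertical lines of cell faces; it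
vanishes on the boundary faces. -/
def gradX {M : ℕ} (h : ℝ) (U : Grid M) : Fin (M + 1) → Fin M → ℝ := fun i j =>
  if hi : 0 < (i : ℕ) ∧ (i : ℕ) < M then
    (U ⟨i, hi.2⟩ j - U ⟨i - 1, lt_of_le_of_lt (Nat.sub_le _ _) hi.2⟩ j) / h
  else 0

/-- The `y`-component of the discrete gradient; it vanishes on the boundary faces. -/
def gradY {M : ℕ} (h : ℝ) (U : Grid M) : Fin M → Fin (M + 1) → ℝ := fun i j =>
  if hj : 0 < (j : ℕ) ∧ (j : ℕ) < M then
    (U i ⟨j, hj.2⟩ - U i ⟨j - 1, lt_of_le_of_lt (Nat.sub_le _ _) hj.2⟩) / h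
  else 0

/-- The discrete divergence. -/
def discreteDiv {M : ℕ} (h : ℝ) (V : Fin (M + 1) → Fin M → ℝ) (W : Fin M → Fin (M + 1) → ℝ) :
    Grid M := fun i j =>
  (V i.succ j - V i.castSucc j) / h + (W i j.succ - W i j.castSucc) / h

/-- The discrete Neumann Laplacian. -/
def discreteLaplacian {M : ℕ} (h : ℝ) (U : Grid M) : Grid M :=
  discreteDiv h (gradX h U) (gradY h U)

/-! ### Time meshes -/

/-- `0 = t_0 < t_1 < ... < t_N = T`; the values of `t` beyond `N` are irrelevant. -/
structure IsMesh (T : ℝ) (N : ℕ) (t : ℕ → ℝ) : Prop where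
  zero : t 0 = 0
  last : t N = T
  lt : ∀ k < N, t k < t (k + 1)

/-- The step `τ_k = t_k - t_{k-1}`, for `k ≥ 1`. -/
def step (t : ℕ → ℝ) (k : ℕ) : ℝ := t k - t (k - 1)

/-- The maximum of `g k` over `1 ≤ k ≤ n`; it is `0` for `n = 0`. -/
def maxOver (n : ℕ) (g : ℕ → ℝ) : ℝ := ⨆ k : Set.Icc 1 n, g k

/-- The maximal step `τ`. -/
def maxStep (t : ℕ → ℝ) (N : ℕ) : ℝ := maxOver N (step t)

/-- The step ratios `τ_k / τ_{k+1}` are at most `ρ`. -/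
def RatioBound (ρ : ℝ) (N : ℕ) (t : ℕ → ℝ) : Prop :=
  ∀ k, 1 ≤ k → k + 1 ≤ N → step t k / step t (k + 1) ≤ ρ

/-- The graded-mesh condition with grading parameter `γ` and constant `Cγ`. -/
def AssG (γ Cγ : ℝ) (N : ℕ) (t : ℕ → ℝ) : Prop :=
  (∀ k, 1 ≤ k → k ≤ N → step t k ≤ Cγ * maxStep t N * min 1 (t k ^ (1 - 1 / γ))) ∧
  (∀ k, 2 ≤ k → k ≤ N → t k ≤ Cγ * t (k - 1))

/-! ### The fast L1 formula -/

/-- `∑ wᵢ exp(-sᵢ t)`, with positive weights and nodes, approximates `t^(-α) / Γ(1-α)` up to the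
absolute error `tol` on `(δ, T]`. -/
structure IsSOE (α T δ tol : ℝ) {m : ℕ} (w s : Fin m → ℝ) : Prop where
  weight_pos : ∀ i, 0 < w i
  node_pos : ∀ i, 0 < s i
  error : ∀ t ∈ Set.Ioc δ T,
    |1 / (Real.Gamma (1 - α) * t ^ α) - ∑ i, w i * Real.exp (-(s i) * t)| ≤ tol

/-- The kernel `A^{(n)}_{n-k}`, `0 ≤ k ≤ n`, of the fast L1 formula: the exact L1 weight on the
last interval `k = n`, the sum-of-exponentials weight on the earlier intervals. -/
def fastKernel (α : ℝ) (t : ℕ → ℝ) {m : ℕ} (w s : Fin m → ℝ) (n k : ℕ) : ℝ :=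
  if k = n then
    1 / (Real.Gamma (1 - α) * step t (n + 1)) * ∫ r in (t n)..(t (n + 1)), (t (n + 1) - r) ^ (-α)
  else
    1 / step t (k + 1) *
      ∑ i, w i * ∫ r in (t k)..(t (k + 1)), Real.exp (-(s i) * (t (n + 1) - r))

/-- The fast L1 approximation of the Caputo derivative at `t_{n+1}`, for the history
`Φ^0, ..., Φ^n` and the new value `V` at `t_{n+1}`. -/
def fastL1 (α : ℝ) (t : ℕ → ℝ) {m : ℕ} (w s : Fin m → ℝ) {M : ℕ} (Φ : ℕ → Grid M) (n : ℕ)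
    (V : Grid M) : Grid M :=
  fastKernel α t w s n n • (V - Φ n) +
    ∑ k ∈ Finset.range n, fastKernel α t w s n k • (Φ (k + 1) - Φ k)

/-! ### The predictor-corrector scheme -/

/-- The stabilized nonlinearity `f_κ(u) = f(u) - κ u`. -/
def stabilized (f : ℝ → ℝ) (κ u : ℝ) : ℝ := f u - κ * u

/-- One linear solve: `V` satisfies
`L_t V + κ V - ε² Δ_h V + f_κ(W) = 0` at `t_{n+1}`, for the history `Φ^0, ..., Φ^n`. -/
def LinearStep (α ε L κ : ℝ) (f : ℝ → ℝ) (t : ℕ → ℝ) {m : ℕ} (w s : Fin m → ℝ) {M : ℕ}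
    (Φ : ℕ → Grid M) (n : ℕ) (W V : Grid M) : Prop :=
  ∀ i j, fastL1 α t w s Φ n V i j + κ * V i j - ε ^ 2 * discreteLaplacian (L / M) V i j
    + stabilized f κ (W i j) = 0

/-- `Φ^n` and the predictors `Φ^{*,n}` are produced by the fast linear predictor-corrector
stabilized L1 scheme with initial value `φ₀`. -/
structure IsSchemeSolution (α ε L κ : ℝ) (f : ℝ → ℝ) (φ₀ : ℝ → ℝ → ℝ) (N : ℕ) (t : ℕ → ℝ)
    {m : ℕ} (w s : Fin m → ℝ) {M : ℕ} (Φ Φstar : ℕ → Grid M) : Prop where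
  init : Φ 0 = restrict L M φ₀
  predictor : ∀ n < N, LinearStep α ε L κ f t w s Φ n (Φ n) (Φstar (n + 1))
  corrector : ∀ n < N, LinearStep α ε L κ f t w s Φ n (Φstar (n + 1)) (Φ (n + 1))

/-- An admissible run of the scheme for the data `φ(0)`: a grid, a time mesh with step ratios
bounded by `ρ`, a sum of exponentials that is accurate up to `tol` beyond the smallest step, with
`tol` below the threshold, and the resulting grid functions; the initial grid values lie
in `[-1,1]`. -/
structure IsRun (α ε T L κ ρ : ℝ) (f : ℝ → ℝ) (φ : ℝ → ℝ → ℝ → ℝ) (N : ℕ) (t : ℕ → ℝ)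
    (δ tol : ℝ) {m : ℕ} (w s : Fin m → ℝ) {M : ℕ} (Φ Φstar : ℕ → Grid M) : Prop where
  grid_pos : 0 < M
  mesh : IsMesh T N t
  ratio : RatioBound ρ N t
  cutoff_pos : 0 < δ
  cutoff_le : ∀ k, 1 ≤ k → k ≤ N → δ ≤ step t k
  soe : IsSOE α T δ tol w s
  tol_pos : 0 < tol
  tol_le : tol ≤ min (T ^ (-α) / (3 * Real.Gamma (1 - α)))
    (α / (Real.Gamma (2 - α) * (max 1 (maxStep t N)) ^ α))
  scheme : IsSchemeSolution α ε L κ f (φ 0) N t w s Φ Φstar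
  init_le : ‖Φ 0‖ ≤ 1

end TFAC

end

namespace TFAC

open Set

/-! ### The discrete convolution operator -/

/-! Everything rests on a comparison principle. The fast kernels are positive and increase towards
the newest interval. Summation by parts therefore shows that, for a nonpositive history, the
discrete derivative is at least its diagonal part (`mul_le_convDiff`). Together with the maximum
principle for the discrete Neumann Laplacian, this makes one implicit step order preserving
(`stepOp_comparison`). Comparison with the constant 1 keeps predictor and corrector in `[-1,1]`, so
`f_κ` acts as a Lipschitz function, and the error equations are linear inequalities to which a
barrier can be applied.

The barrier in `exists_stability_constant` is `16 X b - 2 (shifted g) + ψ`, one piece for each kind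
of term. The sequence `b` (`exists_barrier`) is bounded, increasing and piecewise constant, and it
dominates the Lipschitz terms. It is multiplied by a large factor about once per fixed time `η`.
Either the current step contains a jump, or a jump lies at distance at most `η`, where the kernel is
large. Hence no restriction on the time steps is needed. The shifted sequence absorbs the truncation
error in time. On history intervals that error is bounded by kernel increments times local scales `g
k`, and the discrete derivative of the shifted `g` produces exactly these sums (`convDiff_shift`),
leaving only a multiple of the diagonal term `a n * g n`. The grid function `ψ`, of size `h²`,
absorbs the truncation error in space, which is only `O(h)` in the boundary cells. It is built from
a quadratic profile whose flux is cut off at the walls (`secondDiff_consistency`).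

The kernel properties come from the two thresholds on the tolerance. One gives the lower bound by
`2/3` of the exact kernel. The other, with convexity of the exponentials, gives monotonicity in the
quantitative form `soeSum_sub_le_fastKernel_sub`.

The powers in the rate have three sources: `2 - α` is the L1 truncation error; `1 + α` is the
predictor's lag `φ(t (n+1)) - φ(t n)` divided by the diagonal kernel, which gains `τ^α`; `σ` on the
first step is the initial singularity. On a graded mesh these combine into the stated minimum. -/

/-- The discrete convolution derivative with kernel `a`, for the history `v 0, ..., v n` and the
new value `V`. -/
def convDiff (a : ℕ → ℝ) (v : ℕ → ℝ) (n : ℕ) (V : ℝ) : ℝ :=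
  a n * (V - v n) + ∑ k ∈ Finset.range n, a k * (v (k + 1) - v k)

theorem convDiff_self (a v : ℕ → ℝ) (n : ℕ) :
    convDiff a v n (v (n + 1)) = ∑ k ∈ Finset.range (n + 1), a k * (v (k + 1) - v k) := by
  rw [convDiff, Finset.sum_range_succ, add_comm]

theorem convDiff_sub (a v z : ℕ → ℝ) (n : ℕ) (V Z : ℝ) :
    convDiff a (fun k => v k - z k) n (V - Z) = convDiff a v n V - convDiff a z n Z := by
  have : ∀ k, a k * (v (k + 1) - z (k + 1) - (v k - z k)) =
      a k * (v (k + 1) - v k) - a k * (z (k + 1) - z k) := fun k => by ring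
  simp only [convDiff, this, Finset.sum_sub_distrib]
  ring

theorem convDiff_neg (a v : ℕ → ℝ) (n : ℕ) (V : ℝ) :
    convDiff a (fun k => -v k) n (-V) = -convDiff a v n V := by
  have := convDiff_sub a (fun _ => 0) v n 0 V
  simpa [convDiff] using this

theorem convDiff_const (a : ℕ → ℝ) (c : ℝ) (n : ℕ) (V : ℝ) :
    convDiff a (fun _ => c) n V = a n * (V - c) := by
  simp [convDiff]

/-- Summation by parts: the sum equals `a n * d n - a 0 * d 0 - ∑ (a (k+1) - a k) * d (k+1)`, and
the last two contributions are nonnegative for nonpositive `d`. -/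
theorem mul_le_sum_of_nonpos {a d : ℕ → ℝ} {n : ℕ} (ha0 : 0 ≤ a 0)
    (ha : ∀ k < n, a k ≤ a (k + 1)) (hd : ∀ k ≤ n, d k ≤ 0) :
    a n * d n ≤ ∑ k ∈ Finset.range n, a k * (d (k + 1) - d k) := by
  induction n with
  | zero => simpa using mul_nonpos_of_nonneg_of_nonpos ha0 (hd 0 le_rfl)
  | succ n ih =>
    rw [Finset.sum_range_succ]
    have h1 := ih (fun k hk => ha k (by omega)) (fun k hk => hd k (by omega))
    have h2 := mul_le_mul_of_nonpos_right (ha n (by omega)) (hd (n + 1) le_rfl)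
    nlinarith

/-- With a nonpositive history, the convolution derivative dominates its diagonal part. -/
theorem mul_le_convDiff {a d : ℕ → ℝ} {n : ℕ} (ha0 : 0 ≤ a 0)
    (ha : ∀ k < n, a k ≤ a (k + 1)) (hd : ∀ k ≤ n, d k ≤ 0) (D : ℝ) :
    a n * D ≤ convDiff a d n D := by
  have := mul_le_sum_of_nonpos ha0 ha hd
  rw [convDiff]
  linarith

/-- Lower bound of the convolution derivative of a monotone sequence by one window. -/
theorem mul_sub_le_convDiff {a b : ℕ → ℝ} {n j : ℕ} {c : ℝ} (hj : j ≤ n)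
    (ha : ∀ k ≤ n, 0 ≤ a k) (hc : ∀ k, j ≤ k → k ≤ n → c ≤ a k)
    (hb : ∀ k ≤ n, b k ≤ b (k + 1)) :
    c * (b (n + 1) - b j) ≤ convDiff a b n (b (n + 1)) := by
  rw [convDiff_self, ← Finset.sum_range_add_sum_Ico _ (show j ≤ n + 1 by omega),
    ← Finset.sum_Ico_sub _ (show j ≤ n + 1 by omega), Finset.mul_sum]
  have h1 : 0 ≤ ∑ k ∈ Finset.range j, a k * (b (k + 1) - b k) :=
    Finset.sum_nonneg fun k hk => by
      have hk' := Finset.mem_range.1 hk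
      exact mul_nonneg (ha k (by omega)) (sub_nonneg.2 (hb k (by omega)))
  have h2 : ∑ k ∈ Finset.Ico j (n + 1), c * (b (k + 1) - b k)
      ≤ ∑ k ∈ Finset.Ico j (n + 1), a k * (b (k + 1) - b k) :=
    Finset.sum_le_sum fun k hk => by
      have hk' := Finset.mem_Ico.1 hk
      exact mul_le_mul_of_nonneg_right (hc k hk'.1 (by omega)) (sub_nonneg.2 (hb k (by omega)))
  linarith

/-- The convolution derivative of the shifted sequence `0, g 0, g 1, ...`. -/
theorem convDiff_shift (a g : ℕ → ℝ) (n : ℕ) :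
    convDiff a (fun k => if k = 0 then 0 else g (k - 1)) n (g n) =
      a n * g n - ∑ k ∈ Finset.range n, (a (k + 1) - a k) * g k := by
  have key := convDiff_self a (fun k => if k = 0 then 0 else g (k - 1)) n
  simp only [Nat.add_eq_zero_iff, one_ne_zero, and_false, if_false, Nat.add_sub_cancel] at key
  rw [key]
  clear key
  induction n with
  | zero => simp
  | succ n ih =>
    rw [Finset.sum_range_succ, ih, Finset.sum_range_succ]
    simp only [Nat.add_eq_zero_iff, one_ne_zero, and_false, if_false, Nat.add_sub_cancel]
    ring

/-- The nonnegative weights `a (k+1) - a k` telescope to at most `a n`, so the memory part of a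
residual is no larger than a diagonal term. -/
theorem sum_diff_mul_le {a g : ℕ → ℝ} {n : ℕ} {X : ℝ} (ha0 : 0 ≤ a 0) (hX : 0 ≤ X)
    (ha : ∀ k < n, a k ≤ a (k + 1)) (hg : ∀ k < n, g k ≤ X) :
    ∑ k ∈ Finset.range n, (a (k + 1) - a k) * g k ≤ a n * X := by
  calc ∑ k ∈ Finset.range n, (a (k + 1) - a k) * g k
      ≤ ∑ k ∈ Finset.range n, (a (k + 1) - a k) * X :=
        Finset.sum_le_sum fun k hk => by
          have hk' := Finset.mem_range.1 hk
          exact mul_le_mul_of_nonneg_left (hg k hk') (sub_nonneg.2 (ha k hk'))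
    _ = (a n - a 0) * X := by rw [← Finset.sum_mul, Finset.sum_range_sub]
    _ ≤ a n * X := by nlinarith

/-! ### The discrete Laplacian -/

theorem gradX_sub {M : ℕ} (h : ℝ) (U V : Grid M) :
    gradX h (U - V) = gradX h U - gradX h V := by
  ext i j
  simp only [gradX, Pi.sub_apply]
  split_ifs <;> ring

theorem gradY_sub {M : ℕ} (h : ℝ) (U V : Grid M) :
    gradY h (U - V) = gradY h U - gradY h V := by
  ext i j
  simp only [gradY, Pi.sub_apply]
  split_ifs <;> ring

theorem discreteLaplacian_sub {M : ℕ} (h : ℝ) (U V : Grid M) :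
    discreteLaplacian h (U - V) = discreteLaplacian h U - discreteLaplacian h V := by
  ext i j
  simp only [discreteLaplacian, discreteDiv, gradX_sub, gradY_sub, Pi.sub_apply]
  ring

theorem discreteLaplacian_const {M : ℕ} (h c : ℝ) :
    discreteLaplacian h (fun _ _ => c : Grid M) = 0 := by
  ext i j
  simp [discreteLaplacian, discreteDiv, gradX, gradY]

theorem discreteLaplacian_neg {M : ℕ} (h : ℝ) (U : Grid M) :
    discreteLaplacian h (-U) = -discreteLaplacian h U := by
  have h1 := discreteLaplacian_sub h (0 : Grid M) U
  have h0 : discreteLaplacian h (0 : Grid M) = 0 := discreteLaplacian_const h 0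
  rw [h0, zero_sub, zero_sub] at h1
  exact h1

theorem discreteLaplacian_const_add {M : ℕ} (h c : ℝ) (U : Grid M) :
    discreteLaplacian h (fun i j => c + U i j) = discreteLaplacian h U := by
  have h1 := discreteLaplacian_sub h (fun i j => c + U i j) (fun _ _ => c)
  rw [discreteLaplacian_const, sub_zero] at h1
  rw [← h1]
  congr 1
  ext i j
  simp

/-- The discrete Laplacian is nonpositive at a maximum point. -/
theorem discreteLaplacian_nonpos_of_max {M : ℕ} {h : ℝ} (hh : 0 < h) (U : Grid M) (i j : Fin M)
    (hmax : ∀ i' j', U i' j' ≤ U i j) : discreteLaplacian h U i j ≤ 0 := by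
  have h1 : gradX h U i.succ j ≤ 0 := by
    unfold gradX
    split_ifs with hi
    · refine div_nonpos_of_nonpos_of_nonneg (sub_nonpos.2 ?_) hh.le
      have : (⟨(i.succ : ℕ) - 1, lt_of_le_of_lt (Nat.sub_le _ _) hi.2⟩ : Fin M) = i := by
        ext; simp
      rw [this]; exact hmax _ _
    · exact le_rfl
  have h2 : 0 ≤ gradX h U i.castSucc j := by
    unfold gradX
    split_ifs with hi
    · refine div_nonneg (sub_nonneg.2 ?_) hh.le
      exact hmax _ _
    · exact le_rfl
  have h3 : gradY h U i j.succ ≤ 0 := by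
    unfold gradY
    split_ifs with hi
    · refine div_nonpos_of_nonpos_of_nonneg (sub_nonpos.2 ?_) hh.le
      have : (⟨(j.succ : ℕ) - 1, lt_of_le_of_lt (Nat.sub_le _ _) hi.2⟩ : Fin M) = j := by
        ext; simp
      rw [this]; exact hmax _ _
    · exact le_rfl
  have h4 : 0 ≤ gradY h U i j.castSucc := by
    unfold gradY
    split_ifs with hi
    · refine div_nonneg (sub_nonneg.2 ?_) hh.le
      exact hmax _ _
    · exact le_rfl
  have h5 : (gradX h U i.succ j - gradX h U i.castSucc j) / h ≤ 0 :=
    div_nonpos_of_nonpos_of_nonneg (by linarith) hh.le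
  have h6 : (gradY h U i j.succ - gradY h U i j.castSucc) / h ≤ 0 :=
    div_nonpos_of_nonpos_of_nonneg (by linarith) hh.le
  exact add_nonpos h5 h6

/-- The discrete maximum principle. -/
theorem nonpos_of_discrete_elliptic {M : ℕ} {h c ε : ℝ} (hh : 0 < h) (hc : 0 < c) (U : Grid M)
    (hU : ∀ i j, c * U i j - ε ^ 2 * discreteLaplacian h U i j ≤ 0) (i j : Fin M) :
    U i j ≤ 0 := by
  obtain ⟨p, -, hp⟩ := Finset.exists_max_image (Finset.univ : Finset (Fin M × Fin M))
    (fun p => U p.1 p.2) ⟨(i, j), Finset.mem_univ _⟩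
  have h1 := discreteLaplacian_nonpos_of_max hh U p.1 p.2
    (fun i' j' => hp (i', j') (Finset.mem_univ _))
  have h2 := hU p.1 p.2
  have h3 : ε ^ 2 * discreteLaplacian h U p.1 p.2 ≤ 0 :=
    mul_nonpos_of_nonneg_of_nonpos (sq_nonneg _) h1
  have h4 : U p.1 p.2 ≤ 0 := by
    by_contra! hcon
    have := mul_pos hc hcon
    linarith
  exact (hp (i, j) (Finset.mem_univ _)).trans h4

/-- The implicit operator of one time step. -/
noncomputable def stepOp {M : ℕ} (h ε κ : ℝ) (a : ℕ → ℝ) (n : ℕ) (v : ℕ → Grid M) (V : Grid M)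
    (i j : Fin M) : ℝ :=
  convDiff a (fun k => v k i j) n (V i j) + κ * V i j - ε ^ 2 * discreteLaplacian h V i j

theorem stepOp_neg {M : ℕ} (h ε κ : ℝ) (a : ℕ → ℝ) (n : ℕ) (v : ℕ → Grid M) (V : Grid M)
    (i j : Fin M) :
    stepOp h ε κ a n (fun k => -v k) (-V) i j = -stepOp h ε κ a n v V i j := by
  have h1 := convDiff_neg a (fun k => v k i j) n (V i j)
  simp only [stepOp, discreteLaplacian_neg, Pi.neg_apply]
  rw [h1]; ring

theorem stepOp_sub {M : ℕ} (h ε κ : ℝ) (a : ℕ → ℝ) (n : ℕ) (v z : ℕ → Grid M) (V Z : Grid M)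
    (i j : Fin M) :
    stepOp h ε κ a n (fun k => v k - z k) (V - Z) i j =
      stepOp h ε κ a n v V i j - stepOp h ε κ a n z Z i j := by
  have h1 := convDiff_sub a (fun k => v k i j) (fun k => z k i j) n (V i j) (Z i j)
  simp only [stepOp, discreteLaplacian_sub, Pi.sub_apply]
  rw [h1]; ring

/-- Comparison principle for one time step. -/
theorem stepOp_comparison {M : ℕ} {h ε κ : ℝ} {a : ℕ → ℝ} {n : ℕ} (hh : 0 < h) (hκ : 0 ≤ κ)
    (ha0 : 0 ≤ a 0) (ha : ∀ k < n, a k ≤ a (k + 1)) (han : 0 < a n)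
    {v z : ℕ → Grid M} {V Z : Grid M} (hvz : ∀ k ≤ n, ∀ i j, v k i j ≤ z k i j)
    (hVZ : ∀ i j, stepOp h ε κ a n v V i j ≤ stepOp h ε κ a n z Z i j) (i j : Fin M) :
    V i j ≤ Z i j := by
  -- For the difference of the two sides the history is nonpositive, so the memory can be dropped;
  -- what remains is an elliptic inequality with zero-order coefficient `a n + κ`.
  have key := nonpos_of_discrete_elliptic (c := a n + κ) (ε := ε) hh (by linarith) (V - Z) ?_ i j
  · simpa using key
  intro i j
  have h1 := stepOp_sub h ε κ a n v z V Z i j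
  have h2 := mul_le_convDiff ha0 ha (d := fun k => v k i j - z k i j)
    (fun k hk => sub_nonpos.2 (hvz k hk i j)) (V i j - Z i j)
  have h3 := hVZ i j
  simp only [stepOp, Pi.sub_apply] at h1 h3 ⊢
  linarith

/-- Two-sided comparison principle for one time step. -/
theorem stepOp_abs_comparison {M : ℕ} {h ε κ : ℝ} {a : ℕ → ℝ} {n : ℕ} (hh : 0 < h) (hκ : 0 ≤ κ)
    (ha0 : 0 ≤ a 0) (ha : ∀ k < n, a k ≤ a (k + 1)) (han : 0 < a n)
    {v z : ℕ → Grid M} {V Z : Grid M} (hvz : ∀ k ≤ n, ∀ i j, |v k i j| ≤ z k i j)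
    (hVZ : ∀ i j, |stepOp h ε κ a n v V i j| ≤ stepOp h ε κ a n z Z i j) (i j : Fin M) :
    |V i j| ≤ Z i j := by
  refine abs_le'.2 ⟨stepOp_comparison hh hκ ha0 ha han
    (fun k hk i j => (abs_le'.1 (hvz k hk i j)).1) (fun i j => (abs_le'.1 (hVZ i j)).1) i j,
    stepOp_comparison (ε := ε) (v := fun k => -v k) (V := -V) hh hκ ha0 ha han
    (fun k hk i j => (abs_le'.1 (hvz k hk i j)).2) (fun i j => ?_) i j⟩
  rw [stepOp_neg]
  exact (abs_le'.1 (hVZ i j)).2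

/-! ### A barrier for the explicit fractional Gronwall inequality -/

/-- The kernel `x^(-α) / Γ(1-α)`. -/
noncomputable def rlKernel (α x : ℝ) : ℝ := x ^ (-α) / Real.Gamma (1 - α)

theorem rlKernel_pos {α x : ℝ} (hα : α ∈ Ioo (0 : ℝ) 1) (hx : 0 < x) : 0 < rlKernel α x :=
  div_pos (Real.rpow_pos_of_pos hx _) (Real.Gamma_pos_of_pos (by linarith [hα.2]))

theorem rlKernel_anti {α x y : ℝ} (hα : α ∈ Ioo (0 : ℝ) 1) (hx : 0 < x) (hxy : x ≤ y) :
    rlKernel α y ≤ rlKernel α x :=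
  div_le_div_of_nonneg_right (Real.rpow_le_rpow_of_nonpos hx hxy (by linarith [hα.1]))
    (Real.Gamma_pos_of_pos (by linarith [hα.2])).le

theorem exists_le_rlKernel {α : ℝ} (hα : α ∈ Ioo (0 : ℝ) 1) (c : ℝ) :
    ∃ η, 0 < η ∧ c ≤ rlKernel α η := by
  have hΓ : 0 < Real.Gamma (1 - α) := Real.Gamma_pos_of_pos (by linarith [hα.2])
  have hc : 0 < (|c| + 1) * Real.Gamma (1 - α) := by positivity
  -- This point solves `rlKernel α η = |c| + 1`.
  refine ⟨((|c| + 1) * Real.Gamma (1 - α)) ^ (-1 / α), Real.rpow_pos_of_pos hc _, ?_⟩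
  have hα0 : α ≠ 0 := hα.1.ne'
  rw [rlKernel, ← Real.rpow_mul hc.le, show -1 / α * -α = 1 by field_simp, Real.rpow_one,
    mul_div_cancel_right₀ _ hΓ.ne']
  linarith [le_abs_self c]

/-- The number of jumps up to `t n`, and the start of the last jump: a new jump is made at the
step from `t n` to `t (n+1)` if the last one started before `t (n+1) - η`. -/
noncomputable def jumpState (η : ℝ) (t : ℕ → ℝ) : ℕ → ℕ × ℝ
  -- The fictitious start `-η` forces a jump on the first step, since `t 1 > 0 = t 0`. This unit
  -- rise of the barrier pays for the initial layer.
  | 0 => (0, -η)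
  | n + 1 => if (jumpState η t n).2 < t (n + 1) - η then ((jumpState η t n).1 + 1, t n)
      else jumpState η t n

/-- A linear invariant that bounds the number of jumps by `2T/η + 2`, whatever the mesh. A jump adds
`η` on the left, while the right side grows by `t (n+1)` minus the old start, which exceeds `η` by
the jump condition. -/
theorem jumpState_bound {η : ℝ} {t : ℕ → ℝ} {N : ℕ} (h0 : t 0 = 0) (hη : 0 < η)
    (ht : ∀ k < N, t k < t (k + 1)) (n : ℕ) (hn : n ≤ N) :
    (jumpState η t n).2 ≤ t n ∧
      η * (jumpState η t n).1 ≤ t n + (jumpState η t n).2 + 2 * η := by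
  induction n with
  | zero => simp only [jumpState, h0]; constructor <;> [skip; push_cast] <;> linarith
  | succ n ih =>
    obtain ⟨h1, h2⟩ := ih (by omega)
    have h3 := ht n (by omega)
    rw [jumpState]
    split_ifs with h
    · refine ⟨h3.le, ?_⟩
      push_cast
      linarith
    · exact ⟨by linarith, by linarith⟩

theorem jumpState_mono {η : ℝ} {t : ℕ → ℝ} (n : ℕ) :
    (jumpState η t n).1 ≤ (jumpState η t (n + 1)).1 := by
  conv_rhs => rw [jumpState]
  split_ifs <;> simp

/-- Going back to the start of the last jump loses at least one factor of the barrier; this index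
serves as the left end of the window in `exists_barrier`. -/
theorem jumpState_start {η : ℝ} {t : ℕ → ℝ} (n : ℕ) :
    (jumpState η t n).2 = -η ∨
      ∃ j < n, (jumpState η t n).2 = t j ∧ (jumpState η t j).1 + 1 ≤ (jumpState η t n).1 := by
  induction n with
  | zero => simp [jumpState]
  | succ n ih =>
    rw [jumpState]
    split_ifs with h
    · exact Or.inr ⟨n, by omega, rfl, le_rfl⟩
    · rcases ih with h1 | ⟨j, h1, h2, h3⟩
      · exact Or.inl h1
      · exact Or.inr ⟨j, by omega, h2, h3⟩

/-- A bounded increasing barrier that satisfies the explicit discrete fractional Gronwall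
inequality, on every time mesh. -/
theorem exists_barrier {α T : ℝ} (hα : α ∈ Ioo (0 : ℝ) 1) (hT : 0 < T) (Λ : ℝ) :
    ∃ β : ℝ, 1 ≤ β ∧ ∀ (N : ℕ) (t : ℕ → ℝ), IsMesh T N t → ∃ b : ℕ → ℝ,
      b 0 = 1 ∧ 2 ≤ b 1 ∧ (∀ k, b k ≤ b (k + 1)) ∧ (∀ n ≤ N, b n ≤ β) ∧
      ∀ n < N, ∃ j ≤ n,
        Λ * b n ≤ 2 / 3 * rlKernel α (t (n + 1) - t j) * (b (n + 1) - b j) := by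
  -- Without a jump in the current step, at least half of the barrier was gained within time `η`,
  -- and `2/3 * 1/2 * 3Λ = Λ`.
  obtain ⟨η, hη, hηc⟩ := exists_le_rlKernel hα (3 * Λ)
  -- The factor `q` is chosen so that a single jump suffices even with the smallest kernel value:
  -- `2/3 * rlKernel α T * (q - 1) ≥ |Λ|`. Moreover `q ≥ 2`, so a jump at least doubles the barrier.
  have hωT := rlKernel_pos hα hT
  set q : ℝ := 2 + 3 / 2 * |Λ| / rlKernel α T with hq
  have hq2 : 2 ≤ q := by
    have : 0 ≤ 3 / 2 * |Λ| / rlKernel α T := by positivity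
    linarith
  have hq1 : 1 ≤ q := by linarith
  refine ⟨q ^ ⌊2 * T / η + 2⌋₊, one_le_pow₀ hq1, fun N t ht => ?_⟩
  have hmono : ∀ j k, j ≤ k → k ≤ N → t j ≤ t k := by
    intro j k hjk hk
    induction k, hjk using Nat.le_induction with
    | base => exact le_rfl
    | succ k _ ih => exact (ih (by omega)).trans (ht.lt k (by omega)).le
  refine ⟨fun n => q ^ (jumpState η t n).1, by simp [jumpState], ?_,
    fun k => pow_le_pow_right₀ hq1 (jumpState_mono k), fun n hn => ?_, fun n hn => ?_⟩
  · have hN : 0 < N := by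
      rcases Nat.eq_zero_or_pos N with h | h
      · have h1 := ht.last
        rw [h, ht.zero] at h1
        linarith
      · exact h
    have h1 : t 0 < t 1 := ht.lt 0 hN
    rw [ht.zero] at h1
    have : -η < t 1 - η := by linarith
    simp only [jumpState, zero_add, if_pos this, pow_one]
    exact hq2
  · refine pow_le_pow_right₀ hq1 (Nat.le_floor ?_)
    obtain ⟨h1, h2⟩ := jumpState_bound ht.zero hη ht.lt n hn
    have h3 := hmono n N hn le_rfl
    rw [ht.last] at h3
    rw [← sub_le_iff_le_add, le_div_iff₀ hη]
    linarith
  · have htn := ht.lt n hn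
    have hpow : (0 : ℝ) < q ^ (jumpState η t n).1 := by positivity
    by_cases hjump : (jumpState η t n).2 < t (n + 1) - η
    · refine ⟨n, le_rfl, ?_⟩
      have h1 : (jumpState η t (n + 1)).1 = (jumpState η t n).1 + 1 := by
        rw [jumpState, if_pos hjump]
      have h0 := hmono 0 n (by omega) hn.le
      have h2 := hmono (n + 1) N hn le_rfl
      rw [ht.last] at h2
      rw [ht.zero] at h0
      have h3 : rlKernel α T ≤ rlKernel α (t (n + 1) - t n) :=
        rlKernel_anti hα (by linarith) (by linarith)
      simp only [h1, pow_succ]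
      have h4 : Λ ≤ 2 / 3 * rlKernel α T * (q - 1) := by
        have : 2 / 3 * rlKernel α T * (q - 1) = 2 / 3 * rlKernel α T + |Λ| := by
          rw [hq]; field_simp; ring
        rw [this]
        linarith [le_abs_self Λ]
      have h5 : 2 / 3 * rlKernel α T * (q - 1) ≤ 2 / 3 * rlKernel α (t (n + 1) - t n) * (q - 1) :=
        mul_le_mul_of_nonneg_right (by linarith) (by linarith)
      calc Λ * q ^ (jumpState η t n).1
          ≤ (2 / 3 * rlKernel α (t (n + 1) - t n) * (q - 1)) * q ^ (jumpState η t n).1 :=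
            mul_le_mul_of_nonneg_right (h4.trans h5) hpow.le
        _ = _ := by ring
    · have h1 : (jumpState η t (n + 1)).1 = (jumpState η t n).1 := by
        rw [jumpState, if_neg hjump]
      have h0 := hmono 0 n (by omega) hn.le
      rw [ht.zero] at h0
      -- No jump now means that the last one started at some `t j ≥ t (n+1) - η`. The fictitious
      -- start is excluded because `t (n+1) > 0`.
      rcases jumpState_start (η := η) (t := t) n with hs | ⟨j, hj, hs, hm⟩
      · exact absurd (by rw [hs]; linarith) hjump
      · refine ⟨j, hj.le, ?_⟩
        rw [hs] at hjump
        have hjn := hmono j n hj.le hn.le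
        have h3 : rlKernel α η ≤ rlKernel α (t (n + 1) - t j) :=
          rlKernel_anti hα (by linarith) (by linarith)
        have h4 : 2 * q ^ (jumpState η t j).1 ≤ q ^ (jumpState η t n).1 := by
          calc 2 * q ^ (jumpState η t j).1 ≤ q ^ ((jumpState η t j).1 + 1) := by
                rw [pow_succ, mul_comm]
                exact mul_le_mul_of_nonneg_left hq2 (by positivity)
            _ ≤ _ := pow_le_pow_right₀ hq1 hm
        simp only [h1]
        have h6 : 0 < rlKernel α (t (n + 1) - t j) := rlKernel_pos hα (by linarith)
        calc Λ * q ^ (jumpState η t n).1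
            ≤ (1 / 3 * rlKernel α (t (n + 1) - t j)) * q ^ (jumpState η t n).1 :=
              mul_le_mul_of_nonneg_right (by linarith) hpow.le
          _ = 2 / 3 * rlKernel α (t (n + 1) - t j) * (q ^ (jumpState η t n).1 / 2) := by ring
          _ ≤ _ := by
            refine mul_le_mul_of_nonneg_left ?_ (by positivity)
            linarith

end TFAC

/-! ### Stability by a barrier -/

namespace TFAC

open Set

/-- Stability of the predictor-corrector error equations: the bound depends on the kernels, on the
time mesh and on the grid only through the scale `X` of the residuals. -/
theorem exists_stability_constant {α T Λ : ℝ} (hα : α ∈ Ioo (0 : ℝ) 1) (hT : 0 < T) (hΛ : 0 ≤ Λ) :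
    ∃ C : ℝ, 0 < C ∧ ∀ (N : ℕ) (t : ℕ → ℝ) (M : ℕ) (h ε κ : ℝ) (a : ℕ → ℕ → ℝ)
      (e es : ℕ → Grid M) (ψ : Grid M) (g s d : ℕ → ℝ) (r : ℕ → Fin M → Fin M → ℝ) (X : ℝ) (p : ℕ),
      IsMesh T N t → 0 < h → 0 ≤ κ → p < N →
      (∀ n < N, ∀ k ≤ n, 2 / 3 * rlKernel α (t (n + 1) - t k) ≤ a n k) →
      (∀ n < N, ∀ k < n, a n k ≤ a n (k + 1)) →
      e 0 = 0 → 0 ≤ X → (∀ i j, 0 ≤ ψ i j ∧ ψ i j ≤ X) →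
      (∀ n ≤ p, 0 ≤ g n ∧ g n ≤ X) →
      (∀ n ≤ p, 1 ≤ n → a n n * g n ≤ rlKernel α (t (n + 1)) * X) →
      (∀ n ≤ p, s n ≤ rlKernel α (t (n + 1)) * X) →
      (∀ n ≤ p, Λ * (Λ * d n) ≤ a n n * (rlKernel α (t (n + 1)) * X)) →
      (∀ n ≤ p, ∀ i j, r n i j ≤ a n n * g n
        + 2 * ∑ k ∈ Finset.range n, (a n (k + 1) - a n k) * g k + s n
        - ε ^ 2 * discreteLaplacian h ψ i j) →
      (∀ n ≤ p, ∀ i j, |stepOp h ε κ (a n) n e (es (n + 1)) i j| ≤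
        Λ * (|e n i j| + d n) + r n i j) →
      (∀ n ≤ p, ∀ i j, |stepOp h ε κ (a n) n e (e (n + 1)) i j| ≤
        Λ * |es (n + 1) i j| + r n i j) →
      ∀ i j, |e (p + 1) i j| ≤ C * X := by
  have hωT := rlKernel_pos hα hT
  -- `1/θ` is a lower bound for every diagonal kernel, so a source `Λ * Y` in the predictor raises
  -- the solution by at most `θ * (Λ * Y)`.
  set θ : ℝ := 3 / 2 / rlKernel α T with hθ
  have hθ0 : 0 < θ := by positivity
  -- Apart from its lag, the predictor error will be at most `Λs * (16 * X * b n)`. The corrector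
  -- then sees the effective Gronwall constant `Λ * Λs`.
  set Λs : ℝ := 8 + 2 * θ * Λ + 2 with hΛs
  obtain ⟨β, hβ1, hβ⟩ := exists_barrier hα hT (2 * (Λ * Λs))
  refine ⟨16 * β + 1, by linarith, ?_⟩
  intro N t M h ε κ a e es ψ g s d r X p ht hh hκ hpN hK1 hK2 he0 hX hψ hg hg1 hs hd hr hpred hcorr
  obtain ⟨b, hb0, hb1, hbm, hbβ, hbg⟩ := hβ N t ht
  have hmono : ∀ j k, j ≤ k → k ≤ N → t j ≤ t k := by
    intro j k hjk hk
    induction k, hjk using Nat.le_induction with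
    | base => exact le_rfl
    | succ k _ ih => exact (ih (by omega)).trans (ht.lt k (by omega)).le
  have hbmono : Monotone b := monotone_nat_of_le_succ hbm
  have hb1' : ∀ n, 1 ≤ b n := fun n => hb0 ▸ hbmono (Nat.zero_le n)
  have hpos : ∀ n < N, ∀ k ≤ n, 0 < t (n + 1) - t k := fun n hn k hk => by
    linarith [hmono k n hk hn.le, ht.lt n hn]
  have ha0 : ∀ n < N, ∀ k ≤ n, 0 < a n k := fun n hn k hk =>
    lt_of_lt_of_le (mul_pos (by norm_num) (rlKernel_pos hα (hpos n hn k hk))) (hK1 n hn k hk)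
  have hle : ∀ n < N, ∀ k ≤ n, t (n + 1) - t k ≤ t (n + 1) := fun n hn k hk => by
    have := hmono 0 k (by omega) (by omega)
    rw [ht.zero] at this
    linarith
  have hlT : ∀ n < N, t (n + 1) ≤ T := fun n hn => ht.last ▸ hmono (n + 1) N hn le_rfl
  have hK3 : ∀ n < N, ∀ k ≤ n, 2 / 3 * rlKernel α (t (n + 1)) ≤ a n k := fun n hn k hk =>
    le_trans (by linarith [rlKernel_anti hα (hpos n hn k hk) (hle n hn k hk)]) (hK1 n hn k hk)
  have hann : ∀ n < N, 1 ≤ θ * a n n := fun n hn => by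
    have h1 := rlKernel_anti hα (hpos n hn n le_rfl) ((hle n hn n le_rfl).trans (hlT n hn))
    have h2 := hK1 n hn n le_rfl
    have h3 : 2 / 3 * rlKernel α T ≤ a n n := by linarith
    calc (1 : ℝ) = θ * (2 / 3 * rlKernel α T) := by rw [hθ]; field_simp
      _ ≤ _ := mul_le_mul_of_nonneg_left h3 hθ0.le
  -- Half of the coefficient 16 pays for the Lipschitz term, through the rate `2 * (Λ * Λs)` of `b`,
  -- and half for the residuals. The subtracted sequence is `g` shifted by one index, starting from
  -- 0.
  set V : ℕ → Grid M := fun k i j =>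
    16 * X * b k - 2 * (if k = 0 then 0 else g (k - 1)) + ψ i j with hV
  have hmain : ∀ n ≤ p + 1, ∀ i j, |e n i j| ≤ V n i j := by
    intro n
    induction n using Nat.strong_induction_on with
    | _ n ih =>
    intro hn i j
    rcases Nat.eq_zero_or_pos n with h0 | h0
    · subst h0
      have := (hψ i j).1
      simp only [he0, hV, hb0, Pi.zero_apply, abs_zero, if_true]
      linarith
    obtain ⟨n, rfl⟩ : ∃ m, n = m + 1 := ⟨n - 1, by omega⟩
    have hnp : n ≤ p := by omega
    have hnN : n < N := by omega
    have hAn := ha0 n hnN n le_rfl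
    have hA0 := (ha0 n hnN 0 (by omega)).le
    have hω : 0 < rlKernel α (t (n + 1)) := by
      have := hpos n hnN 0 (by omega)
      rw [ht.zero, sub_zero] at this
      exact rlKernel_pos hα this
    set ω := rlKernel α (t (n + 1)) with hωdef
    have hωX : ω * X ≤ 3 / 2 * (a n n * X) := by
      have := mul_le_mul_of_nonneg_right (hK3 n hnN n le_rfl) hX
      linarith
    -- A constant bound for the whole history. The discrete derivative of a constant history is
    -- purely diagonal, so the predictor needs no finer barrier.
    set Y : ℝ := 16 * X * b n + X with hY
    have hXb : X ≤ X * b n := le_mul_of_one_le_right hX (hb1' n)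
    have hY0 : 0 ≤ Y := by linarith
    have heY : ∀ k ≤ n, ∀ i j, |e k i j| ≤ Y := by
      intro k hk i j
      refine (ih k (by omega) (by omega) i j).trans ?_
      have h1 : 0 ≤ (if k = 0 then 0 else g (k - 1)) := by
        split_ifs with hk0
        · exact le_rfl
        · exact (hg (k - 1) (by omega)).1
      have h2 : X * b k ≤ X * b n := mul_le_mul_of_nonneg_left (hbmono hk) hX
      have h3 := (hψ i j).2
      simp only [hV, hY]
      linarith
    have hsum : ∑ k ∈ Finset.range n, (a n (k + 1) - a n k) * g k ≤ a n n * X :=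
      sum_diff_mul_le hA0 hX (hK2 n hnN) fun k hk => (hg k (by omega)).2
    have hgX := (hg n hnp).2
    have hag : a n n * g n ≤ a n n * X := mul_le_mul_of_nonneg_left hgX hAn.le
    -- The lag `d n` enters the predictor after inversion of the diagonal kernel; this is the gain
    -- of `τ^α` behind the order `1 + α`.
    set D : ℝ := Λ * d n / a n n with hD
    have hDan : a n n * D = Λ * d n := by rw [hD]; field_simp
    -- The `6 * X` covers the residual: `a n n * X` from the diagonal, twice that from the memory
    -- sum, and `3/2` of it from `s n`.
    set Z : ℝ := θ * (Λ * Y) + 6 * X with hZ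
    have hesb : ∀ i j, |es (n + 1) i j| ≤ Y + Z + max D 0 + ψ i j := by
      have hZ1 : 0 ≤ Z := by positivity
      refine stepOp_abs_comparison (v := e) (z := fun _ _ _ => Y) (V := es (n + 1))
        (Z := fun i j => Y + Z + max D 0 + ψ i j) (ε := ε) hh hκ hA0 (hK2 n hnN) hAn heY
        (fun i j => ?_)
      refine (hpred n hnp i j).trans ?_
      rw [stepOp, convDiff_const, discreteLaplacian_const_add]
      have h1 := hr n hnp i j
      have h2 : Λ * |e n i j| ≤ Λ * Y := mul_le_mul_of_nonneg_left (heY n le_rfl i j) hΛ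
      have h3 := hs n hnp
      have h4 : 0 ≤ κ * (Y + Z + max D 0 + ψ i j) :=
        mul_nonneg hκ (by linarith [(hψ i j).1, le_max_right D 0])
      have h5 : Λ * Y ≤ a n n * (θ * (Λ * Y)) := by
        calc Λ * Y ≤ (θ * a n n) * (Λ * Y) :=
              le_mul_of_one_le_left (mul_nonneg hΛ hY0) (hann n hnN)
          _ = _ := by ring
      have h6 : a n n * D ≤ a n n * max D 0 := mul_le_mul_of_nonneg_left (le_max_left _ _) hAn.le
      have h7 : 0 ≤ a n n * ψ i j := mul_nonneg hAn.le (hψ i j).1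
      have h8 : a n n * (Y + Z + max D 0 + ψ i j - Y) =
          a n n * (θ * (Λ * Y)) + 6 * (a n n * X) + a n n * max D 0 + a n n * ψ i j := by
        rw [hZ]; ring
      have h9 : 0 ≤ a n n * X := mul_nonneg hAn.le hX
      rw [h8]
      linarith
    have hΛD : Λ * max D 0 ≤ ω * X := by
      rcases le_total D 0 with hD0 | hD0
      · rw [max_eq_right hD0, mul_zero]; positivity
      · rw [max_eq_left hD0]
        refine le_of_mul_le_mul_left ?_ hAn
        calc a n n * (Λ * D) = Λ * (a n n * D) := by ring
          _ ≤ _ := by rw [hDan]; exact hd n hnp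
    have hDB1 : 2 * (Λ * Λs) * b n ≤ convDiff (a n) b n (b (n + 1)) := by
      obtain ⟨j, hj, hjb⟩ := hbg n hnN
      refine hjb.trans (mul_sub_le_convDiff hj (fun k hk => (ha0 n hnN k hk).le)
        (fun k hjk hk => ?_) fun k _ => hbm k)
      refine le_trans ?_ (hK1 n hnN k hk)
      have h1 := rlKernel_anti hα (hpos n hnN k hk)
        (show t (n + 1) - t k ≤ t (n + 1) - t j by linarith [hmono j k hjk (by omega)])
      linarith
    have hb11 : 1 ≤ b (n + 1) - b 0 := by
      have := hbmono (show 1 ≤ n + 1 by omega)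
      linarith
    have hDB2 : 2 / 3 * ω ≤ convDiff (a n) b n (b (n + 1)) := by
      refine le_trans ?_ (mul_sub_le_convDiff (Nat.zero_le n) (fun k hk => (ha0 n hnN k hk).le)
        (fun k _ hk => hK3 n hnN k hk) fun k _ => hbm k)
      exact le_mul_of_one_le_right (by positivity) hb11
    -- One `a n n * g n` is residual and two come from the subtracted shifted sequence; one `ω * X`
    -- is `s n` and the other is the predictor lag. For `n = 0` the diagonal jump of `b` pays. Later
    -- the first jump of `b`, seen through the kernel, gives `2/3 * ω`, and `5 ≤ 8 * 2/3`.
    have hforce : 3 * (a n n * g n) + 2 * (ω * X) ≤ 8 * X * convDiff (a n) b n (b (n + 1)) := by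
      rcases Nat.eq_zero_or_pos n with hn0 | hn0
      · have hDB3 : a n n ≤ convDiff (a n) b n (b (n + 1)) := by
          subst hn0
          rw [convDiff_self, Finset.sum_range_one]
          exact le_mul_of_one_le_right hAn.le hb11
        have h1 := mul_le_mul_of_nonneg_left hDB3 hX
        have h2 : 0 ≤ a n n * X := mul_nonneg hAn.le hX
        linarith
      · have h1 := hg1 n hnp hn0
        have := mul_le_mul_of_nonneg_left hDB2 hX
        have : 0 ≤ ω * X := by positivity
        linarith
    refine stepOp_abs_comparison (v := e) (z := V) (V := e (n + 1)) (Z := V (n + 1)) (ε := ε)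
      hh hκ hA0 (hK2 n hnN) hAn (fun k hk => ih k (by omega) (by omega)) (fun i j => ?_) i j
    refine (hcorr n hnp i j).trans ?_
    -- By `convDiff_shift` the memory sum appears here with exactly the coefficient 2 of the
    -- residual, and the Laplacian of `ψ` also matches, so both cancel.
    have hstep : stepOp h ε κ (a n) n V (V (n + 1)) i j =
        16 * X * convDiff (a n) b n (b (n + 1)) - 2 * (a n n * g n)
          + 2 * ∑ k ∈ Finset.range n, (a n (k + 1) - a n k) * g k
          + κ * V (n + 1) i j - ε ^ 2 * discreteLaplacian h ψ i j := by
      have h1 : discreteLaplacian h (V (n + 1)) = discreteLaplacian h ψ :=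
        discreteLaplacian_const_add h _ ψ
      have h2 := convDiff_shift (a n) g n
      have h3 : convDiff (a n) (fun k => V k i j) n (V (n + 1) i j) =
          16 * X * convDiff (a n) b n (b (n + 1)) -
            2 * convDiff (a n) (fun k => if k = 0 then 0 else g (k - 1)) n (g n) := by
        have h4 := convDiff_self (a n) (fun k => if k = 0 then 0 else g (k - 1)) n
        simp only [Nat.add_eq_zero_iff, one_ne_zero, and_false, if_false,
          Nat.add_sub_cancel] at h4
        have h5 := convDiff_self (a n) (fun k => V k i j) n
        rw [h4, h5, convDiff_self, Finset.mul_sum, Finset.mul_sum, ← Finset.sum_sub_distrib]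
        refine Finset.sum_congr rfl fun k _ => ?_
        simp only [hV, Nat.add_eq_zero_iff, one_ne_zero, and_false, if_false, Nat.add_sub_cancel]
        ring
      rw [stepOp, h1, h3, h2]
      ring
    rw [hstep]
    have hV0 : 0 ≤ κ * V (n + 1) i j := by
      refine mul_nonneg hκ ?_
      have h1 : X * 1 ≤ X * b (n + 1) := mul_le_mul_of_nonneg_left (hb1' (n + 1)) hX
      have h2 := (hψ i j).1
      simp only [hV, Nat.add_eq_zero_iff, one_ne_zero, and_false, if_false, Nat.add_sub_cancel]
      linarith
    have hes : Λ * |es (n + 1) i j| ≤ Λ * Λs * (8 * 2 * X * b n) + ω * X := by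
      have h1 := mul_le_mul_of_nonneg_left (hesb i j) hΛ
      have h2 : Y + Z + ψ i j ≤ Λs * (16 * X * b n) := by
        have h3 := (hψ i j).2
        have h4 : Y ≤ 2 * (16 * (X * b n)) := by rw [hY]; linarith
        have h5 : θ * (Λ * Y) ≤ θ * (Λ * (2 * (16 * (X * b n)))) :=
          mul_le_mul_of_nonneg_left (mul_le_mul_of_nonneg_left h4 hΛ) hθ0.le
        have h6 : Λs * (16 * X * b n) =
            10 * (16 * (X * b n)) + θ * (Λ * (2 * (16 * (X * b n)))) := by rw [hΛs]; ring
        rw [h6, hZ]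
        linarith
      have h3 := mul_le_mul_of_nonneg_left h2 hΛ
      calc Λ * |es (n + 1) i j| ≤ Λ * (Y + Z + max D 0 + ψ i j) := h1
        _ = Λ * (Y + Z + ψ i j) + Λ * max D 0 := by ring
        _ ≤ Λ * (Λs * (16 * X * b n)) + ω * X := add_le_add h3 hΛD
        _ = _ := by ring
    have h1 := hr n hnp i j
    have h2 := hs n hnp
    have h3 := mul_le_mul_of_nonneg_left hDB1 (show 0 ≤ 8 * X by positivity)
    have h4 : Λ * Λs * (8 * 2 * X * b n) = 8 * X * (2 * (Λ * Λs) * b n) := by ring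
    rw [h4] at hes
    linarith
  intro i j
  refine (hmain (p + 1) le_rfl i j).trans ?_
  have h1 := (hψ i j).2
  have h2 := (hg p le_rfl).1
  have h3 : X * b (p + 1) ≤ X * β := mul_le_mul_of_nonneg_left (hbβ (p + 1) (by omega)) hX
  simp only [hV, Nat.add_eq_zero_iff, one_ne_zero, and_false, if_false, Nat.add_sub_cancel]
  linarith

end TFAC

namespace TFAC

open Set MeasureTheory

/-! ### The sum of exponentials and the fast kernels -/

/-- The sum of exponentials `∑ wᵢ exp(-sᵢ x)`. -/
noncomputable def soeSum {m : ℕ} (w s : Fin m → ℝ) (x : ℝ) : ℝ :=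
  ∑ i, w i * Real.exp (-(s i) * x)

theorem continuous_soeSum {m : ℕ} (w s : Fin m → ℝ) : Continuous (soeSum w s) := by
  unfold soeSum
  fun_prop

theorem soeSum_antitone {m : ℕ} {w s : Fin m → ℝ} (hw : ∀ i, 0 < w i) (hs : ∀ i, 0 < s i) :
    Antitone (soeSum w s) := fun x y hxy => by
  refine Finset.sum_le_sum fun i _ => mul_le_mul_of_nonneg_left (Real.exp_le_exp.2 ?_) (hw i).le
  nlinarith [hs i]

theorem convexOn_soeSum {m : ℕ} {w s : Fin m → ℝ} (hw : ∀ i, 0 < w i) :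
    ConvexOn ℝ univ (soeSum w s) := by
  refine ⟨convex_univ, fun x _ y _ p q hp hq hpq => ?_⟩
  simp only [soeSum, smul_eq_mul, Finset.mul_sum, ← Finset.sum_add_distrib]
  refine Finset.sum_le_sum fun i _ => ?_
  have h1 := convexOn_exp.2 (mem_univ (-(s i) * x)) (mem_univ (-(s i) * y)) hp hq hpq
  simp only [smul_eq_mul] at h1
  calc w i * Real.exp (-(s i) * (p * x + q * y))
      = w i * Real.exp (p * (-(s i) * x) + q * (-(s i) * y)) := by congr 2; ring
    _ ≤ w i * (p * Real.exp (-(s i) * x) + q * Real.exp (-(s i) * y)) :=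
        mul_le_mul_of_nonneg_left h1 (hw i).le
    _ = _ := by ring

/-- The trapezoidal rule overestimates the integral of a convex function. -/
theorem integral_le_trapezoid {g : ℝ → ℝ} {a b : ℝ} (hab : a < b) (hg : ConvexOn ℝ univ g)
    (hc : Continuous g) : ∫ x in a..b, g x ≤ (b - a) * ((g a + g b) / 2) := by
  have hba : 0 < b - a := sub_pos.2 hab
  have hchord : ∫ x in a..b, (g a + (x - a) * ((g b - g a) / (b - a))) =
      (b - a) * ((g a + g b) / 2) := by
    rw [intervalIntegral.integral_add (by simp) (Continuous.intervalIntegrable (by fun_prop) _ _),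
      intervalIntegral.integral_mul_const, intervalIntegral.integral_sub (by simp) (by simp),
      integral_id]
    simp only [intervalIntegral.integral_const, smul_eq_mul]
    field_simp
    ring
  rw [← hchord]
  refine intervalIntegral.integral_mono_on hab.le (hc.intervalIntegrable _ _)
    (Continuous.intervalIntegrable (by fun_prop) _ _) fun x hx => ?_
  have h1 := hg.2 (mem_univ a) (mem_univ b)
    (div_nonneg (sub_nonneg.2 hx.2) hba.le) (div_nonneg (sub_nonneg.2 hx.1) hba.le)
    (by field_simp; ring)
  simp only [smul_eq_mul] at h1
  have h2 : (b - x) / (b - a) * a + (x - a) / (b - a) * b = x := by field_simp; ring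
  rw [h2] at h1
  refine h1.trans (le_of_eq ?_)
  field_simp
  ring

theorem integral_sub_left_rpow {α a b : ℝ} (hα : α < 1) :
    ∫ r in a..b, (b - r) ^ (-α) = (b - a) ^ (1 - α) / (1 - α) := by
  rw [intervalIntegral.integral_comp_sub_left (fun x => x ^ (-α)) b, sub_self,
    integral_rpow (Or.inl (by linarith)), Real.zero_rpow (by linarith), sub_zero,
    show -α + 1 = 1 - α by ring]

theorem step_succ (t : ℕ → ℝ) (n : ℕ) : step t (n + 1) = t (n + 1) - t n := rfl

theorem IsMesh.mono {T : ℝ} {N : ℕ} {t : ℕ → ℝ} (ht : IsMesh T N t) {j k : ℕ} (hjk : j ≤ k)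
    (hk : k ≤ N) : t j ≤ t k := by
  induction k, hjk using Nat.le_induction with
  | base => exact le_rfl
  | succ k _ ih => exact (ih (by omega)).trans (ht.lt k (by omega)).le

theorem IsMesh.nonneg {T : ℝ} {N : ℕ} {t : ℕ → ℝ} (ht : IsMesh T N t) {k : ℕ} (hk : k ≤ N) :
    0 ≤ t k := ht.zero ▸ ht.mono (Nat.zero_le k) hk

theorem IsMesh.le {T : ℝ} {N : ℕ} {t : ℕ → ℝ} (ht : IsMesh T N t) {k : ℕ} (hk : k ≤ N) :
    t k ≤ T := ht.last ▸ ht.mono hk le_rfl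

theorem IsMesh.pos {T : ℝ} {N : ℕ} {t : ℕ → ℝ} (ht : IsMesh T N t) {k : ℕ} (hk0 : 1 ≤ k)
    (hk : k ≤ N) : 0 < t k :=
  lt_of_lt_of_le (ht.zero ▸ ht.lt 0 (by omega)) (ht.mono hk0 hk)

theorem IsMesh.step_pos {T : ℝ} {N : ℕ} {t : ℕ → ℝ} (ht : IsMesh T N t) {n : ℕ} (hn : n < N) :
    0 < step t (n + 1) := sub_pos.2 (ht.lt n hn)

theorem step_le_maxStep {N : ℕ} (t : ℕ → ℝ) {k : ℕ} (h1 : 1 ≤ k) (hk : k ≤ N) :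
    step t k ≤ maxStep t N :=
  le_ciSup (f := fun k : Icc 1 N => step t k) (finite_range _).bddAbove ⟨k, h1, hk⟩

theorem fastKernel_self {α : ℝ} (hα : α ∈ Ioo (0 : ℝ) 1) {t : ℕ → ℝ} {m : ℕ} (w s : Fin m → ℝ)
    {n : ℕ} (hn : 0 < step t (n + 1)) :
    fastKernel α t w s n n = step t (n + 1) ^ (-α) / Real.Gamma (2 - α) := by
  have h1 : Real.Gamma (2 - α) = (1 - α) * Real.Gamma (1 - α) := by
    rw [show 2 - α = (1 - α) + 1 by ring, Real.Gamma_add_one (by linarith [hα.2])]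
  have hΓ : 0 < Real.Gamma (1 - α) := Real.Gamma_pos_of_pos (by linarith [hα.2])
  have h2 : 1 - α ≠ 0 := by linarith [hα.2]
  rw [fastKernel, if_pos rfl, integral_sub_left_rpow hα.2, ← step_succ, h1,
    show 1 - α = -α + 1 by ring, Real.rpow_add hn, Real.rpow_one]
  rw [show 1 - α = -α + 1 by ring] at hΓ h2
  field_simp

theorem fastKernel_of_lt {α : ℝ} {t : ℕ → ℝ} {m : ℕ} {w s : Fin m → ℝ} {n k : ℕ} (hk : k < n) :
    fastKernel α t w s n k =
      1 / step t (k + 1) * ∫ r in (t k)..(t (k + 1)), soeSum w s (t (n + 1) - r) := by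
  rw [fastKernel, if_neg hk.ne]
  congr 1
  simp only [soeSum]
  rw [intervalIntegral.integral_finsetSum fun i _ => Continuous.intervalIntegrable (by fun_prop) _ _]
  simp only [intervalIntegral.integral_const_mul]

section Kernel

variable {α T : ℝ} {N : ℕ} {t : ℕ → ℝ} {δ tol : ℝ} {m : ℕ} {w s : Fin m → ℝ}

/-- By continuity the accuracy extends to the closed interval. The end point `δ` matters because the
shortest step may equal the cut-off. -/
theorem rlKernel_sub_soeSum_le (hδ : 0 < δ) (hs : IsSOE α T δ tol w s)
    {x : ℝ} (hx : δ ≤ x) (hxT : x ≤ T) (hδT : δ < T) :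
    |rlKernel α x - soeSum w s x| ≤ tol := by
  have hcl : x ∈ closure (Ioc δ T) := by
    rw [closure_Ioc hδT.ne]; exact ⟨hx, hxT⟩
  refine le_on_closure (f := fun x => |rlKernel α x - soeSum w s x|) (g := fun _ => tol)
    (fun y hy => ?_) ?_ continuousOn_const hcl
  · have h1 := hs.error y hy
    have hy0 : 0 < y := hδ.trans hy.1
    have h2 : rlKernel α y = 1 / (Real.Gamma (1 - α) * y ^ α) := by
      rw [rlKernel, Real.rpow_neg hy0.le, inv_eq_one_div, div_div, mul_comm]
    simp only [h2]
    exact h1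
  · rw [closure_Ioc hδT.ne]
    refine (ContinuousOn.sub ?_ (continuous_soeSum w s).continuousOn).abs
    exact (continuousOn_id.rpow_const fun y hy => Or.inl (hδ.trans_le hy.1).ne').div_const _

/-- The threshold equals `rlKernel α T / 3`, hence is at most a third of the kernel at any `x ≤ T`.
-/
theorem two_thirds_rlKernel_le_soeSum (hα : α ∈ Ioo (0 : ℝ) 1) (hδ : 0 < δ)
    (hs : IsSOE α T δ tol w s) (htol : tol ≤ T ^ (-α) / (3 * Real.Gamma (1 - α)))
    {x : ℝ} (hx : δ < x) (hxT : x ≤ T) : 2 / 3 * rlKernel α x ≤ soeSum w s x := by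
  have h1 := (abs_le.1 (rlKernel_sub_soeSum_le hδ hs hx.le hxT (hx.trans_le hxT))).2
  have h2 : T ^ (-α) / (3 * Real.Gamma (1 - α)) = rlKernel α T / 3 := by
    rw [rlKernel]; ring
  have h3 := rlKernel_anti hα (hδ.trans hx) hxT
  linarith

/-- On a history interval the weight is the mean of a decreasing function of the time lag, so it is
at least the value at the longest lag. That lag exceeds `δ`, as it contains the current step and an
earlier one. -/
theorem two_thirds_rlKernel_le_fastKernel (hα : α ∈ Ioo (0 : ℝ) 1) (hδ : 0 < δ)
    (ht : IsMesh T N t) (hs : IsSOE α T δ tol w s) (hcut : ∀ k, 1 ≤ k → k ≤ N → δ ≤ step t k)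
    (htol : tol ≤ T ^ (-α) / (3 * Real.Gamma (1 - α))) {n k : ℕ} (hn : n < N) (hk : k ≤ n) :
    2 / 3 * rlKernel α (t (n + 1) - t k) ≤ fastKernel α t w s n k := by
  rcases hk.eq_or_lt with rfl | hk
  · have hpos := ht.step_pos hn
    rw [fastKernel_self hα w s hpos, ← step_succ]
    have h1 : Real.Gamma (2 - α) = (1 - α) * Real.Gamma (1 - α) := by
      rw [show 2 - α = (1 - α) + 1 by ring, Real.Gamma_add_one (by linarith [hα.2])]
    have hΓ : 0 < Real.Gamma (1 - α) := Real.Gamma_pos_of_pos (by linarith [hα.2])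
    have h2 := rlKernel_pos hα hpos
    have h3 : rlKernel α (step t (k + 1)) ≤ step t (k + 1) ^ (-α) / Real.Gamma (2 - α) := by
      rw [rlKernel, h1]
      refine div_le_div_of_nonneg_left (Real.rpow_nonneg hpos.le _) (mul_pos (by linarith [hα.2]) hΓ) ?_
      nlinarith [hα.1]
    linarith
  · have hpos := ht.step_pos (show k < N by omega)
    have h1 : soeSum w s (t (n + 1) - t k) ≤ fastKernel α t w s n k := by
      rw [fastKernel_of_lt hk, one_div, inv_mul_eq_div, le_div_iff₀ hpos]
      have h2 : ∫ _r in (t k)..(t (k + 1)), soeSum w s (t (n + 1) - t k) ≤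
          ∫ r in (t k)..(t (k + 1)), soeSum w s (t (n + 1) - r) :=
        intervalIntegral.integral_mono_on (ht.lt k (by omega)).le (by simp)
          (((continuous_soeSum w s).comp (by fun_prop)).intervalIntegrable _ _) fun r hr =>
          soeSum_antitone hs.weight_pos hs.node_pos (by linarith [hr.1])
      rw [intervalIntegral.integral_const, smul_eq_mul, mul_comm] at h2
      exact h2
    refine le_trans (two_thirds_rlKernel_le_soeSum hα hδ hs htol ?_ ?_) h1
    · have h2 := hcut (n + 1) (by omega) hn
      rw [step_succ] at h2
      have h3 := ht.lt k (by omega)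
      have h4 := ht.mono (show k + 1 ≤ n by omega) hn.le
      linarith
    · linarith [ht.le (show n + 1 ≤ N by omega), ht.nonneg (show k ≤ N by omega)]

/-- The increments of the sum of exponentials over a mesh interval are controlled by the increments
of the discrete kernels. -/
theorem soeSum_sub_le_fastKernel_sub (hα : α ∈ Ioo (0 : ℝ) 1) (hδ : 0 < δ)
    (ht : IsMesh T N t) (hs : IsSOE α T δ tol w s) (hcut : ∀ k, 1 ≤ k → k ≤ N → δ ≤ step t k)
    (htol : tol ≤ α / (Real.Gamma (2 - α) * (max 1 (maxStep t N)) ^ α)) {n k : ℕ} (hn : n < N)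
    (hk : k < n) :
    soeSum w s (t (n + 1) - t (k + 1)) - soeSum w s (t (n + 1) - t k) ≤
      2 * (fastKernel α t w s n (k + 1) - fastKernel α t w s n k) := by
  have hpos := ht.step_pos (show k < N by omega)
  -- Convexity puts the mean below the average of the two end values, while the next kernel lies
  -- above the value at the common end point. Hence the kernel increment is at least half the
  -- increment of the sum of exponentials.
  have h1 : fastKernel α t w s n k ≤
      (soeSum w s (t (n + 1) - t k) + soeSum w s (t (n + 1) - t (k + 1))) / 2 := by
    rw [fastKernel_of_lt hk, one_div, inv_mul_eq_div, div_le_iff₀ hpos, step_succ]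
    have hcv : ConvexOn ℝ univ (fun r => soeSum w s (t (n + 1) - r)) := by
      refine ⟨convex_univ, fun x _ y _ p q hp hq hpq => ?_⟩
      have h3 := (convexOn_soeSum (s := s) hs.weight_pos).2 (mem_univ (t (n + 1) - x))
        (mem_univ (t (n + 1) - y)) hp hq hpq
      convert h3 using 2
      simp only [smul_eq_mul]
      linear_combination -(t (n + 1)) * hpq
    have h2 := integral_le_trapezoid (ht.lt k (by omega)) hcv
      ((continuous_soeSum w s).comp (by fun_prop))
    linarith
  have h2 : soeSum w s (t (n + 1) - t (k + 1)) ≤ fastKernel α t w s n (k + 1) := by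
    rcases (show k + 1 ≤ n by omega).eq_or_lt with rfl | hk'
    · have hpos' := ht.step_pos hn
      rw [fastKernel_self hα w s hpos', ← step_succ]
      have hδ' := hcut (k + 1 + 1) (by omega) hn
      have hτT : step t (k + 1 + 1) < T := by
        rw [step_succ]
        linarith [ht.le (show k + 1 + 1 ≤ N by omega), ht.pos (show 1 ≤ k + 1 by omega) hn.le]
      have h3 := (abs_le.1 (rlKernel_sub_soeSum_le hδ hs hδ' hτT.le (hδ'.trans_lt hτT))).1
      have hG : Real.Gamma (2 - α) = (1 - α) * Real.Gamma (1 - α) := by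
        rw [show 2 - α = (1 - α) + 1 by ring, Real.Gamma_add_one (by linarith [hα.2])]
      have hΓ : 0 < Real.Gamma (1 - α) := Real.Gamma_pos_of_pos (by linarith [hα.2])
      have hα1 : 0 < 1 - α := by linarith [hα.2]
      -- The exact kernel at the last step is `1 - α` times the diagonal L1 weight, so the tolerance
      -- must fit into the remaining fraction `α`. This is the second threshold.
      have h4 : tol ≤ α * (step t (k + 1 + 1) ^ (-α) / Real.Gamma (2 - α)) := by
        refine htol.trans ?_
        have h5 : step t (k + 1 + 1) ^ α ≤ (max 1 (maxStep t N)) ^ α :=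
          Real.rpow_le_rpow hpos'.le
            ((step_le_maxStep t (by omega) hn).trans (le_max_right _ _)) hα.1.le
        have h6 : 0 < step t (k + 1 + 1) ^ α := Real.rpow_pos_of_pos hpos' _
        have h7 : 0 < Real.Gamma (2 - α) := by rw [hG]; positivity
        rw [Real.rpow_neg hpos'.le, ← one_div, div_div, mul_one_div, mul_comm (Real.Gamma _)]
        exact div_le_div_of_nonneg_left hα.1.le (by positivity)
          (mul_le_mul_of_nonneg_right h5 h7.le)
      have h5 : rlKernel α (step t (k + 1 + 1)) =
          (1 - α) * (step t (k + 1 + 1) ^ (-α) / Real.Gamma (2 - α)) := by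
        rw [rlKernel, hG]; field_simp
      linarith
    · have hpos' := ht.step_pos (show k + 1 < N by omega)
      rw [fastKernel_of_lt hk', one_div, inv_mul_eq_div, le_div_iff₀ hpos']
      have h2 : ∫ _r in (t (k + 1))..(t (k + 1 + 1)), soeSum w s (t (n + 1) - t (k + 1)) ≤
          ∫ r in (t (k + 1))..(t (k + 1 + 1)), soeSum w s (t (n + 1) - r) :=
        intervalIntegral.integral_mono_on (ht.lt (k + 1) (by omega)).le (by simp)
          (((continuous_soeSum w s).comp (by fun_prop)).intervalIntegrable _ _) fun r hr =>
          soeSum_antitone hs.weight_pos hs.node_pos (by linarith [hr.1])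
      rw [intervalIntegral.integral_const, smul_eq_mul, mul_comm] at h2
      exact h2
  linarith

end Kernel

end TFAC

namespace TFAC

open Set

/-! ### Consistency of the discrete Laplacian -/

/-- The one-dimensional discrete gradient with vanishing boundary fluxes. -/
noncomputable def flux {M : ℕ} (h : ℝ) (v : Fin M → ℝ) (i : Fin (M + 1)) : ℝ :=
  if hi : 0 < (i : ℕ) ∧ (i : ℕ) < M then
    (v ⟨i, hi.2⟩ - v ⟨i - 1, lt_of_le_of_lt (Nat.sub_le _ _) hi.2⟩) / h
  else 0

/-- The one-dimensional discrete Neumann Laplacian. -/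
noncomputable def secondDiff {M : ℕ} (h : ℝ) (v : Fin M → ℝ) (i : Fin M) : ℝ :=
  (flux h v i.succ - flux h v i.castSucc) / h

theorem discreteLaplacian_eq_secondDiff {M : ℕ} (h : ℝ) (U : Grid M) (i j : Fin M) :
    discreteLaplacian h U i j =
      secondDiff h (fun a => U a j) i + secondDiff h (fun b => U i b) j := rfl

/-- The mean value inequality on the segment from `x` to `s` raises the order of vanishing by one;
the factor `1 / (k + 1)` is given up. Iterating it yields Taylor's formula from a Lipschitz third
derivative. -/
theorem abs_le_pow_succ_of_deriv {L K x : ℝ} {f f' : ℝ → ℝ} {k : ℕ} (hK : 0 ≤ K)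
    (hf : ∀ s ∈ Icc 0 L, HasDerivWithinAt f (f' s) (Icc 0 L) s) (hx : x ∈ Icc 0 L) (hfx : f x = 0)
    (hb : ∀ s ∈ Icc 0 L, |f' s| ≤ K * |s - x| ^ k) :
    ∀ s ∈ Icc 0 L, |f s| ≤ K * |s - x| ^ (k + 1) := by
  intro s hs
  have hsub : uIcc x s ⊆ Icc 0 L := uIcc_subset_Icc hx hs
  have h1 := Convex.norm_image_sub_le_of_norm_hasDerivWithin_le (f := f) (f' := f')
    (s := uIcc x s) (C := K * |s - x| ^ k) (fun y hy => (hf y (hsub hy)).mono hsub)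
    (fun y hy => ?_) (convex_uIcc x s) left_mem_uIcc right_mem_uIcc
  · rw [hfx, sub_zero, Real.norm_eq_abs, Real.norm_eq_abs] at h1
    rw [pow_succ, ← mul_assoc]
    exact h1
  · refine (hb y (hsub hy)).trans (mul_le_mul_of_nonneg_left ?_ hK)
    exact pow_le_pow_left₀ (abs_nonneg _) (abs_sub_left_of_mem_uIcc hy) k

/-- A function on `[0,L]` with derivatives `g1, g2, g3`, the last one bounded by `K` and
`K`-Lipschitz, and with vanishing first derivative at the end points. -/
structure NeumannSmooth (K L : ℝ) (g g1 g2 g3 : ℝ → ℝ) : Prop where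
  deriv_zero : ∀ s ∈ Icc 0 L, HasDerivWithinAt g (g1 s) (Icc 0 L) s
  deriv_one : ∀ s ∈ Icc 0 L, HasDerivWithinAt g1 (g2 s) (Icc 0 L) s
  deriv_two : ∀ s ∈ Icc 0 L, HasDerivWithinAt g2 (g3 s) (Icc 0 L) s
  bound : ∀ s ∈ Icc 0 L, |g3 s| ≤ K
  lipschitz : ∀ s ∈ Icc 0 L, ∀ r ∈ Icc 0 L, |g3 s - g3 r| ≤ K * |s - r|
  left : g1 0 = 0
  right : g1 L = 0

theorem NeumannSmooth.taylor {K L : ℝ} {g g1 g2 g3 : ℝ → ℝ} (hg : NeumannSmooth K L g g1 g2 g3)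
    (hK : 0 ≤ K) {x : ℝ} (hx : x ∈ Icc 0 L) :
    (∀ s ∈ Icc 0 L, |g1 s - (g1 x + g2 x * (s - x) + g3 x * (s - x) ^ 2 / 2)| ≤
      K * |s - x| ^ 3) ∧
    ∀ s ∈ Icc 0 L, |g s - (g x + g1 x * (s - x) + g2 x * (s - x) ^ 2 / 2
      + g3 x * (s - x) ^ 3 / 6)| ≤ K * |s - x| ^ 4 := by
  have hid : ∀ s, HasDerivWithinAt (fun s => s - x) 1 (Icc 0 L) s := fun s =>
    (hasDerivWithinAt_id s _).sub_const x
  have h2 : ∀ s ∈ Icc 0 L, |g2 s - (g2 x + g3 x * (s - x))| ≤ K * |s - x| ^ 2 := by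
    refine abs_le_pow_succ_of_deriv (f' := fun s => g3 s - g3 x) (k := 1) hK (fun s hs => ?_) hx
      (by ring) (fun s hs => by simpa using hg.lipschitz s hs x hx)
    have := (hg.deriv_two s hs).sub (((hid s).const_mul (g3 x)).const_add (g2 x))
    exact this.congr_deriv (by ring)
  have h1 : ∀ s ∈ Icc 0 L, |g1 s - (g1 x + g2 x * (s - x) + g3 x * (s - x) ^ 2 / 2)| ≤
      K * |s - x| ^ 3 := by
    refine abs_le_pow_succ_of_deriv (f' := fun s => g2 s - (g2 x + g3 x * (s - x))) (k := 2) hK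
      (fun s hs => ?_) hx (by ring) h2
    have := (hg.deriv_one s hs).sub ((((hid s).const_mul (g2 x)).const_add (g1 x)).add
      ((((hid s).pow 2).const_mul (g3 x)).div_const 2))
    refine this.congr_deriv ?_
    norm_num
    ring
  refine ⟨h1, ?_⟩
  refine abs_le_pow_succ_of_deriv
    (f' := fun s => g1 s - (g1 x + g2 x * (s - x) + g3 x * (s - x) ^ 2 / 2)) (k := 3) hK
    (fun s hs => ?_) hx (by ring) h1
  have := (hg.deriv_zero s hs).sub (((((hid s).const_mul (g1 x)).const_add (g x)).add
    ((((hid s).pow 2).const_mul (g2 x)).div_const 2)).add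
    ((((hid s).pow 3).const_mul (g3 x)).div_const 6))
  refine this.congr_deriv ?_
  norm_num
  ring

/-- The quadratic corrector `h² (x - L/2)² / L` at the cell centres. -/
noncomputable def cornerProfile (L : ℝ) (M : ℕ) (i : Fin M) : ℝ :=
  (L / M) ^ 2 / L * (((i : ℝ) + 1 / 2) * (L / M) - L / 2) ^ 2

theorem cellCentre_mem {L : ℝ} (hL : 0 < L) {M : ℕ} (i : Fin M) :
    ((i : ℝ) + 1 / 2) * (L / M) ∈ Ioo 0 L := by
  have hM : (0 : ℝ) < M := by exact_mod_cast i.pos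
  have hi : (i : ℝ) + 1 ≤ M := by exact_mod_cast i.isLt
  refine ⟨by positivity, ?_⟩
  rw [mul_div_assoc', div_lt_iff₀ hM, mul_comm]
  exact mul_lt_mul_of_pos_left (by linarith) hL

theorem cornerProfile_bounds {L : ℝ} (hL : 0 < L) {M : ℕ} (i : Fin M) :
    0 ≤ cornerProfile L M i ∧ cornerProfile L M i ≤ L * (L / M) ^ 2 := by
  have h1 := cellCentre_mem hL i
  set x := ((i : ℝ) + 1 / 2) * (L / M)
  have h2 : (x - L / 2) ^ 2 ≤ L ^ 2 := by nlinarith [h1.1, h1.2]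
  have h3 : 0 ≤ (L / M) ^ 2 / L := by positivity
  refine ⟨mul_nonneg h3 (sq_nonneg _), (mul_le_mul_of_nonneg_left h2 h3).trans (le_of_eq ?_)⟩
  field_simp

/-- The consistency error of the second difference is at most of second order, up to the discrete
Laplacian of the quadratic corrector. -/
theorem secondDiff_consistency {K L : ℝ} {g g1 g2 g3 : ℝ → ℝ}
    (hg : NeumannSmooth K L g g1 g2 g3) (hK : 0 ≤ K) (hL : 0 < L) {M : ℕ} (i : Fin M) :
    |secondDiff (L / M) (fun a : Fin M => g (((a : ℝ) + 1 / 2) * (L / M))) i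
        - g2 (((i : ℝ) + 1 / 2) * (L / M))| ≤
      K * (2 + 2 / L) * (L / M) ^ 2 - K * secondDiff (L / M) (cornerProfile L M) i := by
  have hM : (0 : ℝ) < M := by exact_mod_cast i.pos
  have hxI := cellCentre_mem hL i
  set h := L / M with hh
  have hh0 : 0 < h := by positivity
  have hhM : M * h = L := by rw [hh]; field_simp
  set x := ((i : ℝ) + 1 / 2) * h with hx
  have hx' : x ∈ Icc 0 L := ⟨hxI.1.le, hxI.2.le⟩
  obtain ⟨hT1, hT0⟩ := hg.taylor hK hx'
  have hb3 := hg.bound x hx'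
  -- `P` and `Q` are the Taylor polynomials of the forward and backward difference quotients, so `(P
  -- - Q) / h = g2 x` exactly.
  set P := g1 x + g2 x * h / 2 + g3 x * h ^ 2 / 6 with hP
  set Q := g1 x - g2 x * h / 2 + g3 x * h ^ 2 / 6 with hQ
  have hright : |flux h (fun a : Fin M => g (((a : ℝ) + 1 / 2) * h)) i.succ - P| ≤
      K * h ^ 3 + K * (h ^ 2 / L * (2 * (x + h / 2) - L) - flux h (cornerProfile L M) i.succ) := by
    have hcast : (((i : ℕ) + 1 : ℕ) : ℝ) = i + 1 := by push_cast; ring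
    by_cases hi : (i : ℕ) + 1 < M
    · have hcond : 0 < (i.succ : ℕ) ∧ (i.succ : ℕ) < M := ⟨by simp, by simpa using hi⟩
      rw [flux, flux, dif_pos hcond, dif_pos hcond]
      simp only [Fin.val_succ, Nat.add_sub_cancel, cornerProfile, hcast, ← hh]
      have hs : x + h ∈ Icc 0 L := by
        have : ((i : ℕ) : ℝ) + 1 + 1 ≤ M := by exact_mod_cast hi
        refine ⟨by linarith [hxI.1], ?_⟩
        rw [← hhM, hx]
        nlinarith
      have h1 := hT0 (x + h) hs
      rw [show x + h - x = h by ring, abs_of_pos hh0] at h1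
      rw [show ((i : ℝ) + 1 + 1 / 2) * h = x + h by rw [hx]; ring, ← hx]
      have h2 : (h ^ 2 / L * (x + h - L / 2) ^ 2 - h ^ 2 / L * (x - L / 2) ^ 2) / h =
          h ^ 2 / L * (2 * (x + h / 2) - L) := by field_simp; ring
      rw [h2, sub_self, mul_zero, add_zero]
      have h3 : (g (x + h) - g x) / h - P = (g (x + h) - (g x + g1 x * h + g2 x * h ^ 2 / 2
          + g3 x * h ^ 3 / 6)) / h := by rw [hP]; field_simp; ring
      rw [h3, abs_div, abs_of_pos hh0, div_le_iff₀ hh0]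
      linarith
    -- At the wall the vanishing flux is exact, but it differs from `P` by `g3 x * h² / 24` up to
    -- third order. After division by `h` this is the `O(h)` defect. The missing wall flux `h²` of
    -- the corrector pays for it.
    · have hcond : ¬ (0 < (i.succ : ℕ) ∧ (i.succ : ℕ) < M) := by simp; omega
      rw [flux, flux, dif_neg hcond, dif_neg hcond]
      have hiM : ((i : ℕ) : ℝ) + 1 = M := by
        have := i.isLt
        exact_mod_cast (show (i : ℕ) + 1 = M by omega)
      have hxL : x + h / 2 = L := by rw [hx, ← hhM, ← hiM]; ring
      have h1 := hT1 L ⟨hL.le, le_rfl⟩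
      rw [hg.right, show L - x = h / 2 by linarith, abs_of_pos (half_pos hh0)] at h1
      rw [hxL, sub_zero, show h ^ 2 / L * (2 * L - L) = h ^ 2 by field_simp; ring]
      have h2 : 0 - P = (0 - (g1 x + g2 x * (h / 2) + g3 x * (h / 2) ^ 2 / 2))
        - g3 x * (h ^ 2 / 24) := by rw [hP]; ring
      rw [h2]
      refine (abs_sub _ _).trans ?_
      rw [abs_mul, abs_of_pos (show 0 < h ^ 2 / 24 by positivity)]
      have h3 := mul_le_mul_of_nonneg_right hb3 (show 0 ≤ h ^ 2 / 24 by positivity)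
      have h4 : 0 ≤ K * h ^ 3 := by positivity
      have h5 : 0 ≤ K * h ^ 2 := by positivity
      have h6 : K * (h / 2) ^ 3 = K * h ^ 3 / 8 := by ring
      linarith
  have hleft : |flux h (fun a : Fin M => g (((a : ℝ) + 1 / 2) * h)) i.castSucc - Q| ≤
      K * h ^ 3 + K * (flux h (cornerProfile L M) i.castSucc
        - h ^ 2 / L * (2 * (x - h / 2) - L)) := by
    by_cases hi : 0 < (i : ℕ)
    · have hcond : 0 < (i.castSucc : ℕ) ∧ (i.castSucc : ℕ) < M := ⟨by simpa using hi, by simp⟩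
      have hcast : (((i : ℕ) - 1 : ℕ) : ℝ) = i - 1 := by push_cast [Nat.cast_sub hi]; ring
      rw [flux, flux, dif_pos hcond, dif_pos hcond]
      simp only [Fin.val_castSucc, cornerProfile, hcast, ← hh]
      have hs : x - h ∈ Icc 0 L := by
        have : (1 : ℝ) ≤ (i : ℕ) := by exact_mod_cast hi
        refine ⟨?_, by linarith [hxI.2]⟩
        rw [hx]
        nlinarith
      have h1 := hT0 (x - h) hs
      rw [show x - h - x = -h by ring, abs_neg, abs_of_pos hh0] at h1
      rw [show ((i : ℝ) - 1 + 1 / 2) * h = x - h by rw [hx]; ring, ← hx]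
      have h2 : (h ^ 2 / L * (x - L / 2) ^ 2 - h ^ 2 / L * (x - h - L / 2) ^ 2) / h =
          h ^ 2 / L * (2 * (x - h / 2) - L) := by field_simp; ring
      rw [h2, sub_self, mul_zero, add_zero]
      have h3 : (g x - g (x - h)) / h - Q = -((g (x - h) - (g x + g1 x * (-h)
          + g2 x * (-h) ^ 2 / 2 + g3 x * (-h) ^ 3 / 6)) / h) := by rw [hQ]; field_simp; ring
      rw [h3, abs_neg, abs_div, abs_of_pos hh0, div_le_iff₀ hh0]
      linarith
    · have hcond : ¬ (0 < (i.castSucc : ℕ) ∧ (i.castSucc : ℕ) < M) := by simp; omega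
      rw [flux, flux, dif_neg hcond, dif_neg hcond]
      have hi0 : ((i : ℕ) : ℝ) = 0 := by exact_mod_cast (show (i : ℕ) = 0 by omega)
      have hxL : x = h / 2 := by rw [hx, hi0]; ring
      have h1 := hT1 0 ⟨le_rfl, hL.le⟩
      rw [hg.left, show 0 - x = -(h / 2) by linarith, abs_neg, abs_of_pos (half_pos hh0)] at h1
      rw [show h ^ 2 / L * (2 * (x - h / 2) - L) = -h ^ 2 by rw [hxL]; field_simp; ring]
      have h2 : 0 - Q = (0 - (g1 x + g2 x * (-(h / 2)) + g3 x * (-(h / 2)) ^ 2 / 2))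
        - g3 x * (h ^ 2 / 24) := by rw [hQ]; ring
      rw [h2]
      refine (abs_sub _ _).trans ?_
      rw [abs_mul, abs_of_pos (show 0 < h ^ 2 / 24 by positivity)]
      have h3 := mul_le_mul_of_nonneg_right hb3 (show 0 ≤ h ^ 2 / 24 by positivity)
      have h4 : 0 ≤ K * h ^ 3 := by positivity
      have h5 : 0 ≤ K * h ^ 2 := by positivity
      have h6 : K * (h / 2) ^ 3 = K * h ^ 3 / 8 := by ring
      linarith
  rw [secondDiff, secondDiff]
  set F1 := flux h (fun a : Fin M => g (((a : ℝ) + 1 / 2) * h)) i.succ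
  set F0 := flux h (fun a : Fin M => g (((a : ℝ) + 1 / 2) * h)) i.castSucc
  set G1 := flux h (cornerProfile L M) i.succ
  set G0 := flux h (cornerProfile L M) i.castSucc
  have h1 : (F1 - F0) / h - g2 x = ((F1 - P) - (F0 - Q)) / h := by
    rw [hP, hQ]; field_simp; ring
  rw [h1, abs_div, abs_of_pos hh0, div_le_iff₀ hh0]
  have h2 : (K * (2 + 2 / L) * h ^ 2 - K * ((G1 - G0) / h)) * h =
      K * h ^ 3 + K * (h ^ 2 / L * (2 * (x + h / 2) - L) - G1) +
      (K * h ^ 3 + K * (G0 - h ^ 2 / L * (2 * (x - h / 2) - L))) := by field_simp; ring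
  rw [h2]
  exact (abs_sub _ _).trans (add_le_add hright hleft)

/-- The directional derivatives along a line of a function that is `C³` on a closed set. -/
theorem hasDerivWithinAt_iteratedFDerivWithin_line {L : ℝ} {F : ℝ × ℝ → ℝ} {S : Set (ℝ × ℝ)}
    (hS : UniqueDiffOn ℝ S) (hF : ContDiffOn ℝ 3 F S) (v : ℝ × ℝ) {c : ℝ → ℝ × ℝ}
    (hc : ∀ s ∈ Icc 0 L, HasDerivWithinAt c v (Icc 0 L) s) (hcS : MapsTo c (Icc 0 L) S)
    {k : ℕ} (hk : k < 3) {s : ℝ} (hs : s ∈ Icc 0 L) :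
    HasDerivWithinAt (fun s => iteratedFDerivWithin ℝ k F S (c s) (fun _ => v))
      (iteratedFDerivWithin ℝ (k + 1) F S (c s) (fun _ => v)) (Icc 0 L) s := by
  have h1 : DifferentiableWithinAt ℝ (iteratedFDerivWithin ℝ k F S) S (c s) :=
    hF.differentiableOn_iteratedFDerivWithin (by exact_mod_cast hk) hS _ (hcS hs)
  have h2 := h1.hasFDerivWithinAt.comp_hasDerivWithinAt s (hc s hs) hcS
  have h3 := ((ContinuousMultilinearMap.apply ℝ (fun _ : Fin k => ℝ × ℝ) ℝ
    (fun _ => v)).hasFDerivAt).comp_hasDerivWithinAt s h2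
  rw [iteratedFDerivWithin_succ_apply_left]
  exact h3

theorem iteratedDeriv_two_eq {L : ℝ} {g g1 g2 : ℝ → ℝ}
    (h0 : ∀ s ∈ Icc 0 L, HasDerivWithinAt g (g1 s) (Icc 0 L) s)
    (h1 : ∀ s ∈ Icc 0 L, HasDerivWithinAt g1 (g2 s) (Icc 0 L) s) {x : ℝ} (hx : x ∈ Ioo 0 L) :
    iteratedDeriv 2 g x = g2 x := by
  have hd : ∀ s ∈ Ioo 0 L, deriv g s = g1 s := fun s hs =>
    ((h0 s (Ioo_subset_Icc_self hs)).hasDerivAt (Icc_mem_nhds hs.1 hs.2)).deriv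
  rw [iteratedDeriv_succ, iteratedDeriv_one]
  have he : deriv g =ᶠ[nhds x] g1 := by
    filter_upwards [Ioo_mem_nhds hx.1 hx.2] with s hs using hd s hs
  rw [he.deriv_eq]
  exact ((h1 x (Ioo_subset_Icc_self hx)).hasDerivAt (Icc_mem_nhds hx.1 hx.2)).deriv

/-- Restriction to a line parallel to an axis keeps the constant `K`, because the direction has norm
1. Uniqueness of one-sided derivatives identifies the end values of `g1` with the Neumann data. -/
theorem exists_neumannSmooth_line {K L : ℝ} (hL : 0 < L) {F : ℝ × ℝ → ℝ}
    (hF : ContDiffOn ℝ 3 F (closedSquare L))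
    (hb : ∀ p ∈ closedSquare L, ‖iteratedFDerivWithin ℝ 3 F (closedSquare L) p‖ ≤ K)
    (hlip : ∀ p ∈ closedSquare L, ∀ q ∈ closedSquare L,
      ‖iteratedFDerivWithin ℝ 3 F (closedSquare L) p
        - iteratedFDerivWithin ℝ 3 F (closedSquare L) q‖ ≤ K * ‖p - q‖)
    (v : ℝ × ℝ) (hv : ‖v‖ = 1) {c : ℝ → ℝ × ℝ}
    (hc : ∀ s ∈ Icc 0 L, HasDerivWithinAt c v (Icc 0 L) s)
    (hcS : MapsTo c (Icc 0 L) (closedSquare L)) (hcl : ∀ s r, ‖c s - c r‖ = |s - r|)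
    (h0 : HasDerivWithinAt (fun s => F (c s)) 0 (Icc 0 L) 0)
    (h1 : HasDerivWithinAt (fun s => F (c s)) 0 (Icc 0 L) L) :
    ∃ g1 g2 g3 : ℝ → ℝ, NeumannSmooth K L (fun s => F (c s)) g1 g2 g3 := by
  have hS : UniqueDiffOn ℝ (closedSquare L) :=
    (uniqueDiffOn_Icc hL).prod (uniqueDiffOn_Icc hL)
  have hU := uniqueDiffOn_Icc hL
  have hline := fun (k : ℕ) (hk : k < 3) (s : ℝ) (hs : s ∈ Icc 0 L) =>
    hasDerivWithinAt_iteratedFDerivWithin_line hS hF v hc hcS hk hs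
  have hd0 : ∀ s ∈ Icc 0 L, HasDerivWithinAt (fun s => F (c s))
      (iteratedFDerivWithin ℝ 1 F (closedSquare L) (c s) (fun _ => v)) (Icc 0 L) s := fun s hs => by
    simpa using hline 0 (by norm_num) s hs
  have hle : ∀ A : ContinuousMultilinearMap ℝ (fun _ : Fin 3 => ℝ × ℝ) ℝ,
      |A (fun _ => v)| ≤ ‖A‖ := fun A => by
    have := A.le_opNorm (fun _ => v)
    simpa [hv] using this
  refine ⟨_, _, fun s => iteratedFDerivWithin ℝ 3 F (closedSquare L) (c s) (fun _ => v),
    hd0, hline 1 (by norm_num), hline 2 (by norm_num), fun s hs => (hle _).trans (hb _ (hcS hs)),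
    fun s hs r hr => ?_, ?_, ?_⟩
  · rw [← hcl s r]
    exact (hle (iteratedFDerivWithin ℝ 3 F (closedSquare L) (c s)
      - iteratedFDerivWithin ℝ 3 F (closedSquare L) (c r))).trans (hlip _ (hcS hs) _ (hcS hr))
  · exact (hU 0 ⟨le_rfl, hL.le⟩).eq_deriv _ (hd0 0 ⟨le_rfl, hL.le⟩) h0
  · exact (hU L ⟨hL.le, le_rfl⟩).eq_deriv _ (hd0 L ⟨hL.le, le_rfl⟩) h1

/-- Consistency of the discrete Neumann Laplacian, up to the discrete Laplacian of the corrector. -/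
theorem discreteLaplacian_consistency {K T L : ℝ} (hL : 0 < L) {φ : ℝ → ℝ → ℝ → ℝ} {α ε : ℝ}
    {f : ℝ → ℝ} (hφ : IsSolution α ε T L f φ) (hsp : SpaceRegular K T L φ) {t : ℝ}
    (ht : t ∈ Ioc 0 T) {M : ℕ} (i j : Fin M) :
    |discreteLaplacian (L / M) (restrict L M (φ t)) i j
        - laplacian (φ t) (((i : ℝ) + 1 / 2) * (L / M)) (((j : ℝ) + 1 / 2) * (L / M))| ≤
      K * (4 + 4 / L) * (L / M) ^ 2 - discreteLaplacian (L / M)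
        (fun i j => K * (cornerProfile L M i + cornerProfile L M j)) i j := by
  obtain ⟨hC, hB, hLip⟩ := hsp t ht
  have hK : 0 ≤ K := (norm_nonneg _).trans
    (hB 0 (by norm_num) (0, 0) ⟨⟨le_rfl, hL.le⟩, ⟨le_rfl, hL.le⟩⟩)
  have hxi := cellCentre_mem hL i
  have hyj := cellCentre_mem hL j
  set x := ((i : ℝ) + 1 / 2) * (L / M)
  set y := ((j : ℝ) + 1 / 2) * (L / M)
  have hx' := Ioo_subset_Icc_self hxi
  have hy' := Ioo_subset_Icc_self hyj
  obtain ⟨g1, g2, g3, hg⟩ := exists_neumannSmooth_line hL hC (hB 3 le_rfl) hLip (1, 0)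
    (by simp) (c := fun s => (s, y))
    (fun s _ => (hasDerivWithinAt_id s _).prodMk (hasDerivWithinAt_const s _ y))
    (fun s hs => ⟨hs, hy'⟩) (fun s r => by simp [Prod.norm_def])
    (hφ.neumann_left t ht y hy') (hφ.neumann_right t ht y hy')
  obtain ⟨k1, k2, k3, hk⟩ := exists_neumannSmooth_line hL hC (hB 3 le_rfl) hLip (0, 1)
    (by simp) (c := fun s => (x, s))
    (fun s _ => (hasDerivWithinAt_const s _ x).prodMk (hasDerivWithinAt_id s _))
    (fun s hs => ⟨hx', hs⟩) (fun s r => by simp [Prod.norm_def])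
    (hφ.neumann_bottom t ht x hx') (hφ.neumann_top t ht x hx')
  have e1 := secondDiff_consistency hg hK hL i
  have e2 := secondDiff_consistency hk hK hL j
  have hlap : laplacian (φ t) x y = g2 x + k2 y := by
    rw [laplacian, iteratedDeriv_two_eq hg.deriv_zero hg.deriv_one hxi,
      iteratedDeriv_two_eq hk.deriv_zero hk.deriv_one hyj]
  have hlin : ∀ (a : Fin M) (b : ℝ), secondDiff (L / M)
      (fun a => K * (cornerProfile L M a + b)) a = K * secondDiff (L / M) (cornerProfile L M) a := by
    intro a b
    simp only [secondDiff, flux]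
    split_ifs <;> ring
  have hlin' : ∀ (a : Fin M) (b : ℝ), secondDiff (L / M)
      (fun a => K * (b + cornerProfile L M a)) a = K * secondDiff (L / M) (cornerProfile L M) a := by
    intro a b
    simp only [add_comm b, hlin]
  rw [discreteLaplacian_eq_secondDiff, discreteLaplacian_eq_secondDiff, hlin, hlin', hlap]
  have e3 := (abs_add_le _ _).trans (add_le_add e1 e2)
  refine (le_of_eq ?_).trans (e3.trans (le_of_eq (by ring)))
  congr 1
  simp only [restrict]
  ring

end TFAC

namespace TFAC

open Set MeasureTheory intervalIntegral

/-! ### Consistency of the fast L1 formula -/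

/-- Regularity in time of a function of one variable, with a weak singularity at `0`. -/
structure WeaklySingular (σ c T : ℝ) (u : ℝ → ℝ) : Prop where
  continuousOn : ContinuousOn u (Icc 0 T)
  differentiableAt : ∀ r ∈ Ioo 0 T, DifferentiableAt ℝ u r
  differentiableAt_deriv : ∀ r ∈ Ioo 0 T, DifferentiableAt ℝ (deriv u) r
  deriv_le : ∀ r ∈ Ioo 0 T, |deriv u r| ≤ c * r ^ (σ - 1)
  deriv_deriv_le : ∀ r ∈ Ioo 0 T, |deriv (deriv u) r| ≤ c * r ^ (σ - 2)

theorem intervalIntegrable_of_abs_le {f g : ℝ → ℝ} {a b : ℝ} (hab : a ≤ b) (hf : Measurable f)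
    (hg : IntervalIntegrable g volume a b) (h : ∀ x ∈ Ioo a b, |f x| ≤ g x) :
    IntervalIntegrable f volume a b := by
  rw [intervalIntegrable_iff_integrableOn_Ioo_of_le hab] at hg ⊢
  refine Integrable.mono' hg hf.aestronglyMeasurable ?_
  exact (ae_restrict_iff' measurableSet_Ioo).2 (Filter.Eventually.of_forall h)

theorem abs_integral_le_of_abs_le {f g : ℝ → ℝ} {a b : ℝ} (hab : a ≤ b)
    (hg : IntervalIntegrable g volume a b) (h : ∀ x ∈ Ioo a b, |f x| ≤ g x) :
    |∫ x in a..b, f x| ≤ ∫ x in a..b, g x := by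
  rw [← Real.norm_eq_abs]
  refine intervalIntegral.norm_integral_le_of_norm_le hab ?_ hg
  have hb : ∀ᵐ x : ℝ, x ≠ b := by simp [ae_iff]
  filter_upwards [hb] with x hx hxI using h x ⟨hxI.1, lt_of_le_of_ne hxI.2 hx⟩

theorem measurable_rlKernel_sub (α c : ℝ) : Measurable (fun r => rlKernel α (c - r)) := by
  unfold rlKernel
  exact ((measurable_const.sub measurable_id).pow_const _).div_const _

theorem integral_rlKernel_sub {α a b : ℝ} (hα : α ∈ Ioo (0 : ℝ) 1) :
    ∫ r in a..b, rlKernel α (b - r) = (b - a) ^ (1 - α) / Real.Gamma (2 - α) := by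
  have h1 : Real.Gamma (2 - α) = (1 - α) * Real.Gamma (1 - α) := by
    rw [show 2 - α = (1 - α) + 1 by ring, Real.Gamma_add_one (by linarith [hα.2])]
  simp only [rlKernel]
  rw [intervalIntegral.integral_div, integral_sub_left_rpow hα.2, h1, div_div]

theorem intervalIntegrable_rlKernel_sub {α a b : ℝ} (hα : α ∈ Ioo (0 : ℝ) 1) :
    IntervalIntegrable (fun r => rlKernel α (b - r)) volume a b := by
  have h1 : IntervalIntegrable (fun x : ℝ => x ^ (-α)) volume (b - a) (b - b) :=
    intervalIntegrable_rpow' (by linarith [hα.2])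
  have h2 := h1.comp_sub_left b
  simp only [sub_sub_cancel] at h2
  exact h2.div_const _

namespace WeaklySingular

variable {σ c T : ℝ} {u : ℝ → ℝ}

theorem const_nonneg (hu : WeaklySingular σ c T u) (hT : 0 < T) : 0 ≤ c := by
  have h1 := (abs_nonneg _).trans (hu.deriv_le (T / 2) ⟨by linarith, by linarith⟩)
  have h2 : 0 < (T / 2) ^ (σ - 1) := Real.rpow_pos_of_pos (by linarith) _
  by_contra! h
  linarith [mul_neg_of_neg_of_pos h h2]

theorem intervalIntegrable_deriv (hu : WeaklySingular σ c T u) (hσ : 0 < σ) {a b : ℝ} (ha : 0 ≤ a)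
    (hab : a ≤ b) (hb : b ≤ T) : IntervalIntegrable (deriv u) volume a b :=
  intervalIntegrable_of_abs_le hab (measurable_deriv u)
    ((intervalIntegrable_rpow' (by linarith)).const_mul c)
    fun x hx => hu.deriv_le x ⟨ha.trans_lt hx.1, hx.2.trans_le hb⟩

theorem integral_deriv (hu : WeaklySingular σ c T u) (hσ : 0 < σ) {a b : ℝ} (ha : 0 ≤ a)
    (hab : a ≤ b) (hb : b ≤ T) : ∫ r in a..b, deriv u r = u b - u a :=
  integral_eq_sub_of_hasDerivAt_of_le hab
    (hu.continuousOn.mono (Icc_subset_Icc ha hb))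
    (fun x hx => (hu.differentiableAt x ⟨ha.trans_lt hx.1, hx.2.trans_le hb⟩).hasDerivAt)
    (hu.intervalIntegrable_deriv hσ ha hab hb)

theorem integral_abs_deriv_le (hu : WeaklySingular σ c T u) (hσ : 0 < σ) {b : ℝ}
    (hb0 : 0 ≤ b) (hb : b ≤ T) : ∫ r in (0 : ℝ)..b, |deriv u r| ≤ c * (b ^ σ / σ) := by
  have h1 : ∫ r in (0 : ℝ)..b, c * r ^ (σ - 1) = c * (b ^ σ / σ) := by
    rw [intervalIntegral.integral_const_mul, integral_rpow (Or.inl (by linarith)), sub_add_cancel,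
      Real.zero_rpow hσ.ne', sub_zero]
  rw [← h1]
  exact integral_mono_on_of_le_Ioo hb0 (hu.intervalIntegrable_deriv hσ le_rfl hb0 hb).abs
    ((intervalIntegrable_rpow' (by linarith)).const_mul c)
    fun x hx => hu.deriv_le x ⟨hx.1, hx.2.trans_le hb⟩

theorem abs_sub_zero_le (hu : WeaklySingular σ c T u) (hσ : 0 < σ) {b : ℝ}
    (hb0 : 0 ≤ b) (hb : b ≤ T) : |u b - u 0| ≤ c * (b ^ σ / σ) := by
  rw [← hu.integral_deriv hσ le_rfl hb0 hb]
  exact (abs_integral_le_integral_abs hb0).trans (hu.integral_abs_deriv_le hσ hb0 hb)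

theorem exists_slope (hu : WeaklySingular σ c T u) {a b : ℝ} (ha : 0 < a) (hab : a < b)
    (hb : b ≤ T) : ∃ ξ ∈ Ioo a b, deriv u ξ = (u b - u a) / (b - a) :=
  exists_deriv_eq_slope u hab (hu.continuousOn.mono (Icc_subset_Icc ha.le hb)) fun x hx =>
    (hu.differentiableAt x ⟨ha.trans hx.1, hx.2.trans_le hb⟩).differentiableWithinAt

theorem abs_sub_le (hu : WeaklySingular σ c T u) (hσ : σ < 1) {a b : ℝ} (ha : 0 < a)
    (hab : a < b) (hb : b ≤ T) : |u b - u a| ≤ c * a ^ (σ - 1) * (b - a) := by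
  obtain ⟨ξ, hξ, h⟩ := hu.exists_slope ha hab hb
  have hba : 0 < b - a := sub_pos.2 hab
  have hc := hu.const_nonneg (ha.trans (hab.trans_le hb))
  rw [eq_div_iff hba.ne'] at h
  rw [← h, abs_mul, abs_of_pos hba]
  refine mul_le_mul_of_nonneg_right ((hu.deriv_le ξ ⟨ha.trans hξ.1, hξ.2.trans_le hb⟩).trans ?_)
    hba.le
  exact mul_le_mul_of_nonneg_left
    (Real.rpow_le_rpow_of_nonpos ha hξ.1.le (by linarith)) hc

/-- The slope is the derivative at an intermediate point, and away from `0` the second derivative is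
largest at the left end. -/
theorem abs_slope_sub_deriv_le (hu : WeaklySingular σ c T u) (hσ : σ < 1) {a b : ℝ} (ha : 0 < a)
    (hab : a < b) (hb : b ≤ T) {r : ℝ} (hr : r ∈ Ioo a b) :
    |(u b - u a) / (b - a) - deriv u r| ≤ c * a ^ (σ - 2) * (b - a) := by
  obtain ⟨ξ, hξ, h⟩ := hu.exists_slope ha hab hb
  have hc := hu.const_nonneg (ha.trans (hab.trans_le hb))
  rw [← h]
  have hmem : ∀ x ∈ Ioo a b, x ∈ Ioo 0 T := fun x hx => ⟨ha.trans hx.1, hx.2.trans_le hb⟩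
  have h1 := Convex.norm_image_sub_le_of_norm_deriv_le (f := deriv u) (s := Ioo a b)
    (C := c * a ^ (σ - 2)) (fun x hx => hu.differentiableAt_deriv x (hmem x hx))
    (fun x hx => (hu.deriv_deriv_le x (hmem x hx)).trans (mul_le_mul_of_nonneg_left
      (Real.rpow_le_rpow_of_nonpos ha hx.1.le (by linarith)) hc)) (convex_Ioo a b) hr hξ
  refine h1.trans (mul_le_mul_of_nonneg_left ?_ (mul_nonneg hc (Real.rpow_nonneg ha.le _)))
  rw [Real.norm_eq_abs, abs_le]
  constructor <;> linarith [hr.1, hr.2, hξ.1, hξ.2]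

/-- The weakly singular majorant of the integrand of the Caputo derivative. -/
theorem abs_rlKernel_mul_deriv_le (hu : WeaklySingular σ c T u) {α : ℝ} (hα : α ∈ Ioo (0 : ℝ) 1)
    (hσ : σ < 1) {τ : ℝ} (hτ : 0 < τ) (hτT : τ ≤ T) {r : ℝ} (hr : r ∈ Ioo 0 τ) :
    |rlKernel α (τ - r) * deriv u r| ≤
      rlKernel α (τ / 2) * (c * r ^ (σ - 1)) + c * (τ / 2) ^ (σ - 1) * rlKernel α (τ - r) := by
  have hc := hu.const_nonneg (hτ.trans_le hτT)
  have h1 := hu.deriv_le r ⟨hr.1, hr.2.trans_le hτT⟩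
  have h2 := rlKernel_pos hα (show 0 < τ - r by linarith [hr.2])
  have h3 := rlKernel_pos hα (half_pos hτ)
  have h4 : 0 ≤ c * r ^ (σ - 1) := mul_nonneg hc (Real.rpow_nonneg hr.1.le _)
  have h5 : 0 ≤ c * (τ / 2) ^ (σ - 1) := mul_nonneg hc (Real.rpow_nonneg (half_pos hτ).le _)
  rw [abs_mul, abs_of_pos h2]
  -- On each half of the interval only one factor is singular; the other is bounded by its value at
  -- the midpoint.
  rcases le_total r (τ / 2) with h | h
  · have h6 := rlKernel_anti hα (half_pos hτ) (show τ / 2 ≤ τ - r by linarith)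
    have h7 := mul_le_mul h6 h1 (abs_nonneg _) h3.le
    have h8 := mul_nonneg h5 h2.le
    linarith
  · have h6 : c * r ^ (σ - 1) ≤ c * (τ / 2) ^ (σ - 1) := mul_le_mul_of_nonneg_left
      (Real.rpow_le_rpow_of_nonpos (half_pos hτ) h (by linarith)) hc
    have h7 := mul_le_mul_of_nonneg_left (h1.trans h6) h2.le
    have h8 := mul_nonneg h3.le h4
    linarith

theorem intervalIntegrable_majorant {α τ : ℝ} (hα : α ∈ Ioo (0 : ℝ) 1) (hσ : 0 < σ) :
    IntervalIntegrable (fun r => rlKernel α (τ / 2) * (c * r ^ (σ - 1)) +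
      c * (τ / 2) ^ (σ - 1) * rlKernel α (τ - r)) volume 0 τ :=
  (((intervalIntegrable_rpow' (by linarith)).const_mul c).const_mul _).add
    ((intervalIntegrable_rlKernel_sub hα).const_mul _)

theorem intervalIntegrable_caputo (hu : WeaklySingular σ c T u) {α : ℝ} (hα : α ∈ Ioo (0 : ℝ) 1)
    (hσ : σ ∈ Ioo (0 : ℝ) 1) {τ : ℝ} (hτ : 0 < τ) (hτT : τ ≤ T) :
    IntervalIntegrable (fun r => rlKernel α (τ - r) * deriv u r) volume 0 τ :=
  intervalIntegrable_of_abs_le hτ.le ((measurable_rlKernel_sub α τ).mul (measurable_deriv u))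
    (intervalIntegrable_majorant hα hσ.1)
    fun _ hr => hu.abs_rlKernel_mul_deriv_le hα hσ.2 hτ hτT hr

/-- The Caputo derivative at a small time. -/
theorem abs_integral_caputo_le (hu : WeaklySingular σ c T u) {α : ℝ} (hα : α ∈ Ioo (0 : ℝ) 1)
    (hσ : σ ∈ Ioo (0 : ℝ) 1) {τ : ℝ} (hτ : 0 < τ) (hτT : τ ≤ T) :
    |∫ r in (0 : ℝ)..τ, rlKernel α (τ - r) * deriv u r| ≤
      τ ^ (-α) / Real.Gamma (2 - α) * (4 * c * (τ ^ σ / σ)) := by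
  have hc := hu.const_nonneg (hτ.trans_le hτT)
  refine (abs_integral_le_of_abs_le hτ.le (intervalIntegrable_majorant (c := c) hα hσ.1)
    fun _ hr => hu.abs_rlKernel_mul_deriv_le hα hσ.2 hτ hτT hr).trans ?_
  have hΓ : 0 < Real.Gamma (1 - α) := Real.Gamma_pos_of_pos (by linarith [hα.2])
  have hα1 : 0 < 1 - α := by linarith [hα.2]
  have hG : Real.Gamma (2 - α) = (1 - α) * Real.Gamma (1 - α) := by
    rw [show 2 - α = (1 - α) + 1 by ring, Real.Gamma_add_one hα1.ne']
  have hσ0 := hσ.1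
  rw [intervalIntegral.integral_add
    (((intervalIntegrable_rpow' (by linarith [hσ.1])).const_mul c).const_mul _)
    ((intervalIntegrable_rlKernel_sub hα).const_mul _), intervalIntegral.integral_const_mul,
    intervalIntegral.integral_const_mul, intervalIntegral.integral_const_mul,
    integral_rpow (Or.inl (by linarith [hσ.1])), sub_add_cancel, Real.zero_rpow hσ.1.ne', sub_zero,
    integral_rlKernel_sub hα, sub_zero, rlKernel, Real.div_rpow hτ.le zero_le_two,
    Real.div_rpow hτ.le zero_le_two, show 1 - α = -α + 1 by ring, Real.rpow_add hτ, Real.rpow_one,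
    Real.rpow_sub hτ, Real.rpow_one, Real.rpow_neg zero_le_two, hG,
    show σ - 1 = -(1 - σ) by ring, Real.rpow_neg zero_le_two, show -α + 1 = 1 - α by ring]
  have h2α : (2 : ℝ) ^ α ≤ 2 := by
    simpa using Real.rpow_le_rpow_of_exponent_le one_le_two hα.2.le
  have h2σ : (2 : ℝ) ^ (1 - σ) ≤ 2 := by
    simpa using Real.rpow_le_rpow_of_exponent_le one_le_two (show 1 - σ ≤ 1 by linarith)
  have hp : 0 < (2 : ℝ) ^ α := Real.rpow_pos_of_pos two_pos _
  have hq : 0 < (2 : ℝ) ^ (1 - σ) := Real.rpow_pos_of_pos two_pos _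
  set A := τ ^ (-α) with hA
  have hA0 : 0 < A := Real.rpow_pos_of_pos hτ _
  set B := τ ^ σ with hB
  have hB0 : 0 < B := Real.rpow_pos_of_pos hτ _
  set p := (2 : ℝ) ^ α
  set q := (2 : ℝ) ^ (1 - σ)
  have hκ : 0 ≤ c * A * B / (Real.Gamma (1 - α) * (1 - α) * σ) := by positivity
  have e1 : A / p⁻¹ / Real.Gamma (1 - α) * (c * (B / σ)) +
      c * (B / τ / q⁻¹) * (A * τ / ((1 - α) * Real.Gamma (1 - α))) =
      c * A * B / (Real.Gamma (1 - α) * (1 - α) * σ) * (p * (1 - α) + q * σ) := by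
    field_simp
  have e2 : A / ((1 - α) * Real.Gamma (1 - α)) * (4 * c * (B / σ)) =
      c * A * B / (Real.Gamma (1 - α) * (1 - α) * σ) * 4 := by
    field_simp
  rw [e1, e2]
  refine mul_le_mul_of_nonneg_left ?_ hκ
  nlinarith [hα.1, hσ.1, hσ.2]

end WeaklySingular

/-- The scale of the local interpolation error on the interval from `t k` to `t (k+1)`. -/
noncomputable def localScale (σ c : ℝ) (t : ℕ → ℝ) (k : ℕ) : ℝ :=
  if k = 0 then 5 * c * (step t 1 ^ σ / σ) else c * (step t (k + 1) ^ 2 * t k ^ (σ - 2))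

section Truncation

variable {α T : ℝ} {N : ℕ} {t : ℕ → ℝ} {σ c : ℝ} {u : ℝ → ℝ}

theorem WeaklySingular.integral_abs_slope_sub_deriv_le (hu : WeaklySingular σ c T u)
    (hσ : σ ∈ Ioo (0 : ℝ) 1) (hT : 0 < T) (ht : IsMesh T N t) {k : ℕ} (hk : k < N) :
    ∫ r in (t k)..(t (k + 1)), |(u (t (k + 1)) - u (t k)) / (t (k + 1) - t k) - deriv u r| ≤
      localScale σ c t k := by
  have hlt := ht.lt k hk
  have hba : 0 < t (k + 1) - t k := sub_pos.2 hlt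
  have hT' := ht.le (show k + 1 ≤ N by omega)
  have hc := hu.const_nonneg hT
  have hint := hu.intervalIntegrable_deriv hσ.1 (ht.nonneg hk.le) hlt.le hT'
  have hint' : IntervalIntegrable
      (fun r => (u (t (k + 1)) - u (t k)) / (t (k + 1) - t k) - deriv u r) volume
      (t k) (t (k + 1)) := intervalIntegrable_const.sub hint
  -- The bound on the second derivative is not integrable at `0`, so on the first interval slope and
  -- derivative are estimated separately in `L¹`.
  rcases Nat.eq_zero_or_pos k with rfl | hk0
  · rw [localScale, if_pos rfl]
    have h1 : ∫ r in (t 0)..(t (0 + 1)), |(u (t (0 + 1)) - u (t 0)) / (t (0 + 1) - t 0) - deriv u r|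
        ≤ ∫ r in (t 0)..(t (0 + 1)), (|(u (t (0 + 1)) - u (t 0)) / (t (0 + 1) - t 0)|
          + |deriv u r|) :=
      integral_mono_on hlt.le hint'.abs (intervalIntegrable_const.add hint.abs)
        fun r _ => abs_sub _ _
    refine h1.trans ?_
    rw [intervalIntegral.integral_add intervalIntegrable_const hint.abs,
      intervalIntegral.integral_const, smul_eq_mul, abs_div, abs_of_pos hba,
      mul_div_cancel₀ _ hba.ne', ht.zero, zero_add]
    have e : step t 1 = t 1 := by rw [step_succ, ht.zero, sub_zero]
    rw [zero_add] at hT' hlt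
    rw [ht.zero] at hlt
    have h2 := hu.abs_sub_zero_le hσ.1 hlt.le hT'
    have h3 := hu.integral_abs_deriv_le hσ.1 hlt.le hT'
    have h4 : 0 ≤ c * (t 1 ^ σ / σ) :=
      mul_nonneg hc (div_nonneg (Real.rpow_nonneg hlt.le _) hσ.1.le)
    rw [e]
    linarith
  · rw [localScale, if_neg hk0.ne', step_succ]
    have h1 := integral_mono_on_of_le_Ioo hlt.le hint'.abs intervalIntegrable_const
      fun r hr => hu.abs_slope_sub_deriv_le hσ.2 (ht.pos hk0 hk.le) hlt hT' hr
    refine h1.trans (le_of_eq ?_)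
    rw [intervalIntegral.integral_const, smul_eq_mul]
    ring

/-- The local consistency error of a monotone kernel on a history interval. -/
theorem abs_average_mul_sub_integral_le {S : ℝ → ℝ} (hS : Antitone S) (hSc : Continuous S)
    {a b z J : ℝ} (hab : a < b) (hint : IntervalIntegrable (deriv u) volume a b)
    (hftc : ∫ r in a..b, deriv u r = u b - u a)
    (hJ : ∫ r in a..b, |(u b - u a) / (b - a) - deriv u r| ≤ J) :
    |1 / (b - a) * (∫ r in a..b, S (z - r)) * (u b - u a) - ∫ r in a..b, S (z - r) * deriv u r| ≤
      (S (z - b) - S (z - a)) * J := by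
  have hba : 0 < b - a := sub_pos.2 hab
  set d := (u b - u a) / (b - a) with hd
  have hcont : Continuous (fun r => S (z - r)) := hSc.comp (by fun_prop)
  have hSu : IntervalIntegrable (fun r => S (z - r) * deriv u r) volume a b :=
    hint.continuousOn_mul hcont.continuousOn
  -- The interpolation error of the derivative has mean zero, so a constant may be subtracted from
  -- the kernel; only the oscillation of `S` survives.
  have hmean : ∫ r in a..b, (d - deriv u r) = 0 := by
    rw [intervalIntegral.integral_sub intervalIntegrable_const hint, hftc,
      intervalIntegral.integral_const, smul_eq_mul, hd, mul_div_cancel₀ _ hba.ne', sub_self]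
  have hdu : IntervalIntegrable (fun r => d - deriv u r) volume a b :=
    intervalIntegrable_const.sub hint
  have e : 1 / (b - a) * (∫ r in a..b, S (z - r)) * (u b - u a)
      - ∫ r in a..b, S (z - r) * deriv u r =
      ∫ r in a..b, (S (z - r) - S (z - a)) * (d - deriv u r) := by
    have e1 : ∀ r, (S (z - r) - S (z - a)) * (d - deriv u r) =
        (S (z - r) * d - S (z - r) * deriv u r) - S (z - a) * (d - deriv u r) := fun r => by ring
    simp only [e1]
    rw [intervalIntegral.integral_sub
      (((hcont.intervalIntegrable _ _).mul_const _).sub hSu) (hdu.const_mul _),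
      intervalIntegral.integral_sub ((hcont.intervalIntegrable _ _).mul_const _) hSu,
      intervalIntegral.integral_const_mul (S (z - a)), hmean,
      intervalIntegral.integral_mul_const, hd]
    ring
  rw [e]
  have hS0 : 0 ≤ S (z - b) - S (z - a) := sub_nonneg.2 (hS (by linarith))
  refine (abs_integral_le_of_abs_le (g := fun r => (S (z - b) - S (z - a)) * |d - deriv u r|)
    hab.le (hdu.abs.const_mul _) fun r hr => ?_).trans ?_
  · rw [abs_mul]
    refine mul_le_mul_of_nonneg_right ?_ (abs_nonneg _)
    have h1 := hS (show z - r ≤ z - a by linarith [hr.1])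
    have h2 := hS (show z - b ≤ z - r by linarith [hr.2])
    rw [abs_of_nonneg (by linarith)]
    linarith
  · rw [intervalIntegral.integral_const_mul]
    exact mul_le_mul_of_nonneg_left hJ hS0

theorem caputo_eq_integral (α : ℝ) (u : ℝ → ℝ) (x : ℝ) :
    caputo α u x = ∫ r in (0 : ℝ)..x, rlKernel α (x - r) * deriv u r := by
  rw [caputo, riemannLiouville, ← intervalIntegral.integral_const_mul]
  refine intervalIntegral.integral_congr fun r _ => ?_
  simp only [rlKernel, show 1 - α - 1 = -α by ring]
  ring

/-- Consistency of the fast L1 formula. -/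
theorem WeaklySingular.fastL1_consistency (hu : WeaklySingular σ c T u) (hα : α ∈ Ioo (0 : ℝ) 1)
    (hσ : σ ∈ Ioo (0 : ℝ) 1) (hT : 0 < T) (ht : IsMesh T N t) {δ tol : ℝ} {m : ℕ}
    {w s : Fin m → ℝ} (hδ : 0 < δ) (hs : IsSOE α T δ tol w s)
    (hcut : ∀ k, 1 ≤ k → k ≤ N → δ ≤ step t k) (htol0 : 0 ≤ tol)
    (htol : tol ≤ α / (Real.Gamma (2 - α) * (max 1 (maxStep t N)) ^ α)) {n : ℕ} (hn : n < N) :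
    |convDiff (fastKernel α t w s n) (fun k => u (t k)) n (u (t (n + 1)))
        - caputo α u (t (n + 1))| ≤
      fastKernel α t w s n n * localScale σ c t n
        + 2 * ∑ k ∈ Finset.range n, (fastKernel α t w s n (k + 1) - fastKernel α t w s n k)
            * localScale σ c t k
        + c * (T ^ σ / σ) * tol := by
  have hc := hu.const_nonneg hT
  set z := t (n + 1) with hz
  have hz0 : 0 < z := ht.pos (by omega) hn
  have hzT : z ≤ T := ht.le hn
  have hzn : t n < z := ht.lt n hn
  have hci := hu.intervalIntegrable_caputo hα hσ hz0 hzT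
  have hsub : ∀ k ≤ n, IntervalIntegrable (fun r => rlKernel α (z - r) * deriv u r) volume
      (t k) (t (k + 1)) := fun k hk => by
    refine hci.mono_set ?_
    rw [uIcc_of_le hz0.le, uIcc_of_le (ht.lt k (by omega)).le]
    exact Icc_subset_Icc (ht.nonneg (by omega)) (ht.mono (by omega) hn)
  have hdi : ∀ k ≤ n, IntervalIntegrable (deriv u) volume (t k) (t (k + 1)) := fun k hk =>
    hu.intervalIntegrable_deriv hσ.1 (ht.nonneg (by omega)) (ht.lt k (by omega)).le
      (ht.le (by omega))
  have hscale : ∀ k, k < N → 0 ≤ localScale σ c t k := fun k hk =>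
    le_trans (integral_nonneg (ht.lt k hk).le fun _ _ => abs_nonneg _)
      (hu.integral_abs_slope_sub_deriv_le hσ hT ht hk)
  have hsplit : caputo α u z = (∑ k ∈ Finset.range n,
      ∫ r in (t k)..(t (k + 1)), rlKernel α (z - r) * deriv u r) +
      ∫ r in (t n)..z, rlKernel α (z - r) * deriv u r := by
    rw [caputo_eq_integral, ← ht.zero, hz, ← Finset.sum_range_succ (fun k =>
      ∫ r in (t k)..(t (k + 1)), rlKernel α (t (n + 1) - r) * deriv u r),
      sum_integral_adjacent_intervals fun k hk => hsub k (by omega)]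
  have hlast : |fastKernel α t w s n n * (u z - u (t n))
      - ∫ r in (t n)..z, rlKernel α (z - r) * deriv u r| ≤
      fastKernel α t w s n n * localScale σ c t n := by
    have hpos := ht.step_pos hn
    have hK : fastKernel α t w s n n = step t (n + 1) ^ (-α) / Real.Gamma (2 - α) :=
      fastKernel_self hα w s hpos
    have hK0 : 0 ≤ fastKernel α t w s n n := by
      rw [hK]
      exact div_nonneg (Real.rpow_nonneg hpos.le _) (Real.Gamma_pos_of_pos (by linarith [hα.2])).le
    -- On the first step the Caputo integral contributes 4 and the difference `u z - u 0`
    -- contributes 1; hence the 5 in `localScale`. Later, the exact L1 weight integrates the slope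
    -- exactly and only `d - deriv u r` remains.
    rcases Nat.eq_zero_or_pos n with rfl | hn0
    · have h1 := hu.abs_integral_caputo_le hα hσ hz0 hzT
      have h2 := mul_le_mul_of_nonneg_left (hu.abs_sub_zero_le hσ.1 hz0.le hzT) hK0
      have e : step t (0 + 1) = z := by rw [step_succ, ht.zero, sub_zero]
      rw [e] at hK
      rw [← hK] at h1
      rw [localScale, if_pos rfl, ht.zero, show step t 1 = z from e]
      refine (abs_sub _ _).trans ?_
      rw [abs_mul, abs_of_nonneg hK0]
      linarith
    · have hba : 0 < z - t n := sub_pos.2 hzn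
      have hri := intervalIntegrable_rlKernel_sub (a := t n) (b := z) hα
      have hKi : fastKernel α t w s n n * (z - t n) = ∫ r in (t n)..z, rlKernel α (z - r) := by
        rw [integral_rlKernel_sub hα, hK, step_succ, ← hz, show 1 - α = -α + 1 by ring,
          Real.rpow_add hba, Real.rpow_one]
        ring
      set d := (u z - u (t n)) / (z - t n) with hd
      have e : fastKernel α t w s n n * (u z - u (t n))
          - ∫ r in (t n)..z, rlKernel α (z - r) * deriv u r =
          ∫ r in (t n)..z, rlKernel α (z - r) * (d - deriv u r) := by
        simp only [mul_sub]
        rw [intervalIntegral.integral_sub (hri.mul_const _) (hsub n le_rfl),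
          intervalIntegral.integral_mul_const, ← hKi, hd]
        field_simp
      rw [e]
      refine (abs_integral_le_of_abs_le
        (g := fun r => rlKernel α (z - r) * (c * t n ^ (σ - 2) * (z - t n))) hzn.le
        (hri.mul_const _) fun r hr => ?_).trans (le_of_eq ?_)
      · have h1 := rlKernel_pos hα (show 0 < z - r by linarith [hr.2])
        rw [abs_mul, abs_of_pos h1]
        exact mul_le_mul_of_nonneg_left
          (hu.abs_slope_sub_deriv_le hσ.2 (ht.pos hn0 hn.le) hzn hzT hr) h1.le
      · rw [intervalIntegral.integral_mul_const, ← hKi, localScale, if_neg hn0.ne', step_succ]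
        ring
  have hhist : ∀ k ∈ Finset.range n, |fastKernel α t w s n k * (u (t (k + 1)) - u (t k))
      - ∫ r in (t k)..(t (k + 1)), rlKernel α (z - r) * deriv u r| ≤
      2 * ((fastKernel α t w s n (k + 1) - fastKernel α t w s n k) * localScale σ c t k)
        + tol * ∫ r in (t k)..(t (k + 1)), |deriv u r| := by
    intro k hk
    have hkn := Finset.mem_range.1 hk
    have hlt := ht.lt k (by omega)
    have hcont : Continuous (fun r => soeSum w s (z - r)) :=
      (continuous_soeSum w s).comp (by fun_prop)
    have hSi : IntervalIntegrable (fun r => soeSum w s (z - r) * deriv u r) volume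
        (t k) (t (k + 1)) := (hdi k hkn.le).continuousOn_mul hcont.continuousOn
    have h1 := abs_average_mul_sub_integral_le
      (soeSum_antitone hs.weight_pos hs.node_pos) (continuous_soeSum w s) (z := z) hlt
      (hdi k hkn.le) (hu.integral_deriv hσ.1 (ht.nonneg (by omega)) hlt.le (ht.le (by omega)))
      (hu.integral_abs_slope_sub_deriv_le hσ hT ht (show k < N by omega))
    -- Increments of the sum of exponentials become kernel increments, the form that the shifted
    -- part of the barrier absorbs.
    have h2 := mul_le_mul_of_nonneg_right
      (soeSum_sub_le_fastKernel_sub hα hδ ht hs hcut htol hn hkn) (hscale k (by omega))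
    have h3 : |∫ r in (t k)..(t (k + 1)), (soeSum w s (z - r) - rlKernel α (z - r)) * deriv u r| ≤
        tol * ∫ r in (t k)..(t (k + 1)), |deriv u r| := by
      rw [← intervalIntegral.integral_const_mul]
      refine abs_integral_le_of_abs_le hlt.le ((hdi k hkn.le).abs.const_mul _) fun r hr => ?_
      rw [abs_mul]
      refine mul_le_mul_of_nonneg_right ?_ (abs_nonneg _)
      have hδz := hcut (n + 1) (by omega) hn
      rw [step_succ, ← hz] at hδz
      have h4 := ht.mono (show k + 1 ≤ n by omega) hn.le
      have h5 := ht.nonneg (show k ≤ N by omega)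
      have h6 : δ ≤ z - r := by linarith [hr.2]
      have h7 : z - r < T := by linarith [hr.1]
      rw [abs_sub_comm]
      exact rlKernel_sub_soeSum_le hδ hs h6 h7.le (h6.trans_lt h7)
    have h4 : ∫ r in (t k)..(t (k + 1)), (soeSum w s (z - r) - rlKernel α (z - r)) * deriv u r =
        (∫ r in (t k)..(t (k + 1)), soeSum w s (z - r) * deriv u r) -
        ∫ r in (t k)..(t (k + 1)), rlKernel α (z - r) * deriv u r := by
      rw [← intervalIntegral.integral_sub hSi (hsub k hkn.le)]
      simp only [sub_mul]
    rw [h4] at h3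
    rw [← step_succ, ← fastKernel_of_lt hkn] at h1
    have h5 := abs_add_le
      (fastKernel α t w s n k * (u (t (k + 1)) - u (t k))
        - ∫ r in (t k)..(t (k + 1)), soeSum w s (z - r) * deriv u r)
      ((∫ r in (t k)..(t (k + 1)), soeSum w s (z - r) * deriv u r) -
        ∫ r in (t k)..(t (k + 1)), rlKernel α (z - r) * deriv u r)
    rw [sub_add_sub_cancel] at h5
    linarith
  have hsum : ∑ k ∈ Finset.range n, ∫ r in (t k)..(t (k + 1)), |deriv u r| ≤ c * (T ^ σ / σ) := by
    rw [sum_integral_adjacent_intervals fun k hk => (hdi k hk.le).abs, ht.zero]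
    refine (hu.integral_abs_deriv_le hσ.1 (ht.nonneg hn.le) (ht.le hn.le)).trans
      (mul_le_mul_of_nonneg_left ?_ hc)
    exact div_le_div_of_nonneg_right
      (Real.rpow_le_rpow (ht.nonneg hn.le) (ht.le hn.le) hσ.1.le) hσ.1.le
  have e : convDiff (fastKernel α t w s n) (fun k => u (t k)) n (u z) - caputo α u z =
      (fastKernel α t w s n n * (u z - u (t n))
        - ∫ r in (t n)..z, rlKernel α (z - r) * deriv u r) +
      ∑ k ∈ Finset.range n, (fastKernel α t w s n k * (u (t (k + 1)) - u (t k))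
        - ∫ r in (t k)..(t (k + 1)), rlKernel α (z - r) * deriv u r) := by
    rw [hsplit, convDiff, Finset.sum_sub_distrib]
    ring
  rw [e]
  refine (abs_add_le _ _).trans ?_
  have h1 := (Finset.abs_sum_le_sum_abs _ _).trans (Finset.sum_le_sum hhist)
  rw [Finset.sum_add_distrib, ← Finset.mul_sum, ← Finset.mul_sum] at h1
  have h2 := mul_le_mul_of_nonneg_left hsum htol0
  linarith

end Truncation

end TFAC

namespace TFAC

open Set

/-! ### The scheme -/

theorem fastL1_apply (α : ℝ) (t : ℕ → ℝ) {m : ℕ} (w s : Fin m → ℝ) {M : ℕ} (Φ : ℕ → Grid M)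
    (n : ℕ) (V : Grid M) (i j : Fin M) :
    fastL1 α t w s Φ n V i j = convDiff (fastKernel α t w s n) (fun k => Φ k i j) n (V i j) := by
  simp [fastL1, convDiff, Finset.sum_apply]

theorem LinearStep.stepOp_eq {α ε L κ : ℝ} {f : ℝ → ℝ} {t : ℕ → ℝ} {m : ℕ} {w s : Fin m → ℝ}
    {M : ℕ} {Φ : ℕ → Grid M} {n : ℕ} {W V : Grid M} (h : LinearStep α ε L κ f t w s Φ n W V)
    (i j : Fin M) :
    stepOp (L / M) ε κ (fastKernel α t w s n) n Φ V i j = -stabilized f κ (W i j) := by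
  have := h i j
  rw [fastL1_apply] at this
  rw [stepOp]
  linarith

/-- The stabilization parameter is nonnegative. -/
theorem stabilization_nonneg {f : ℝ → ℝ} {κ : ℝ} (hf : ContDiff ℝ 1 f) (hl : f (-1) ≤ 0)
    (hr : 0 ≤ f 1) (hκ : ∀ u ∈ Icc (-1 : ℝ) 1, deriv f u ≤ κ) : 0 ≤ κ := by
  obtain ⟨ξ, hξ, h⟩ := exists_deriv_eq_slope f (show (-1 : ℝ) < 1 by norm_num)
    hf.continuous.continuousOn (hf.differentiable one_ne_zero).differentiableOn
  have h1 := hκ ξ (Ioo_subset_Icc_self hξ)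
  rw [h] at h1
  exact le_trans (div_nonneg (by linarith) (by norm_num)) h1

/-- The choice of `κ` makes `f_κ` decreasing on `[-1,1]`, so its values lie between `f 1 - κ ≥ -κ`
and `f (-1) + κ ≤ κ`. -/
theorem abs_stabilized_le {f : ℝ → ℝ} {κ : ℝ} (hf : ContDiff ℝ 1 f) (hl : f (-1) ≤ 0)
    (hr : 0 ≤ f 1) (hκ : ∀ u ∈ Icc (-1 : ℝ) 1, deriv f u ≤ κ) {u : ℝ} (hu : |u| ≤ 1) :
    |stabilized f κ u| ≤ κ := by
  have hd := hf.differentiable one_ne_zero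
  have hd' : ∀ x, HasDerivAt (stabilized f κ) (deriv f x - κ) x := fun x => by
    have h1 := (hd x).hasDerivAt.sub ((hasDerivAt_id x).const_mul κ)
    rw [mul_one] at h1
    exact h1
  have hanti : AntitoneOn (stabilized f κ) (Icc (-1) 1) := by
    refine antitoneOn_of_deriv_nonpos (convex_Icc _ _)
      (fun x _ => (hd' x).continuousAt.continuousWithinAt)
      (fun x _ => (hd' x).differentiableAt.differentiableWithinAt) fun x hx => ?_
    rw [(hd' x).deriv]
    linarith [hκ x (interior_subset hx)]
  have hu' := abs_le.1 hu
  have h1 := hanti ⟨le_rfl, by norm_num⟩ hu' hu'.1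
  have h2 := hanti hu' ⟨by norm_num, le_rfl⟩ hu'.2
  simp only [stabilized] at h1 h2 ⊢
  rw [abs_le]
  constructor <;> linarith

theorem exists_lipschitz_stabilized {f : ℝ → ℝ} (hf : ContDiff ℝ 1 f) (κ R : ℝ) :
    ∃ Λ, 0 ≤ Λ ∧ ∀ u v, |u| ≤ R → |v| ≤ R →
      |stabilized f κ u - stabilized f κ v| ≤ Λ * |u - v| := by
  obtain ⟨A, hA⟩ := (isCompact_Icc (a := -R) (b := R)).exists_bound_of_continuousOn
    (hf.continuous_deriv le_rfl).continuousOn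
  refine ⟨|A| + |κ|, by positivity, fun u v hu hv => ?_⟩
  have h1 := Convex.norm_image_sub_le_of_norm_deriv_le (s := Icc (-R) R) (C := A)
    (fun x _ => hf.differentiable one_ne_zero x) hA (convex_Icc _ _) (abs_le.1 hv) (abs_le.1 hu)
  have h2 : A * |u - v| ≤ |A| * |u - v| :=
    mul_le_mul_of_nonneg_right (le_abs_self A) (abs_nonneg _)
  have h3 : stabilized f κ u - stabilized f κ v = (f u - f v) - κ * (u - v) := by
    simp only [stabilized]; ring
  rw [h3, add_mul, ← abs_mul κ]
  exact (abs_sub _ _).trans (add_le_add (h1.trans h2) le_rfl)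

/-! ### Properties of a run -/

section Run

variable {α ε T L κ ρ : ℝ} {f : ℝ → ℝ} {φ : ℝ → ℝ → ℝ → ℝ} {N : ℕ} {t : ℕ → ℝ} {δ tol : ℝ}
  {m : ℕ} {w s : Fin m → ℝ} {M : ℕ} {Φ Φstar : ℕ → Grid M}

theorem IsRun.kernel_ge (h : IsRun α ε T L κ ρ f φ N t δ tol w s Φ Φstar)
    (hα : α ∈ Ioo (0 : ℝ) 1) {n k : ℕ} (hn : n < N) (hk : k ≤ n) :
    2 / 3 * rlKernel α (t (n + 1) - t k) ≤ fastKernel α t w s n k :=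
  two_thirds_rlKernel_le_fastKernel hα h.cutoff_pos h.mesh h.soe h.cutoff_le
    (h.tol_le.trans (min_le_left _ _)) hn hk

theorem IsRun.kernel_pos (h : IsRun α ε T L κ ρ f φ N t δ tol w s Φ Φstar)
    (hα : α ∈ Ioo (0 : ℝ) 1) {n k : ℕ} (hn : n < N) (hk : k ≤ n) :
    0 < fastKernel α t w s n k := by
  refine lt_of_lt_of_le (mul_pos (by norm_num) (rlKernel_pos hα ?_)) (h.kernel_ge hα hn hk)
  linarith [h.mesh.mono hk hn.le, h.mesh.lt n hn]

theorem IsRun.kernel_mono (h : IsRun α ε T L κ ρ f φ N t δ tol w s Φ Φstar)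
    (hα : α ∈ Ioo (0 : ℝ) 1) {n k : ℕ} (hn : n < N) (hk : k < n) :
    fastKernel α t w s n k ≤ fastKernel α t w s n (k + 1) := by
  have h1 := soeSum_sub_le_fastKernel_sub hα h.cutoff_pos h.mesh h.soe h.cutoff_le
    (h.tol_le.trans (min_le_right _ _)) hn hk
  have h2 := soeSum_antitone h.soe.weight_pos h.soe.node_pos
    (show t (n + 1) - t (k + 1) ≤ t (n + 1) - t k by linarith [h.mesh.lt k (by omega)])
  linarith

/-- One step of the scheme preserves the bound `1`. -/
theorem IsRun.abs_le_one_of_step (h : IsRun α ε T L κ ρ f φ N t δ tol w s Φ Φstar)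
    (hα : α ∈ Ioo (0 : ℝ) 1) (hL : 0 < L) (hκ0 : 0 ≤ κ)
    (hstab : ∀ u, |u| ≤ 1 → |stabilized f κ u| ≤ κ) {n : ℕ} (hn : n < N)
    (hist : ∀ k ≤ n, ∀ i j, |Φ k i j| ≤ 1) {W V : Grid M} (hW : ∀ i j, |W i j| ≤ 1)
    (hV : LinearStep α ε L κ f t w s Φ n W V) (i j : Fin M) : |V i j| ≤ 1 := by
  have hM : (0 : ℝ) < M := by exact_mod_cast h.grid_pos
  -- On the constant `1` the implicit operator equals `κ`, which dominates the stabilized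
  -- nonlinearity.
  refine stepOp_abs_comparison (h := L / M) (ε := ε) (κ := κ) (a := fastKernel α t w s n) (n := n)
    (v := Φ) (z := fun _ _ _ => 1) (V := V) (Z := fun _ _ => 1) (by positivity) hκ0
    (h.kernel_pos hα hn (Nat.zero_le n)).le (fun k hk => h.kernel_mono hα hn hk)
    (h.kernel_pos hα hn le_rfl) hist (fun i j => ?_) i j
  rw [hV.stepOp_eq, abs_neg, stepOp, convDiff_const, discreteLaplacian_const]
  simpa using hstab _ (hW i j)

/-- The discrete maximum principle for the scheme. -/
theorem IsRun.abs_le_one (h : IsRun α ε T L κ ρ f φ N t δ tol w s Φ Φstar)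
    (hα : α ∈ Ioo (0 : ℝ) 1) (hL : 0 < L) (hκ0 : 0 ≤ κ)
    (hstab : ∀ u, |u| ≤ 1 → |stabilized f κ u| ≤ κ) :
    (∀ n ≤ N, ∀ i j, |Φ n i j| ≤ 1) ∧ ∀ n < N, ∀ i j, |Φstar (n + 1) i j| ≤ 1 := by
  have hpred : ∀ n < N, (∀ k ≤ n, ∀ i j, |Φ k i j| ≤ 1) → ∀ i j, |Φstar (n + 1) i j| ≤ 1 :=
    fun n hn hist => h.abs_le_one_of_step hα hL hκ0 hstab hn hist (hist n le_rfl)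
      (h.scheme.predictor n hn)
  have hcorr : ∀ n ≤ N, ∀ i j, |Φ n i j| ≤ 1 := by
    intro n
    induction n using Nat.strong_induction_on with
    | _ n ih =>
    intro hn
    rcases Nat.eq_zero_or_pos n with rfl | h0
    · intro i j
      exact (norm_le_pi_norm (Φ 0 i) j).trans ((norm_le_pi_norm (Φ 0) i).trans h.init_le)
    · obtain ⟨n, rfl⟩ : ∃ k, n = k + 1 := ⟨n - 1, by omega⟩
      have hist : ∀ k ≤ n, ∀ i j, |Φ k i j| ≤ 1 := fun k hk => ih k (by omega) (by omega)
      exact h.abs_le_one_of_step hα hL hκ0 hstab (by omega) hist (hpred n (by omega) hist)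
        (h.scheme.corrector n (by omega))
  exact ⟨hcorr, fun n hn => hpred n hn fun k hk => hcorr k (by omega)⟩

end Run

/-! ### From the scheme to the error bound -/

/-- On `(0,T)` the constant `1` is at most `T^p * r^(-p)`, so the bounded parts of the estimates are
absorbed into the singular ones. -/
theorem TimeRegular.weaklySingular {σ Cφ T L : ℝ} {φ : ℝ → ℝ → ℝ → ℝ}
    (h : TimeRegular σ Cφ T L φ) (hσ : σ ∈ Ioo (0 : ℝ) 1) (hT : 0 < T) {x y : ℝ}
    (hx : x ∈ Ioo 0 L) (hy : y ∈ Ioo 0 L) :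
    WeaklySingular σ (Cφ * (1 + T ^ (1 - σ) + T ^ (2 - σ))) T (fun r => φ r x y) := by
  have hC : 0 ≤ Cφ := by
    have h1 := (abs_nonneg _).trans (h.deriv_bound (T / 2) ⟨by linarith, by linarith⟩ x hx y hy)
    have h2 : 0 < 1 + (T / 2) ^ (σ - 1) := by positivity
    by_contra! hn
    linarith [mul_neg_of_neg_of_pos hn h2]
  have key : ∀ p : ℝ, 0 ≤ p → ∀ r ∈ Ioo 0 T, 1 ≤ T ^ p * r ^ (-p) := by
    intro p hp r hr
    rw [Real.rpow_neg hr.1.le, ← div_eq_mul_inv, one_le_div (Real.rpow_pos_of_pos hr.1 _)]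
    exact Real.rpow_le_rpow hr.1.le hr.2.le hp
  have hp1 : 0 ≤ T ^ (1 - σ) := Real.rpow_nonneg hT.le _
  have hp2 : 0 ≤ T ^ (2 - σ) := Real.rpow_nonneg hT.le _
  refine ⟨h.continuousOn x hx y hy, fun r hr => h.differentiableAt r hr x hx y hy,
    fun r hr => h.differentiableAt_deriv r hr x hx y hy, fun r hr => ?_, fun r hr => ?_⟩
  · refine (h.deriv_bound r hr x hx y hy).trans ?_
    rw [mul_assoc]
    refine mul_le_mul_of_nonneg_left ?_ hC
    have h1 := key (1 - σ) (by linarith [hσ.2]) r hr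
    rw [neg_sub] at h1
    have h2 : 0 ≤ r ^ (σ - 1) := Real.rpow_nonneg hr.1.le _
    have h3 := mul_nonneg hp2 h2
    linarith
  · refine (h.deriv_deriv_bound r hr x hx y hy).trans ?_
    rw [mul_assoc]
    refine mul_le_mul_of_nonneg_left ?_ hC
    have h1 := key (2 - σ) (by linarith [hσ.2]) r hr
    rw [neg_sub] at h1
    have h2 : 0 ≤ r ^ (σ - 2) := Real.rpow_nonneg hr.1.le _
    have h3 := mul_nonneg hp1 h2
    linarith

theorem SpaceRegular.abs_le {K T L : ℝ} {φ : ℝ → ℝ → ℝ → ℝ} (h : SpaceRegular K T L φ) {t x y : ℝ}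
    (ht : t ∈ Ioc 0 T) (hx : x ∈ Icc 0 L) (hy : y ∈ Icc 0 L) : |φ t x y| ≤ K := by
  have := (h t ht).2.1 0 (by norm_num) (x, y) ⟨hx, hy⟩
  rwa [norm_iteratedFDerivWithin_zero] at this

theorem le_rlKernel_mul {α x y z : ℝ} (hα : α ∈ Ioo (0 : ℝ) 1) (hx : 0 < x)
    (h : z * (x ^ α * Real.Gamma (1 - α)) ≤ y) : z ≤ rlKernel α x * y := by
  have hΓ : 0 < Real.Gamma (1 - α) := Real.Gamma_pos_of_pos (by linarith [hα.2])
  have hp : 0 < x ^ α := Real.rpow_pos_of_pos hx _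
  rw [rlKernel, Real.rpow_neg hx.le, ← one_div, div_div, one_div_mul_eq_div,
    le_div_iff₀ (by positivity)]
  exact h

/-- The scale of the variation of the solution over the step from `t n` to `t (n+1)`. -/
noncomputable def localVariation (σ c : ℝ) (t : ℕ → ℝ) (n : ℕ) : ℝ :=
  if n = 0 then c * (step t 1 ^ σ / σ) else c * t n ^ (σ - 1) * step t (n + 1)

set_option maxHeartbeats 1000000 in
/-- The error estimate in terms of a common bound `Q` of the weighted local errors. -/
theorem exists_error_constant {α ε T L κ ρ σ Cφ K : ℝ} {f : ℝ → ℝ} {φ : ℝ → ℝ → ℝ → ℝ}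
    (hα : α ∈ Ioo (0 : ℝ) 1) (hT : 0 < T) (hL : 0 < L) (hσ : σ ∈ Ioo (0 : ℝ) 1)
    (hf : ContDiff ℝ 1 f) (hf_left : f (-1) ≤ 0) (hf_right : 0 ≤ f 1)
    (hκ : ∀ u ∈ Icc (-1 : ℝ) 1, deriv f u ≤ κ) (hφ : IsSolution α ε T L f φ)
    (hφ_time : TimeRegular σ Cφ T L φ) (hφ_space : SpaceRegular K T L φ) :
    ∃ C : ℝ, 0 < C ∧
      ∀ (N : ℕ) (t : ℕ → ℝ) (δ tol : ℝ) (m : ℕ) (w s : Fin m → ℝ) (M : ℕ)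
        (Φ Φstar : ℕ → Grid M), IsRun α ε T L κ ρ f φ N t δ tol w s Φ Φstar →
        ∀ n < N, ∀ Q : ℝ, 0 ≤ Q →
          (∀ k, 1 ≤ k → k ≤ n →
            t (k + 1) ^ α * (step t (k + 1) ^ (2 - α) * t k ^ (σ - 2)) ≤ Q ∧
            t (k + 1) ^ α * (step t (k + 1) ^ (1 + α) * t k ^ (σ - 1)) ≤ Q) →
          ‖Φ (n + 1) - restrict L M (φ (t (n + 1)))‖ ≤
            C * (step t 1 ^ σ + Q + t (n + 1) ^ α * tol + (L / M) ^ 2) := by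
  have hκ0 := stabilization_nonneg hf hf_left hf_right hκ
  have hstab := fun u hu => abs_stabilized_le hf hf_left hf_right hκ (u := u) hu
  -- The numerical values are bounded by 1 and the exact solution by `K` for `t > 0`. At `t = 0` the
  -- space bound is not assumed, and the grid values of the solution are those of the scheme, again
  -- at most 1.
  obtain ⟨Λ, hΛ, hLip⟩ := exists_lipschitz_stabilized hf κ (max 1 K)
  obtain ⟨C, hC, hbound⟩ := exists_stability_constant hα hT hΛ
  set c := Cφ * (1 + T ^ (1 - σ) + T ^ (2 - σ)) with hc_def
  have hmid : L / 2 ∈ Ioo 0 L := ⟨by linarith, by linarith⟩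
  have hc : 0 ≤ c := (hφ_time.weaklySingular hσ hT hmid hmid).const_nonneg hT
  have hK : 0 ≤ K := (abs_nonneg _).trans
    (hφ_space.abs_le ⟨hT, le_rfl⟩ (Ioo_subset_Icc_self hmid) (Ioo_subset_Icc_self hmid))
  set G := Real.Gamma (1 - α) with hG
  set G' := Real.Gamma (2 - α) with hG'
  have hGpos : 0 < G := Real.Gamma_pos_of_pos (by linarith [hα.2])
  have hG'pos : 0 < G' := Real.Gamma_pos_of_pos (by linarith [hα.2])
  have hσ0 := hσ.1
  have hTα : 0 < T ^ α := Real.rpow_pos_of_pos hT _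
  set Ct := c * (T ^ σ / σ) with hCt
  have hCt0 : 0 ≤ Ct := by positivity
  set Cs := ε ^ 2 * (K * (4 + 4 / L)) with hCs
  have hCs0 : 0 ≤ Cs := by positivity
  -- One summand for each bound needed below with `X = A * E`: the corrector `ψ`, the local scales
  -- at the first and later steps, their diagonal-weighted form, the tolerance, the space error, and
  -- the predictor lag at the first and later steps. The final 1 makes `A` positive.
  set A := 2 * K * L + 5 * c / σ + c + c * G / G' + G * Ct + T ^ α * G * Cs +
    Λ * Λ * c / σ * (T ^ α * G' * (T ^ α * G)) + Λ * Λ * c * G' * G + 1 with hA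
  have hp1 : 0 ≤ 2 * K * L := by positivity
  have hp2 : 0 ≤ 5 * c / σ := by positivity
  have hp3 : 0 ≤ c * G / G' := by positivity
  have hp4 : 0 ≤ G * Ct := by positivity
  have hp5 : 0 ≤ T ^ α * G * Cs := by positivity
  have hp6 : 0 ≤ Λ * Λ * c / σ * (T ^ α * G' * (T ^ α * G)) := by positivity
  have hp7 : 0 ≤ Λ * Λ * c * G' * G := by positivity
  have hA0 : 0 < A := by linarith
  refine ⟨C * A, by positivity, ?_⟩
  intro N t δ tol m w s M Φ Φstar h p hp Q hQ hQk
  have hM : (0 : ℝ) < M := by exact_mod_cast h.grid_pos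
  have ht := h.mesh
  have htol := h.tol_pos
  obtain ⟨hΦ1, hΦs1⟩ := h.abs_le_one hα hL hκ0 hstab
  have hN : 0 < N := by omega
  have hτ1 : 0 < step t 1 := ht.step_pos hN
  have hτσ : 0 ≤ step t 1 ^ σ := Real.rpow_nonneg hτ1.le _
  have hH : 0 < t (p + 1) ^ α := Real.rpow_pos_of_pos (ht.pos (by omega) hp) _
  have hHtol : 0 ≤ t (p + 1) ^ α * tol := by positivity
  have hh2 : 0 ≤ (L / M) ^ 2 := sq_nonneg _
  set E := step t 1 ^ σ + Q + t (p + 1) ^ α * tol + (L / M) ^ 2 with hE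
  have hE0 : 0 ≤ E := by positivity
  set a := fastKernel α t w s with ha
  set P : ℕ → Grid M := fun k => restrict L M (φ (t k)) with hP
  set ψ : Grid M := fun i j => K * (cornerProfile L M i + cornerProfile L M j) with hψ
  have hann : ∀ n < N, a n n = step t (n + 1) ^ (-α) / G' := fun n hn =>
    fastKernel_self hα w s (ht.step_pos hn)
  have hannle : ∀ n < N, ∀ y z : ℝ, z * (step t (n + 1) ^ α * G') ≤ y → z ≤ a n n * y := by
    intro n hn y z hyz
    have h1 := ht.step_pos hn
    have h2 : 0 < step t (n + 1) ^ α := Real.rpow_pos_of_pos h1 _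
    rw [hann n hn, Real.rpow_neg h1.le, ← one_div, div_div, one_div_mul_eq_div,
      le_div_iff₀ (by positivity)]
    exact hyz
  have hPle : ∀ n ≤ N, ∀ i j, |P n i j| ≤ max 1 K := by
    intro n hn i j
    rcases Nat.eq_zero_or_pos n with rfl | hn0
    · have h1 := hΦ1 0 hn i j
      rw [h.scheme.init] at h1
      simp only [hP, ht.zero]
      exact h1.trans (le_max_left _ _)
    · exact (hφ_space.abs_le ⟨ht.pos hn0 hn, ht.le hn⟩
        (Ioo_subset_Icc_self (cellCentre_mem hL i))
        (Ioo_subset_Icc_self (cellCentre_mem hL j))).trans (le_max_right _ _)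
  have hws : ∀ i j : Fin M, WeaklySingular σ c T (fun r => restrict L M (φ r) i j) := fun i j =>
    hφ_time.weaklySingular hσ hT (cellCentre_mem hL i) (cellCentre_mem hL j)
  -- The exact solution satisfies the scheme up to the time and space truncation errors, since the
  -- equation holds at every cell centre.
  have hexact : ∀ n < N, ∀ i j, |stepOp (L / M) ε κ (a n) n P (P (n + 1)) i j
      + stabilized f κ (P (n + 1) i j)| ≤ a n n * localScale σ c t n
        + 2 * ∑ k ∈ Finset.range n, (a n (k + 1) - a n k) * localScale σ c t k
        + (Ct * tol + Cs * (L / M) ^ 2) - ε ^ 2 * discreteLaplacian (L / M) ψ i j := by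
    intro n hn i j
    have htn : t (n + 1) ∈ Ioc 0 T := ⟨ht.pos (by omega) hn, ht.le hn⟩
    have h1 := (hws i j).fastL1_consistency hα hσ hT ht h.cutoff_pos h.soe h.cutoff_le htol.le
      (h.tol_le.trans (min_le_right _ _)) hn
    have h2 := mul_le_mul_of_nonneg_left
      (discreteLaplacian_consistency hL hφ hφ_space htn i j) (sq_nonneg ε)
    have h3 := hφ.equation (t (n + 1)) htn _ (cellCentre_mem hL i) _ (cellCentre_mem hL j)
    have e : stepOp (L / M) ε κ (a n) n P (P (n + 1)) i j + stabilized f κ (P (n + 1) i j) =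
        (convDiff (a n) (fun k => restrict L M (φ (t k)) i j) n
          (restrict L M (φ (t (n + 1))) i j) -
          caputo α (fun r => restrict L M (φ r) i j) (t (n + 1)))
        - ε ^ 2 * (discreteLaplacian (L / M) (restrict L M (φ (t (n + 1)))) i j
          - laplacian (φ (t (n + 1))) (((i : ℝ) + 1 / 2) * (L / M))
            (((j : ℝ) + 1 / 2) * (L / M))) := by
      have h4 : f (P (n + 1) i j) = f (φ (t (n + 1)) (((i : ℝ) + 1 / 2) * (L / M))
          (((j : ℝ) + 1 / 2) * (L / M))) := rfl
      have h5 : caputo α (fun r => restrict L M (φ r) i j) (t (n + 1)) =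
          caputo α (fun r => φ r (((i : ℝ) + 1 / 2) * (L / M)) (((j : ℝ) + 1 / 2) * (L / M)))
            (t (n + 1)) := rfl
      rw [stepOp, stabilized, h4, h5]
      simp only [hP]
      linear_combination h3
    rw [e]
    refine (abs_sub _ _).trans ?_
    rw [abs_mul (ε ^ 2), abs_of_nonneg (sq_nonneg ε)]
    have h6 : ε ^ 2 * (K * (4 + 4 / L) * (L / M) ^ 2 - discreteLaplacian (L / M) ψ i j) =
        Cs * (L / M) ^ 2 - ε ^ 2 * discreteLaplacian (L / M) ψ i j := by rw [hCs]; ring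
    rw [h6] at h2
    linarith
  have hvar : ∀ n < N, ∀ i j, |P (n + 1) i j - P n i j| ≤ localVariation σ c t n := by
    intro n hn i j
    rcases Nat.eq_zero_or_pos n with rfl | hn0
    · have h1 := (hws i j).abs_sub_zero_le hσ.1 (ht.nonneg (show 1 ≤ N by omega)) (ht.le hN)
      rw [localVariation, if_pos rfl, step_succ, ht.zero, sub_zero]
      simp only [hP, ht.zero, zero_add]
      exact h1
    · rw [localVariation, if_neg hn0.ne']
      exact (hws i j).abs_sub_le hσ.2 (ht.pos hn0 hn.le) (ht.lt n hn) (ht.le hn)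
  have herr : ∀ n < N, ∀ V W : Grid M, LinearStep α ε L κ f t w s Φ n W V → (∀ i j, |W i j| ≤ 1) →
      ∀ i j, |stepOp (L / M) ε κ (a n) n (fun k => Φ k - P k) (V - P (n + 1)) i j| ≤
        Λ * |W i j - P (n + 1) i j| + (a n n * localScale σ c t n
        + 2 * ∑ k ∈ Finset.range n, (a n (k + 1) - a n k) * localScale σ c t k
        + (Ct * tol + Cs * (L / M) ^ 2) - ε ^ 2 * discreteLaplacian (L / M) ψ i j) := by
    intro n hn V W hV hW i j
    rw [stepOp_sub, hV.stepOp_eq]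
    have h1 := hexact n hn i j
    have h2 := hLip (W i j) (P (n + 1) i j) ((hW i j).trans (le_max_left _ _))
      (hPle (n + 1) hn i j)
    have h3 : -stabilized f κ (W i j) - stepOp (L / M) ε κ (a n) n P (P (n + 1)) i j =
        -(stabilized f κ (W i j) - stabilized f κ (P (n + 1) i j)) -
        (stepOp (L / M) ε κ (a n) n P (P (n + 1)) i j + stabilized f κ (P (n + 1) i j)) := by ring
    rw [h3]
    refine (abs_sub _ _).trans ?_
    rw [abs_neg]
    exact add_le_add h2 h1
  have hstepα : ∀ n < N, step t (n + 1) ^ α ≤ t (n + 1) ^ α := fun n hn =>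
    Real.rpow_le_rpow (ht.step_pos hn).le (by rw [step_succ]; linarith [ht.nonneg hn.le]) hα.1.le
  have htα : ∀ n < N, t (n + 1) ^ α ≤ T ^ α := fun n hn =>
    Real.rpow_le_rpow (ht.nonneg hn) (ht.le hn) hα.1.le
  have hAE : ∀ B : ℝ, 0 ≤ B → B ≤ A → ∀ y, 0 ≤ y → y ≤ E → B * y ≤ A * E := fun B hB hBA y hy hyE =>
    mul_le_mul hBA hyE hy hA0.le
  have hτE : step t 1 ^ σ ≤ E := by linarith
  have hQE : Q ≤ E := by linarith
  have hscale : ∀ n, 1 ≤ n → n ≤ p → 0 ≤ step t (n + 1) ^ (2 - α) * t n ^ (σ - 2) ∧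
      localScale σ c t n =
        step t (n + 1) ^ α * (c * (step t (n + 1) ^ (2 - α) * t n ^ (σ - 2))) := by
    intro n hn0 hn
    have h1 := ht.step_pos (show n < N by omega)
    have h2 := ht.pos hn0 (show n ≤ N by omega)
    refine ⟨by positivity, ?_⟩
    have h3 : step t (n + 1) ^ 2 = step t (n + 1) ^ α * step t (n + 1) ^ (2 - α) := by
      rw [← Real.rpow_add h1, add_sub_cancel, Real.rpow_two]
    rw [localScale, if_neg (by omega), h3]
    ring
  have key := hbound N t M (L / M) ε κ a (fun k => Φ k - P k) (fun k => Φstar k - P k) ψ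
    (localScale σ c t) (fun _ => Ct * tol + Cs * (L / M) ^ 2) (localVariation σ c t)
    (fun n i j => a n n * localScale σ c t n
        + 2 * ∑ k ∈ Finset.range n, (a n (k + 1) - a n k) * localScale σ c t k
        + (Ct * tol + Cs * (L / M) ^ 2) - ε ^ 2 * discreteLaplacian (L / M) ψ i j) (A * E) p
    ht (by positivity) hκ0 hp (fun n hn k hk => h.kernel_ge hα hn hk)
    (fun n hn k hk => h.kernel_mono hα hn hk) ?_ (by positivity) ?_ ?_ ?_ ?_ ?_
    (fun n hn i j => le_rfl) ?_ ?_
  · have hnn : 0 ≤ C * A * E := by positivity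
    rw [pi_norm_le_iff_of_nonneg hnn]
    intro i
    rw [pi_norm_le_iff_of_nonneg hnn]
    intro j
    rw [mul_assoc]
    exact key i j
  · simp only [hP, ht.zero, h.scheme.init, sub_self]
  · intro i j
    have h1 := cornerProfile_bounds hL i
    have h2 := cornerProfile_bounds hL j
    simp only [hψ]
    refine ⟨mul_nonneg hK (by linarith), ?_⟩
    calc K * (cornerProfile L M i + cornerProfile L M j)
        ≤ K * (L * (L / M) ^ 2 + L * (L / M) ^ 2) :=
          mul_le_mul_of_nonneg_left (add_le_add h1.2 h2.2) hK
      _ = 2 * K * L * (L / M) ^ 2 := by ring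
      _ ≤ A * E := hAE _ hp1 (by linarith) _ hh2 (by linarith)
  · intro n hn
    rcases Nat.eq_zero_or_pos n with rfl | hn0
    · rw [localScale, if_pos rfl]
      refine ⟨by positivity, ?_⟩
      calc 5 * c * (step t 1 ^ σ / σ) = 5 * c / σ * step t 1 ^ σ := by ring
        _ ≤ A * E := hAE _ hp2 (by linarith) _ hτσ hτE
    · obtain ⟨h1, h2⟩ := hscale n hn0 hn
      have h3 := ht.step_pos (show n < N by omega)
      rw [h2]
      refine ⟨by positivity, ?_⟩
      calc step t (n + 1) ^ α * (c * (step t (n + 1) ^ (2 - α) * t n ^ (σ - 2)))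
          = c * (step t (n + 1) ^ α * (step t (n + 1) ^ (2 - α) * t n ^ (σ - 2))) := by ring
        _ ≤ c * (t (n + 1) ^ α * (step t (n + 1) ^ (2 - α) * t n ^ (σ - 2))) :=
          mul_le_mul_of_nonneg_left (mul_le_mul_of_nonneg_right (hstepα n (by omega)) h1) hc
        _ ≤ c * Q := mul_le_mul_of_nonneg_left (hQk n hn0 hn).1 hc
        _ ≤ A * E := hAE _ hc (by linarith) _ hQ hQE
  · intro n hn hn0
    have hnN : n < N := by omega
    obtain ⟨h1, h2⟩ := hscale n hn0 hn
    have h3 := ht.step_pos hnN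
    have h4 : 0 < step t (n + 1) ^ α := Real.rpow_pos_of_pos h3 _
    refine le_rlKernel_mul hα (ht.pos (by omega) hnN) ?_
    calc a n n * localScale σ c t n * (t (n + 1) ^ α * G)
        = c * G / G' * (t (n + 1) ^ α * (step t (n + 1) ^ (2 - α) * t n ^ (σ - 2))) := by
          rw [h2, hann n hnN, Real.rpow_neg h3.le]
          field_simp
      _ ≤ c * G / G' * Q := mul_le_mul_of_nonneg_left (hQk n hn0 hn).1 hp3
      _ ≤ A * E := hAE _ hp3 (by linarith) _ hQ hQE
  · intro n hn
    have hnN : n < N := by omega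
    refine le_rlKernel_mul hα (ht.pos (by omega) hnN) ?_
    have h1 : t (n + 1) ^ α ≤ t (p + 1) ^ α :=
      Real.rpow_le_rpow (ht.nonneg hnN) (ht.mono (by omega) hp) hα.1.le
    have h2 : G * Ct * (t (n + 1) ^ α * tol) ≤ G * Ct * (t (p + 1) ^ α * tol) :=
      mul_le_mul_of_nonneg_left (mul_le_mul_of_nonneg_right h1 htol.le) hp4
    have h3 : t (n + 1) ^ α * (G * Cs * (L / M) ^ 2) ≤ T ^ α * (G * Cs * (L / M) ^ 2) :=
      mul_le_mul_of_nonneg_right (htα n hnN) (by positivity)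
    have h4 : G * Ct * (t (p + 1) ^ α * tol) ≤ G * Ct * E :=
      mul_le_mul_of_nonneg_left (by linarith) hp4
    have h5 : T ^ α * G * Cs * (L / M) ^ 2 ≤ T ^ α * G * Cs * E :=
      mul_le_mul_of_nonneg_left (by linarith) hp5
    have h6 : (G * Ct + T ^ α * G * Cs) * E ≤ A * E :=
      mul_le_mul_of_nonneg_right (by linarith) hE0
    linarith
  · intro n hn
    have hnN : n < N := by omega
    refine hannle n hnN _ _ (le_rlKernel_mul hα (ht.pos (by omega) hnN) ?_)
    have h0 := ht.step_pos hnN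
    have hs0 : 0 ≤ step t (n + 1) ^ α := Real.rpow_nonneg h0.le _
    have ht0 : 0 ≤ t (n + 1) ^ α := Real.rpow_nonneg (ht.nonneg hnN) _
    rcases Nat.eq_zero_or_pos n with rfl | hn0
    · rw [localVariation, if_pos rfl]
      have h1 : step t (0 + 1) ^ α * G' * (t (0 + 1) ^ α * G) ≤ T ^ α * G' * (T ^ α * G) :=
        mul_le_mul (mul_le_mul_of_nonneg_right ((hstepα 0 hnN).trans (htα 0 hnN)) hG'pos.le)
          (mul_le_mul_of_nonneg_right (htα 0 hnN) hGpos.le) (by positivity) (by positivity)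
      calc Λ * (Λ * (c * (step t 1 ^ σ / σ))) * (step t (0 + 1) ^ α * G') * (t (0 + 1) ^ α * G)
          = Λ * Λ * c / σ * (step t (0 + 1) ^ α * G' * (t (0 + 1) ^ α * G)) * step t 1 ^ σ := by
            ring
        _ ≤ Λ * Λ * c / σ * (T ^ α * G' * (T ^ α * G)) * step t 1 ^ σ :=
            mul_le_mul_of_nonneg_right (mul_le_mul_of_nonneg_left h1 (by positivity)) hτσ
        _ ≤ A * E := hAE _ hp6 (by linarith) _ hτσ hτE
    · rw [localVariation, if_neg hn0.ne']
      have h1 : step t (n + 1) ^ (1 + α) = step t (n + 1) * step t (n + 1) ^ α := by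
        rw [Real.rpow_add h0, Real.rpow_one]
      have h2 := (hQk n hn0 hn).2
      rw [h1] at h2
      calc Λ * (Λ * (c * t n ^ (σ - 1) * step t (n + 1))) * (step t (n + 1) ^ α * G')
            * (t (n + 1) ^ α * G)
          = Λ * Λ * c * G' * G * (t (n + 1) ^ α *
            (step t (n + 1) * step t (n + 1) ^ α * t n ^ (σ - 1))) := by ring
        _ ≤ Λ * Λ * c * G' * G * Q := mul_le_mul_of_nonneg_left h2 hp7
        _ ≤ A * E := hAE _ hp7 (by linarith) _ hQ hQE
  · intro n hn i j
    have hnN : n < N := by omega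
    refine (herr n hnN (Φstar (n + 1)) (Φ n) (h.scheme.predictor n hnN) (hΦ1 n hnN.le) i j).trans
      (add_le_add (mul_le_mul_of_nonneg_left ?_ hΛ) le_rfl)
    have h1 := hvar n hnN i j
    rw [abs_sub_comm] at h1
    have h2 := abs_add_le (Φ n i j - P n i j) (P n i j - P (n + 1) i j)
    rw [sub_add_sub_cancel] at h2
    simp only [Pi.sub_apply]
    linarith
  · intro n hn i j
    have hnN : n < N := by omega
    exact herr n hnN (Φ (n + 1)) (Φstar (n + 1)) (h.scheme.corrector n hnN) (hΦs1 n hnN) i j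

end TFAC

/-! ### Maxima over the mesh and graded meshes -/

namespace TFAC

open Set

theorem le_maxOver {n : ℕ} (g : ℕ → ℝ) {k : ℕ} (h1 : 1 ≤ k) (hk : k ≤ n) : g k ≤ maxOver n g :=
  le_ciSup (f := fun k : Icc 1 n => g k) (finite_range _).bddAbove ⟨k, h1, hk⟩

theorem maxOver_nonneg {n : ℕ} {g : ℕ → ℝ} (hg : ∀ k, 1 ≤ k → k ≤ n → 0 ≤ g k) :
    0 ≤ maxOver n g :=
  Real.iSup_nonneg fun k => hg k k.2.1 k.2.2

/-- The weighted local errors on a graded mesh. -/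
theorem graded_weight_le {α p q β γ C T τ x y z : ℝ} (hC : 0 < C) (hτ : 0 ≤ τ)
    (hβ : 0 ≤ β) (hβp : β ≤ p) (hq : q ≤ 0) (hexp : 0 ≤ α + q + p - β / γ) (hx : 0 < x)
    (hxT : x ≤ T) (hy : 0 ≤ y) (hyx : y ≤ x) (hyτ : y ≤ C * τ * x ^ (1 - 1 / γ)) (hxz : x ≤ C * z) :
    x ^ α * (y ^ p * z ^ q) ≤ C ^ β * C ^ (-q) * T ^ (α + q + p - β / γ) * τ ^ β := by
  have h1 : z ^ q ≤ x ^ q * C ^ (-q) := by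
    have h2 := Real.rpow_le_rpow_of_nonpos (div_pos hx hC) ((div_le_iff₀' hC).2 hxz) hq
    rwa [Real.div_rpow hx.le hC.le, div_eq_mul_inv, ← Real.rpow_neg hC.le] at h2
  have h2 : y ^ p ≤ C ^ β * τ ^ β * x ^ ((1 - 1 / γ) * β) * x ^ (p - β) := by
    rcases hy.eq_or_lt with rfl | hy0
    · rcases (hβ.trans hβp).eq_or_lt with hp | hp
      · have hβ0 : β = 0 := by linarith
        simp [← hp, hβ0]
      · rw [Real.zero_rpow hp.ne']
        have : 0 ≤ τ ^ β := Real.rpow_nonneg hτ _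
        positivity
    -- Only `β` powers of the step are exchanged for `τ` by the grading condition; the others are
    -- bounded by powers of `x`. The powers of `x` then add up to `α + q + p - β / γ`, nonnegative
    -- by `hexp`.
    · calc y ^ p = y ^ β * y ^ (p - β) := by rw [← Real.rpow_add hy0, add_sub_cancel]
        _ ≤ (C * τ * x ^ (1 - 1 / γ)) ^ β * x ^ (p - β) :=
          mul_le_mul (Real.rpow_le_rpow hy hyτ hβ) (Real.rpow_le_rpow hy hyx (by linarith))
            (Real.rpow_nonneg hy _) (Real.rpow_nonneg (hy.trans hyτ) _)
        _ = _ := by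
          rw [Real.mul_rpow (mul_nonneg hC.le hτ) (Real.rpow_nonneg hx.le _),
            Real.mul_rpow hC.le hτ, ← Real.rpow_mul hx.le]
  have hτβ : 0 ≤ τ ^ β := Real.rpow_nonneg hτ _
  have hz : 0 ≤ z ^ q := by
    have : 0 < z := by
      by_contra! hz
      linarith [mul_nonpos_of_nonneg_of_nonpos hC.le hz]
    positivity
  calc x ^ α * (y ^ p * z ^ q)
      ≤ x ^ α * ((C ^ β * τ ^ β * x ^ ((1 - 1 / γ) * β) * x ^ (p - β)) * (x ^ q * C ^ (-q))) :=
        mul_le_mul_of_nonneg_left (mul_le_mul h2 h1 hz (by positivity)) (by positivity)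
    _ = C ^ β * C ^ (-q) * (x ^ α * x ^ ((1 - 1 / γ) * β) * x ^ (p - β) * x ^ q) * τ ^ β := by ring
    _ = C ^ β * C ^ (-q) * x ^ (α + q + p - β / γ) * τ ^ β := by
        rw [← Real.rpow_add hx, ← Real.rpow_add hx, ← Real.rpow_add hx]
        congr 3
        ring
    _ ≤ _ := by
        have := Real.rpow_le_rpow hx.le hxT hexp
        exact mul_le_mul_of_nonneg_right (mul_le_mul_of_nonneg_left this (by positivity)) hτβ

/-- The first step of a graded mesh. -/
theorem graded_first_step_le {σ β γ C T τ x : ℝ} (hC : 0 < C) (hτ : 0 ≤ τ)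
    (hβ : 0 ≤ β) (hexp : 0 ≤ σ - β / γ) (hx : 0 < x) (hxT : x ≤ T)
    (hxτ : x ≤ C * τ * x ^ (1 - 1 / γ)) :
    x ^ σ ≤ C ^ β * T ^ (σ - β / γ) * τ ^ β := by
  -- Here `x` is both the step and the time, so the grading condition can be divided by `x^(1 -
  -- 1/γ)`.
  have h1 : x ^ (1 / γ) ≤ C * τ := by
    have h2 : 0 < x ^ (1 - 1 / γ) := Real.rpow_pos_of_pos hx _
    refine le_of_mul_le_mul_right ?_ h2
    rwa [← Real.rpow_add hx, add_sub_cancel, Real.rpow_one]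
  calc x ^ σ = (x ^ (1 / γ)) ^ β * x ^ (σ - β / γ) := by
        rw [← Real.rpow_mul hx.le, ← Real.rpow_add hx]
        congr 1
        ring
    _ ≤ (C * τ) ^ β * T ^ (σ - β / γ) :=
        mul_le_mul (Real.rpow_le_rpow (Real.rpow_nonneg hx.le _) h1 hβ)
          (Real.rpow_le_rpow hx.le hxT hexp) (Real.rpow_nonneg hx.le _)
          (Real.rpow_nonneg (mul_nonneg hC.le hτ) _)
    _ = _ := by rw [Real.mul_rpow hC.le hτ]; ring

end TFAC

/-- Both estimates follow from `exists_error_constant` by the choice of `Q`: the time-weighted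
maxima for a general mesh, a multiple of `τ^β` for a graded one. -/
theorem mainTheorem5 (α ε T L κ ρ σ Cφ K : ℝ) (f : ℝ → ℝ) (φ : ℝ → ℝ → ℝ → ℝ)
    (hα : α ∈ Set.Ioo (0 : ℝ) 1) (hε : 0 < ε) (hT : 0 < T) (hL : 0 < L)
    (hσ : σ ∈ Set.Ioo (0 : ℝ) 1)
    (hf : ContDiff ℝ 1 f) (hf_left : f (-1) ≤ 0) (hf_right : 0 ≤ f 1)
    (hκ : ∀ u ∈ Set.Icc (-1 : ℝ) 1, deriv f u ≤ κ)
    (hφ : TFAC.IsSolution α ε T L f φ)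
    (hφ_time : TFAC.TimeRegular σ Cφ T L φ)
    (hφ_space : TFAC.SpaceRegular K T L φ) :
    (∃ C : ℝ, 0 < C ∧
      ∀ (N : ℕ) (t : ℕ → ℝ) (δ tol : ℝ) (m : ℕ) (w s : Fin m → ℝ) (M : ℕ)
        (Φ Φstar : ℕ → TFAC.Grid M),
        TFAC.IsRun α ε T L κ ρ f φ N t δ tol w s Φ Φstar →
        ∀ n < N,
          ‖Φ (n + 1) - TFAC.restrict L M (φ (t (n + 1)))‖ ≤
            C * (TFAC.step t 1 ^ (1 + 2 * α) + TFAC.step t 1 ^ σ / σ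
              + t (n + 1) ^ α *
                (TFAC.maxOver n (fun k =>
                    TFAC.step t (k + 1) ^ (1 + α) + t k ^ (σ - 1) * TFAC.step t (k + 1) ^ (1 + α))
                  + TFAC.maxOver n (fun k => t k ^ (σ - 2) * TFAC.step t (k + 1) ^ (2 - α)))
              + tol / σ * t (n + 1) ^ α * max 1 (t (n + 1)) ^ 2
              + (L / M) ^ 2)) ∧
    (∀ γ Cγ : ℝ, 1 ≤ γ → 0 < Cγ →
      ∃ C : ℝ, 0 < C ∧
        ∀ (N : ℕ) (t : ℕ → ℝ) (δ tol : ℝ) (m : ℕ) (w s : Fin m → ℝ) (M : ℕ)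
          (Φ Φstar : ℕ → TFAC.Grid M),
          TFAC.IsRun α ε T L κ ρ f φ N t δ tol w s Φ Φstar →
          TFAC.AssG γ Cγ N t →
          ∀ n < N,
            ‖Φ (n + 1) - TFAC.restrict L M (φ (t (n + 1)))‖ ≤
              C * (TFAC.maxStep t N ^ min (min (1 + α) (2 - α)) (γ * σ) + tol + (L / M) ^ 2)) := by
  obtain ⟨C, hC, hmain⟩ := TFAC.exists_error_constant (ρ := ρ) hα hT hL hσ hf hf_left hf_right hκ
    hφ hφ_time hφ_space
  have hσ0 := hσ.1
  refine ⟨⟨C, hC, fun N t δ tol m w s M Φ Φstar h n hn => ?_⟩, fun γ Cγ hγ hCγ => ?_⟩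
  · have ht := h.mesh
    have htol := h.tol_pos
    have htn : 0 ≤ t (n + 1) ^ α := Real.rpow_nonneg (ht.nonneg hn) _
    set g1 : ℕ → ℝ := fun k => TFAC.step t (k + 1) ^ (1 + α)
      + t k ^ (σ - 1) * TFAC.step t (k + 1) ^ (1 + α) with hg1
    set g2 : ℕ → ℝ := fun k => t k ^ (σ - 2) * TFAC.step t (k + 1) ^ (2 - α) with hg2
    have hs0 : ∀ k, k ≤ n → ∀ r : ℝ, 0 ≤ TFAC.step t (k + 1) ^ r := fun k hk r =>
      Real.rpow_nonneg (ht.step_pos (by omega)).le _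
    have ht0 : ∀ k, k ≤ n → ∀ r : ℝ, 0 ≤ t k ^ r := fun k hk r =>
      Real.rpow_nonneg (ht.nonneg (by omega)) _
    have hm1 : 0 ≤ TFAC.maxOver n g1 := TFAC.maxOver_nonneg fun k _ hk =>
      add_nonneg (hs0 k hk _) (mul_nonneg (ht0 k hk _) (hs0 k hk _))
    have hm2 : 0 ≤ TFAC.maxOver n g2 := TFAC.maxOver_nonneg fun k _ hk =>
      mul_nonneg (ht0 k hk _) (hs0 k hk _)
    refine (hmain N t δ tol m w s M Φ Φstar h n hn
      (t (n + 1) ^ α * (TFAC.maxOver n g1 + TFAC.maxOver n g2))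
      (mul_nonneg htn (add_nonneg hm1 hm2)) fun k hk1 hk => ?_).trans
      (mul_le_mul_of_nonneg_left ?_ hC.le)
    · have htk : t (k + 1) ^ α ≤ t (n + 1) ^ α :=
        Real.rpow_le_rpow (ht.nonneg (by omega)) (ht.mono (by omega) hn) hα.1.le
      have h1 := TFAC.le_maxOver g1 hk1 hk
      have h2 := TFAC.le_maxOver g2 hk1 hk
      have h3 := hs0 k hk (1 + α)
      simp only [hg1] at h1
      simp only [hg2] at h2
      refine ⟨mul_le_mul htk ?_ (mul_nonneg (hs0 k hk _) (ht0 k hk _)) htn,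
        mul_le_mul htk ?_ (mul_nonneg (hs0 k hk _) (ht0 k hk _)) htn⟩
      · rw [mul_comm]
        linarith
      · rw [mul_comm]
        linarith
    -- Division by `σ < 1`, the factor `max 1 (t (n + 1)) ^ 2` and the term of order `1 + 2 * α`
    -- only enlarge the right-hand side.
    · have h1 : TFAC.step t 1 ^ σ ≤ TFAC.step t 1 ^ σ / σ :=
        le_div_self (hs0 0 (Nat.zero_le n) σ) hσ.1 hσ.2.le
      have h2 := hs0 0 (Nat.zero_le n) (1 + 2 * α)
      have h3 : t (n + 1) ^ α * tol ≤ tol / σ * t (n + 1) ^ α * max 1 (t (n + 1)) ^ 2 := by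
        have h4 : tol ≤ tol / σ := le_div_self htol.le hσ.1 hσ.2.le
        have h5 : (1 : ℝ) ≤ max 1 (t (n + 1)) ^ 2 := one_le_pow₀ (le_max_left _ _)
        calc t (n + 1) ^ α * tol = tol * t (n + 1) ^ α := mul_comm _ _
          _ ≤ tol / σ * t (n + 1) ^ α := mul_le_mul_of_nonneg_right h4 htn
          _ ≤ _ := le_mul_of_one_le_right (by positivity) h5
      linarith
  · set β := min (min (1 + α) (2 - α)) (γ * σ) with hβ
    have hγ0 : 0 < γ := by linarith
    have hβ1 : β ≤ 1 + α := (min_le_left _ _).trans (min_le_left _ _)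
    have hβ2 : β ≤ 2 - α := (min_le_left _ _).trans (min_le_right _ _)
    have hβ3 : β ≤ γ * σ := min_le_right _ _
    have hβ0 : 0 ≤ β := le_min (le_min (by linarith [hα.1]) (by linarith [hα.2])) (by positivity)
    -- The three weights carry the powers `σ - β/γ`, `σ - β/γ` and `2α + σ - β/γ` of time; this
    -- inequality, due to `β ≤ γσ`, makes them bounded on `[0,T]`.
    have hβγ : 0 ≤ σ - β / γ := by
      rw [sub_nonneg, div_le_iff₀' hγ0]
      exact hβ3
    set D1 := Cγ ^ β * Cγ ^ (-(σ - 2)) * T ^ (α + (σ - 2) + (2 - α) - β / γ) with hD1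
    set D2 := Cγ ^ β * Cγ ^ (-(σ - 1)) * T ^ (α + (σ - 1) + (1 + α) - β / γ) with hD2
    set D0 := Cγ ^ β * T ^ (σ - β / γ) with hD0
    have hD1p : 0 < D1 := by positivity
    have hD2p : 0 < D2 := by positivity
    have hD0p : 0 < D0 := by positivity
    have hTα : 0 < T ^ α := Real.rpow_pos_of_pos hT _
    refine ⟨C * (D0 + D1 + D2 + T ^ α + 1), by positivity,
      fun N t δ tol m w s M Φ Φstar h hG n hn => ?_⟩
    have ht := h.mesh
    have htol := h.tol_pos
    have hτ1 := (ht.step_pos (show 0 < N by omega)).le.trans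
      (TFAC.step_le_maxStep t le_rfl (show 1 ≤ N by omega))
    set τ := TFAC.maxStep t N with hτ
    have hτβ : 0 ≤ τ ^ β := Real.rpow_nonneg hτ1 _
    have hgrade : ∀ k, 1 ≤ k → k ≤ N → TFAC.step t k ≤ Cγ * τ * t k ^ (1 - 1 / γ) :=
      fun k hk1 hk => (hG.1 k hk1 hk).trans
        (mul_le_mul_of_nonneg_left (min_le_right _ _) (by positivity))
    have key := hmain N t δ tol m w s M Φ Φstar h n hn ((D1 + D2) * τ ^ β) (by positivity)
      fun k hk1 hk => by
        have hx := ht.pos (show 1 ≤ k + 1 by omega) (show k + 1 ≤ N by omega)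
        have hxT := ht.le (show k + 1 ≤ N by omega)
        have hy := (ht.step_pos (show k < N by omega)).le
        have hyx : TFAC.step t (k + 1) ≤ t (k + 1) := by
          rw [TFAC.step_succ]
          linarith [ht.nonneg (show k ≤ N by omega)]
        have hyτ := hgrade (k + 1) (by omega) (by omega)
        have hxz := hG.2 (k + 1) (by omega) (by omega)
        rw [Nat.add_sub_cancel] at hxz
        have h1 := TFAC.graded_weight_le (α := α) (p := 2 - α) (q := σ - 2) hCγ hτ1 hβ0 hβ2
          (by linarith [hσ.2]) (by linarith) hx hxT hy hyx hyτ hxz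
        have h2 := TFAC.graded_weight_le (α := α) (p := 1 + α) (q := σ - 1) hCγ hτ1 hβ0 hβ1
          (by linarith [hσ.2]) (by linarith [hα.1]) hx hxT hy hyx hyτ hxz
        have h3 : 0 ≤ D1 * τ ^ β := by positivity
        have h4 : 0 ≤ D2 * τ ^ β := by positivity
        rw [add_mul]
        exact ⟨h1.trans (by linarith), h2.trans (by linarith)⟩
    refine key.trans ?_
    rw [mul_assoc]
    refine mul_le_mul_of_nonneg_left ?_ hC.le
    have e1 : TFAC.step t 1 = t 1 := by rw [TFAC.step_succ, ht.zero, sub_zero]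
    have hfirst := TFAC.graded_first_step_le (σ := σ) hCγ hτ1 hβ0 hβγ
      (ht.pos le_rfl (show 1 ≤ N by omega)) (ht.le (show 1 ≤ N by omega))
      (e1 ▸ hgrade 1 le_rfl (show 1 ≤ N by omega))
    rw [e1]
    have h1 : t (n + 1) ^ α * tol ≤ T ^ α * tol := mul_le_mul_of_nonneg_right
      (Real.rpow_le_rpow (ht.nonneg hn) (ht.le hn) hα.1.le) htol.le
    have hh2 : 0 ≤ (L / M) ^ 2 := sq_nonneg _
    have h2 : (D0 + D1 + D2) * τ ^ β ≤ (D0 + D1 + D2 + T ^ α + 1) * τ ^ β :=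
      mul_le_mul_of_nonneg_right (by linarith) hτβ
    have h3 : T ^ α * tol ≤ (D0 + D1 + D2 + T ^ α + 1) * tol :=
      mul_le_mul_of_nonneg_right (by linarith) htol.le
    have h4 : 1 * (L / M) ^ 2 ≤ (D0 + D1 + D2 + T ^ α + 1) * (L / M) ^ 2 :=
      mul_le_mul_of_nonneg_right (by linarith) hh2
    linarith
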